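/- Let $m,n,N$ be positive integers. Let $W$ be the set of divisors $Q\mid N$ with $\gcd(Q,N/Q)=1$, a group under $Q*R=QR/\gcd(Q,R)^2$ (the group of Atkin--Lehner involutions of level $N$). Let $H\le W$ be a subgroup and $E:H\to\{\pm1\}$ a group homomorphism. For $Q\in W$ and $f\in S_2(\Gamma_0(N))$ put $$f_{|w_Q}(z)=\frac{Q}{(Nz+Qt)^2}\,f\!\left(\frac{Qz+y}{Nz+Qt}\right),\qquad y,t\in\mathbb Z,\quad Qt-\tfrac NQ\,y=1,$$ which does not depend on the choice of $y,t$. Write $f(z)=\sum_{k\ge1}a_k(f)e^{2i\pi kz}$ and $\langle f,g\rangle=\int_D\overline{f(x+iy)}\,g(x+iy)\,dx\,dy$, where $D$ is a fundamental domain for the action of $\Gamma_0(N)$ on the upper half-plane, and $\|f\|^2=\langle f,f\rangle$. For $c\ge1$ and $a,b\in\mathbb Z/c\mathbb Z$ let $$S(a,b;c)=\sum_{k\in(\mathbb Z/c\mathbb Z)^*}e^{2i\pi(ak+bk^{-1})/c},\qquad J_1(z)=\sum_{k\ge0}\frac{(-1)^k}{k!\,(k+1)!}\left(\frac z2\right)^{2k+1}.$$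 Let $\mathcal B$ be a basis of $S_2(\Gamma_0(N))$, orthogonal for $\langle\cdot,\cdot\rangle$, each of whose members is an eigenvector of $w_Q$ for every $Q\in H$, and set $$(a_m,a_n)_N^E=\sum_{\substack{f\in\mathcal B\\ f_{|w_Q}=E(Q)f\ \text{for all } Q\in H}}\frac{\overline{a_m(f)}\,a_n(f)}{\|f\|^2}.$$ Then for every $Q\in W$ the series $$S_Q=2\pi\sum_{\substack{c>0\\ (N/Q)\mid c,\ \gcd(c,Q)=1}}\frac{S(m,nQ^{-1};c)}{c\sqrt Q}\,J_1\!\left(\frac{4\pi\sqrt{mn}}{c\sqrt Q}\right)$$ (where $Q^{-1}$ denotes the inverse of $Q$ modulo $c$) converges absolutely, and $$\frac{|H|}{4\pi\sqrt{mn}}\,(a_m,a_n)_N^E=\delta_{mn}-\sum_{Q\in H}E(Q)\,S_Q .$$ -/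

import Mathlib

open UpperHalfPlane MeasureTheory
open scoped MatrixGroups ModularForm ComplexConjugate

noncomputable section

/-- The exact divisors `Q ∥ N`, i.e. `Q ∣ N` with `gcd (Q, N / Q) = 1`; they index the
Atkin–Lehner involutions `w_Q` of level `N`. -/
@[ext]
structure ExactDivisor (N : ℕ) where
  val : ℕ
  dvd : val ∣ N
  coprime : Nat.Coprime val (N / val)

namespace ExactDivisor

variable {N : ℕ}

theorem val_ne_zero [NeZero N] (Q : ExactDivisor N) : Q.val ≠ 0 :=
  ne_zero_of_dvd_ne_zero (NeZero.ne N) Q.dvd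

theorem factorization_eq [NeZero N] (Q : ExactDivisor N) (p : ℕ) :
    Q.val.factorization p = 0 ∨ Q.val.factorization p = N.factorization p := by
  have hN : N = Q.val * (N / Q.val) := (Nat.mul_div_cancel' Q.dvd).symm
  have h := Nat.factorization_mul_of_coprime Q.coprime
  rw [← hN] at h
  have hp := DFunLike.congr_fun h p
  rw [Finsupp.add_apply] at hp
  have hd := Nat.Coprime.disjoint_primeFactors Q.coprime
  by_cases h1 : p ∈ Q.val.primeFactors
  · have h2 : p ∉ (N / Q.val).primeFactors := Finset.disjoint_left.1 hd h1
    rw [← Nat.support_factorization, Finsupp.notMem_support_iff] at h2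
    right; omega
  · rw [← Nat.support_factorization, Finsupp.notMem_support_iff] at h1
    exact Or.inl h1

theorem coprime_of_factorization [NeZero N] {q : ℕ} (hq : q ≠ 0)
    (h : ∀ p, q.factorization p = 0 ∨ q.factorization p = N.factorization p) :
    q ∣ N ∧ Nat.Coprime q (N / q) := by
  have hN : N ≠ 0 := NeZero.ne N
  have hdvd : q ∣ N := by
    rw [← Nat.factorization_le_iff_dvd hq hN]
    intro p
    rcases h p with h | h <;> omega
  refine ⟨hdvd, ?_⟩
  have hN' : N / q ≠ 0 := (Nat.div_pos (Nat.le_of_dvd (Nat.pos_of_ne_zero hN) hdvd)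
    (Nat.pos_of_ne_zero hq)).ne'
  refine (Nat.disjoint_primeFactors hq hN').1 (Finset.disjoint_left.2 fun p h1 h2 => ?_)
  rw [← Nat.support_factorization, Finsupp.mem_support_iff] at h1 h2
  rw [Nat.factorization_div hdvd, Finsupp.tsub_apply] at h2
  rcases h p with h | h <;> omega

/-- The group law of the Atkin–Lehner group on exact divisors:
`Q * R = (Q / gcd (Q, R)) (R / gcd (Q, R)) = Q R / gcd (Q, R) ^ 2`. -/
def mulVal (q r : ℕ) : ℕ := (q / Nat.gcd q r) * (r / Nat.gcd q r)

theorem mulVal_ne_zero {q r : ℕ} (hq : q ≠ 0) (hr : r ≠ 0) : mulVal q r ≠ 0 := by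
  have hg : 0 < Nat.gcd q r := Nat.gcd_pos_of_pos_left _ (Nat.pos_of_ne_zero hq)
  exact mul_ne_zero
    (Nat.div_pos (Nat.le_of_dvd (Nat.pos_of_ne_zero hq) (Nat.gcd_dvd_left q r)) hg).ne'
    (Nat.div_pos (Nat.le_of_dvd (Nat.pos_of_ne_zero hr) (Nat.gcd_dvd_right q r)) hg).ne'

theorem factorization_mulVal {q r : ℕ} (hq : q ≠ 0) (hr : r ≠ 0) (p : ℕ) :
    (mulVal q r).factorization p =
      (q.factorization p - min (q.factorization p) (r.factorization p)) +
        (r.factorization p - min (q.factorization p) (r.factorization p)) := by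
  have h := mulVal_ne_zero hq hr
  rw [mulVal] at h ⊢
  rw [Nat.factorization_mul (left_ne_zero_of_mul h) (right_ne_zero_of_mul h),
    Nat.factorization_div (Nat.gcd_dvd_left q r), Nat.factorization_div (Nat.gcd_dvd_right q r),
    Nat.factorization_gcd hq hr]
  simp

variable [NeZero N]

theorem mulVal_mem (Q R : ExactDivisor N) :
    mulVal Q.val R.val ∣ N ∧ Nat.Coprime (mulVal Q.val R.val) (N / mulVal Q.val R.val) := by
  refine coprime_of_factorization (mulVal_ne_zero Q.val_ne_zero R.val_ne_zero) fun p => ?_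
  rw [factorization_mulVal Q.val_ne_zero R.val_ne_zero]
  rcases Q.factorization_eq p with h | h <;> rcases R.factorization_eq p with h' | h' <;>
    rw [h, h'] <;> omega

instance : Mul (ExactDivisor N) :=
  ⟨fun Q R => ⟨mulVal Q.val R.val, (mulVal_mem Q R).1, (mulVal_mem Q R).2⟩⟩

instance : One (ExactDivisor N) := ⟨⟨1, one_dvd N, Nat.coprime_one_left _⟩⟩

instance : Inv (ExactDivisor N) := ⟨id⟩

theorem mul_val (Q R : ExactDivisor N) : (Q * R).val = mulVal Q.val R.val := rfl

theorem one_val : (1 : ExactDivisor N).val = 1 := rfl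

theorem inv_val (Q : ExactDivisor N) : (Q⁻¹).val = Q.val := rfl

/-- The group `W` of Atkin–Lehner involutions of level `N`, identified with the exact divisors of
`N`. -/
instance : CommGroup (ExactDivisor N) where
  mul_assoc Q R S := by
    ext1
    refine Nat.eq_of_factorization_eq (val_ne_zero _) (val_ne_zero _) fun p => ?_
    rw [mul_val, factorization_mulVal (val_ne_zero _) (val_ne_zero _), mul_val,
      factorization_mulVal (val_ne_zero _) (val_ne_zero _), mul_val,
      factorization_mulVal (val_ne_zero _) (val_ne_zero _), mul_val,
      factorization_mulVal (val_ne_zero _) (val_ne_zero _)]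
    rcases Q.factorization_eq p with h | h <;> rcases R.factorization_eq p with h' | h' <;>
      rcases S.factorization_eq p with h'' | h'' <;> rw [h, h', h''] <;> omega
  one_mul Q := by ext1; simp [mul_val, one_val, mulVal]
  mul_one Q := by ext1; simp [mul_val, one_val, mulVal]
  inv_mul_cancel Q := by
    ext1
    simp [mul_val, one_val, inv_val, mulVal, Nat.div_self (Nat.pos_of_ne_zero Q.val_ne_zero)]
  mul_comm Q R := by ext1; simp [mul_val, mulVal, Nat.gcd_comm, mul_comm]

instance : Finite (ExactDivisor N) := by
  refine Finite.of_injective (fun Q : ExactDivisor N => (⟨Q.val, ?_⟩ : Fin (N + 1))) ?_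
  · exact Nat.lt_succ_of_le (Nat.le_of_dvd (Nat.pos_of_ne_zero (NeZero.ne N)) Q.dvd)
  · intro Q R h
    ext1
    simpa using h

/-- The entries of an Atkin–Lehner matrix `W_Q = (Q, y; N, Q t)`, where `y` and `t` are the
integers with `Q t - (N / Q) y = 1` given by the extended Euclidean algorithm. -/
def toMatrix (Q : ExactDivisor N) : Matrix (Fin 2) (Fin 2) ℤ :=
  !![(Q.val : ℤ), -Nat.gcdB Q.val (N / Q.val); (N : ℤ), (Q.val : ℤ) * Nat.gcdA Q.val (N / Q.val)]

theorem det_toMatrix (Q : ExactDivisor N) : Q.toMatrix.det = Q.val := by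
  have h := Nat.gcd_eq_gcd_ab Q.val (N / Q.val)
  rw [Nat.Coprime.gcd_eq_one Q.coprime] at h
  have hN : (N : ℤ) = (Q.val : ℤ) * ((N / Q.val : ℕ) : ℤ) := by
    exact_mod_cast (Nat.mul_div_cancel' Q.dvd).symm
  rw [toMatrix, Matrix.det_fin_two_of]
  push_cast at h hN ⊢
  linear_combination (-(Q.val : ℤ)) * h + Nat.gcdB Q.val (N / Q.val) * hN

/-- The Atkin–Lehner matrix `W_Q`, of determinant `Q`, as an element of `GL₂(ℝ)`. -/
def toGL (Q : ExactDivisor N) : GL (Fin 2) ℝ :=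
  Matrix.GeneralLinearGroup.mkOfDetNeZero (Q.toMatrix.map (Int.castRingHom ℝ)) (by
    rw [← RingHom.mapMatrix_apply, ← RingHom.map_det, det_toMatrix]
    simpa using Q.val_ne_zero)

end ExactDivisor

/-- `S₂(Γ₀(N))`. -/
abbrev CuspForms₂ (N : ℕ) : Type :=
  CuspForm ((CongruenceSubgroup.Gamma0 N).map (Matrix.SpecialLinearGroup.mapGL ℝ)) 2

/-- The Fourier coefficient `a_n(f)`, where `f(z) = ∑ a_n(f) e^{2 i π n z}`. -/
def fourierCoeff₂ {N : ℕ} (n : ℕ) (f : CuspForms₂ N) : ℂ := (qExpansion 1 f).coeff n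

/-- The function `f |_{w_Q} (z) = Q (N z + Q t)⁻² f(W_Q z)`. -/
def atkinLehner {N : ℕ} [NeZero N] (Q : ExactDivisor N) (f : CuspForms₂ N) : ℍ → ℂ :=
  (f : ℍ → ℂ) ∣[(2 : ℤ)] Q.toGL

/-- `D` is a fundamental domain for the action of `Γ₀(N)` on the upper half-plane. As `-1` acts
trivially, this refers to the image of `Γ₀(N)` in the group of permutations of `ℍ`. -/
def IsFundamentalDomainGamma0 (N : ℕ) (D : Set ℍ) : Prop :=
  IsFundamentalDomain (MulAction.toPermHom (CongruenceSubgroup.Gamma0 N) ℍ).range D volume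

/-- The Petersson product `⟨f, g⟩ = ∫_D conj (f(x + i y)) g(x + i y) dx dy`: the integrand below is
`conj (f z) * g z * y ^ 2`, and the measure on `ℍ` is `dx dy / y ^ 2`. -/
def peterssonInner {N : ℕ} (D : Set ℍ) (f g : CuspForms₂ N) : ℂ :=
  ∫ z in D, petersson 2 f g z

/-- A Petersson-orthogonal basis of `S₂(Γ₀(N))` all of whose members are eigenforms of the
Atkin–Lehner involutions `w_Q` with `Q ∈ H`. -/
structure IsAtkinLehnerEigenbasis {N : ℕ} [NeZero N] (D : Set ℍ) (H : Subgroup (ExactDivisor N))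
    {ι : Type*} (B : Module.Basis ι ℂ (CuspForms₂ N)) : Prop where
  orthogonal : ∀ i j, i ≠ j → peterssonInner D (B i) (B j) = 0
  eigenform : ∀ i, ∀ Q ∈ H, ∃ c : ℂ, atkinLehner Q (B i) = c • (B i : ℍ → ℂ)

/-- The weighted sum `∑ conj (a_m(f)) a_n(f) / ‖f‖²` over the members `f` of the basis `B` such that
`f |_{w_Q} = E(Q) f` for all `Q ∈ H`. -/
def restrictedSum {N : ℕ} [NeZero N] (D : Set ℍ) {H : Subgroup (ExactDivisor N)} (E : H →* ℤˣ)
    {ι : Type*} (B : Module.Basis ι ℂ (CuspForms₂ N)) (m n : ℕ) : ℂ :=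
  ∑ᶠ i ∈ {i : ι | ∀ Q : H, atkinLehner (Q : ExactDivisor N) (B i) =
      (((E Q : ℤˣ) : ℤ) : ℂ) • (B i : ℍ → ℂ)},
    conj (fourierCoeff₂ m (B i)) * fourierCoeff₂ n (B i) / peterssonInner D (B i) (B i)

/-- The Kloosterman sum `S(a, b; c) = ∑_{k ∈ (ℤ/cℤ)ˣ} e^{2 i π (a k + b k⁻¹) / c}`, for
`a, b ∈ ℤ/cℤ`. -/
def kloostermanSum (c : ℕ) [NeZero c] (a b : ZMod c) : ℂ :=
  ∑ k : (ZMod c)ˣ, ZMod.stdAddChar (a * (k : ZMod c) + b * ((k⁻¹ : (ZMod c)ˣ) : ZMod c))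

/-- The Bessel function of the first kind and order `1`. -/
def besselJOne (z : ℂ) : ℂ :=
  ∑' k : ℕ, (-1 : ℂ) ^ k / ((k.factorial : ℂ) * ((k + 1).factorial : ℂ)) * (z / 2) ^ (2 * k + 1)

/-- The moduli `c > 0` such that `N / Q` divides `c` and `(c, Q) = 1`. -/
def kloostermanModuli {N : ℕ} (Q : ExactDivisor N) : Set ℕ+ :=
  {c | N / Q.val ∣ (c : ℕ) ∧ Nat.Coprime (c : ℕ) Q.val}

/-- The term `S(m, n Q⁻¹; c) / (c √Q) * J₁(4 π √(m n) / (c √Q))`, where `Q⁻¹` is the inverse of `Q`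
modulo `c`. -/
def kloostermanBesselTerm (m n q : ℕ) (c : ℕ+) : ℂ :=
  kloostermanSum (c : ℕ) (m : ZMod c) ((n : ZMod c) * (q : ZMod c)⁻¹) /
      (((c : ℕ) : ℂ) * (√(q : ℝ) : ℂ)) *
    besselJOne (4 * Real.pi * (√((m : ℝ) * n) : ℂ) / (((c : ℕ) : ℂ) * (√(q : ℝ) : ℂ)))

/-- `S_Q = 2 π ∑_c S(m, n Q⁻¹; c) / (c √Q) * J₁(4 π √(m n) / (c √Q))`. -/
def kloostermanBesselSeries {N : ℕ} (m n : ℕ) (Q : ExactDivisor N) : ℂ :=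
  2 * Real.pi * ∑' c : kloostermanModuli Q, kloostermanBesselTerm m n Q.val c

end

/-! The formula is the Petersson formula averaged over `H`. Let `P` be the Poincaré series of index
m. Unfolding gives ⟨f, P⟩ = conj(a_m(f)) / (4πm) for every cusp form f
(`peterssonInner_poincareForm`), so the coordinate of `P` along a member f of the orthogonal basis
is conj(a_m(f)) / (4πm‖f‖²). The involutions act on f through a character of `H`. Summing E(Q) P|w_Q
over Q in `H` therefore multiplies the f-component by |H| if that character is E and kills it
otherwise, and the n-th coefficient of the sum is |H| / (4πm) times the restricted sum. The n-th
coefficient of P|w_Q is also computed from the series itself, by Lipschitz' formula: it is δ_{mn}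
(for Q = 1 only) minus (n/√(mn)) S_Q (`fourierCoeff₂_atkinLehner_poincareForm_eq_sub`).

The difficulty is the weight: in weight 2 the series ∑ (cz+d)⁻² e(mγz) does not converge absolutely.
It is summed over |cz+d| < R with R → ∞. The action of SL₂(ℤ) carries such a truncation to another
one (`truncatedPoincare_smul`), so the limit is modular without analytic continuation in the weight.
For fixed c the admissible d form an interval. Expanding the phase e(m d⁻¹/c) in additive characters
brings in Kloosterman sums as coefficients. Kloosterman's bound c^{3/4} d(c), from the fourth
moment, and summation by parts then majorize the sum over d by a constant times c^{-9/8} d(c) / y,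
which is summable over c (`exists_norm_sum_poincareTerm_le`). The bound is uniform in R and in the
vector v recording the cusp, so it also gives vanishing at every cusp.

The same truncations justify unfolding. With R = √(y/ε) exactly the terms with Im γz > ε survive, so
the kernel to unfold is integrable. Then ε → 0 by dominated convergence, since both y|f| and y times
the truncated series are bounded and the fundamental domain has finite volume. -/

/-! ### Kloosterman's bound for Kloosterman sums, by the fourth moment. -/

section KloostermanBound

/-- A nonempty fibre is a coset of the n-torsion, which has at most n elements in a cyclic group. -/
theorem ZMod.card_nsmul_eq_le {c : ℕ} [NeZero c] {n : ℕ} (hn : 0 < n) (t : ZMod c) :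
    (Finset.univ.filter fun x : ZMod c => n • x = t).card ≤ n := by
  classical
  rcases (Finset.univ.filter fun x : ZMod c => n • x = t).eq_empty_or_nonempty with h | ⟨y, hy⟩
  · rw [h]; simp
  · refine le_trans ?_ (IsAddCyclic.card_nsmul_eq_zero_le (α := ZMod c) hn)
    refine Finset.card_le_card_of_injOn (fun x => x - y) (fun x hx => ?_) (fun a _ b _ h => ?_)
    · simp only [Finset.coe_filter, Finset.mem_univ, true_and, Set.mem_ofPred_eq,
        Finset.mem_filter] at hx hy ⊢
      rw [nsmul_sub, hx, hy, sub_self]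
    · simpa using h

/-- The additive order of such a `w` divides both `a.val` and c, so `w` is torsion for their gcd. -/
theorem ZMod.card_mul_eq_zero_le {c : ℕ} [NeZero c] (a : ZMod c) :
    (Finset.univ.filter fun w : ZMod c => a * w = 0).card ≤ Nat.gcd a.val c := by
  have hc : 0 < c := Nat.pos_of_ne_zero (NeZero.ne c)
  refine le_trans (Finset.card_le_card ?_)
    (ZMod.card_nsmul_eq_le (c := c) (Nat.gcd_pos_of_pos_right a.val hc) 0)
  intro w hw
  simp only [Finset.mem_filter, Finset.mem_univ, true_and] at hw ⊢
  rw [← addOrderOf_dvd_iff_nsmul_eq_zero]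
  refine Nat.dvd_gcd ?_ ?_ <;> rw [addOrderOf_dvd_iff_nsmul_eq_zero] <;> rw [nsmul_eq_mul]
  · rwa [ZMod.natCast_zmod_val]
  · simp

theorem ZMod.sum_gcd_val_le (c : ℕ) [NeZero c] :
    ∑ u : ZMod c, Nat.gcd u.val c ≤ c * c.divisors.card := by
  have hc : 0 < c := Nat.pos_of_ne_zero (NeZero.ne c)
  calc ∑ u : ZMod c, Nat.gcd u.val c
      ≤ ∑ u : ZMod c, ∑ d ∈ c.divisors, if d ∣ u.val then d else 0 := by
        refine Finset.sum_le_sum fun u _ => ?_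
        have hmem : Nat.gcd u.val c ∈ c.divisors :=
          Nat.mem_divisors.2 ⟨Nat.gcd_dvd_right _ _, hc.ne'⟩
        have := Finset.single_le_sum (f := fun d => if d ∣ u.val then d else 0)
          (fun d _ => Nat.zero_le _) hmem
        simpa [Nat.gcd_dvd_left] using this
    _ = ∑ d ∈ c.divisors, (Finset.univ.filter fun u : ZMod c => d ∣ u.val).card * d := by
        rw [Finset.sum_comm]
        refine Finset.sum_congr rfl fun d _ => ?_
        rw [← Finset.sum_filter, Finset.sum_const, smul_eq_mul]
    _ ≤ ∑ d ∈ c.divisors, c := by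
        refine Finset.sum_le_sum fun d hd => ?_
        have hdc := Nat.dvd_of_mem_divisors hd
        have hcd : 0 < c / d := Nat.div_pos (Nat.le_of_dvd hc hdc) (Nat.pos_of_dvd_of_pos hdc hc)
        have h1 : (Finset.univ.filter fun u : ZMod c => d ∣ u.val).card ≤ c / d := by
          refine le_trans (Finset.card_le_card ?_) (ZMod.card_nsmul_eq_le (c := c) hcd 0)
          intro u hu
          simp only [Finset.mem_filter, Finset.mem_univ, true_and] at hu ⊢
          obtain ⟨k, hk⟩ := hu
          rw [nsmul_eq_mul, ← ZMod.natCast_zmod_val u, hk, ← Nat.cast_mul, ← mul_assoc,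
            Nat.div_mul_cancel hdc]
          simp
        calc _ ≤ c / d * d := Nat.mul_le_mul_right _ h1
          _ = c := Nat.div_mul_cancel hdc
    _ = c * c.divisors.card := by rw [Finset.sum_const, smul_eq_mul, mul_comm]

/-- For fixed u, v the number of w is at most gcd(uv, c) ≤ gcd(u, c) gcd(v, c), and the double sum
factors. -/
theorem ZMod.card_mul_mul_eq_zero_le (c : ℕ) [NeZero c] :
    (Finset.univ.filter fun p : ZMod c × ZMod c × ZMod c => p.1 * p.2.1 * p.2.2 = 0).card ≤
      (c * c.divisors.card) ^ 2 := by
  calc (Finset.univ.filter fun p : ZMod c × ZMod c × ZMod c => p.1 * p.2.1 * p.2.2 = 0).card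
      = ∑ u : ZMod c, ∑ v : ZMod c,
          (Finset.univ.filter fun w : ZMod c => u * v * w = 0).card := by
        simp only [Finset.card_filter, ← Finset.univ_product_univ, Finset.sum_product]
    _ ≤ ∑ u : ZMod c, ∑ v : ZMod c, Nat.gcd u.val c * Nat.gcd v.val c := by
        refine Finset.sum_le_sum fun u _ => Finset.sum_le_sum fun v _ => ?_
        refine (ZMod.card_mul_eq_zero_le (u * v)).trans ?_
        have h1 : Nat.gcd (u * v).val c = Nat.gcd (u.val * v.val) c := by
          rw [ZMod.val_mul, Nat.mod_modEq _ _ |>.gcd_eq]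
        rw [h1]
        have hc : 0 < c := Nat.pos_of_ne_zero (NeZero.ne c)
        refine Nat.le_of_dvd (Nat.mul_pos (Nat.gcd_pos_of_pos_right _ hc)
          (Nat.gcd_pos_of_pos_right _ hc)) ?_
        rw [Nat.gcd_comm, Nat.gcd_comm _ c, Nat.gcd_comm _ c]; exact Nat.gcd_mul_right_dvd_mul_gcd c u.val v.val
    _ = (∑ u : ZMod c, Nat.gcd u.val c) ^ 2 := by
        rw [sq, Finset.sum_mul_sum]
    _ ≤ _ := Nat.pow_le_pow_left (ZMod.sum_gcd_val_le c) 2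

/-- The solutions of `x₁ + x₂ = x₃ + x₄`, `x₁⁻¹ + x₂⁻¹ = x₃⁻¹ + x₄⁻¹` in units modulo `c`. -/
def kloostermanQuadruples (c : ℕ) [NeZero c] :
    Finset (((ZMod c)ˣ × (ZMod c)ˣ) × ((ZMod c)ˣ × (ZMod c)ˣ)) :=
  Finset.univ.filter fun x =>
    (x.1.1 : ZMod c) + x.1.2 - x.2.1 - x.2.2 = 0 ∧
    ((x.1.1⁻¹ : (ZMod c)ˣ) : ZMod c) + ((x.1.2⁻¹ : (ZMod c)ˣ) : ZMod c)
      - ((x.2.1⁻¹ : (ZMod c)ˣ) : ZMod c) - ((x.2.2⁻¹ : (ZMod c)ˣ) : ZMod c) = 0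

/-- Eliminating x₄ and clearing denominators turns the two equations into (x₃ - x₁)(x₃ - x₂)(x₁ +
x₂) = 0. The three factors determine 2x₃, hence x₃ up to two choices, and then the whole quadruple.
-/
theorem card_kloostermanQuadruples_le (c : ℕ) [NeZero c] :
    (kloostermanQuadruples c).card ≤ 2 * (c * c.divisors.card) ^ 2 := by
  classical
  let f : (((ZMod c)ˣ × (ZMod c)ˣ) × ((ZMod c)ˣ × (ZMod c)ˣ)) → ZMod c × ZMod c × ZMod c :=
    fun x => ((x.2.1 : ZMod c) - x.1.1, (x.2.1 : ZMod c) - x.1.2, (x.1.1 : ZMod c) + x.1.2)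
  have himg : (kloostermanQuadruples c).image f ⊆
      Finset.univ.filter fun p : ZMod c × ZMod c × ZMod c => p.1 * p.2.1 * p.2.2 = 0 := by
    intro p hp
    obtain ⟨⟨⟨x1, x2⟩, ⟨x3, x4⟩⟩, hx, rfl⟩ := Finset.mem_image.1 hp
    simp only [kloostermanQuadruples, Finset.mem_filter, Finset.mem_univ, true_and] at hx
    obtain ⟨h1, h2⟩ := hx
    simp only [Finset.mem_filter, Finset.mem_univ, true_and, f]
    have e1 := x1.mul_inv
    have e2 := x2.mul_inv
    have e3 := x3.mul_inv
    have e4 := x4.mul_inv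
    have h4 : (x4 : ZMod c) = x1 + x2 - x3 := by linear_combination -h1
    have key : ((x1 : ZMod c) + x2) * (x3 * x4) - (x3 + x4) * (x1 * x2) = 0 := by
      linear_combination ((x1 : ZMod c) * x2 * x3 * x4) * h2 - ((x2 : ZMod c) * x3 * x4) * e1
        - ((x1 : ZMod c) * x3 * x4) * e2 + ((x1 : ZMod c) * x2 * x4) * e3
        + ((x1 : ZMod c) * x2 * x3) * e4
    rw [h4] at key
    linear_combination -key
  have hfib : ∀ b ∈ (kloostermanQuadruples c).image f,
      ((kloostermanQuadruples c).filter fun a => f a = b).card ≤ 2 := by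
    rintro ⟨u, v, w⟩ -
    refine le_trans ?_ (ZMod.card_nsmul_eq_le (c := c) two_pos (u + v + w))
    refine Finset.card_le_card_of_injOn (fun x => (x.2.1 : ZMod c)) ?_ ?_
    · rintro ⟨⟨x1, x2⟩, ⟨x3, x4⟩⟩ hx
      simp only [Finset.coe_filter, Set.mem_ofPred_eq, f, Prod.mk.injEq] at hx
      simp only [Finset.coe_filter, Finset.mem_univ, true_and, Set.mem_ofPred_eq]
      obtain ⟨-, rfl, rfl, rfl⟩ := hx
      rw [two_nsmul]; ring
    · rintro ⟨⟨x1, x2⟩, ⟨x3, x4⟩⟩ hx ⟨⟨y1, y2⟩, ⟨y3, y4⟩⟩ hy h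
      simp only [Finset.coe_filter, Set.mem_ofPred_eq, f, Prod.mk.injEq, kloostermanQuadruples,
        Finset.mem_filter, Finset.mem_univ, true_and] at hx hy h
      obtain ⟨⟨h1, -⟩, rfl, rfl, rfl⟩ := hx
      obtain ⟨⟨k1, -⟩, k2, k3, k4⟩ := hy
      simp only [Prod.mk.injEq, Units.ext_iff]
      refine ⟨⟨?_, ?_⟩, h, ?_⟩
      · linear_combination k2 + h
      · linear_combination k3 + h
      · linear_combination k1 - h1 - k4 - h
  calc _ ≤ 2 * ((kloostermanQuadruples c).image f).card :=
        Finset.card_le_mul_card_image _ 2 hfib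
    _ ≤ 2 * _ := Nat.mul_le_mul_left 2 ((Finset.card_le_card himg).trans
        (ZMod.card_mul_mul_eq_zero_le c))

/-- Expand the fourth power; orthogonality in a and in b imposes the two equations defining the
quadruples. -/
theorem sum_norm_kloostermanSum_pow_four (c : ℕ) [NeZero c] :
    ∑ a : ZMod c, ∑ b : ZMod c, ‖kloostermanSum c a b‖ ^ 4 =
      c ^ 2 * (kloostermanQuadruples c).card := by
  have hnorm : ∀ z : ℂ, ((‖z‖ ^ 4 : ℝ) : ℂ) = (z * z) * (conj z * conj z) := by
    intro z
    have h : ((‖z‖ ^ 2 : ℝ) : ℂ) = z * conj z := by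
      rw [Complex.mul_conj, Complex.normSq_eq_norm_sq]
    rw [show ‖z‖ ^ 4 = ‖z‖ ^ 2 * ‖z‖ ^ 2 by ring, Complex.ofReal_mul, h]; ring
  have horth : ∀ t : ZMod c, ∑ a : ZMod c, ZMod.stdAddChar (a * t) = if t = 0 then (c : ℂ) else 0 := by
    intro t
    rw [AddChar.sum_mulShift t (ZMod.isPrimitive_stdAddChar c), ZMod.card]
    split_ifs <;> simp
  have key : ∀ a b : ZMod c, ((‖kloostermanSum c a b‖ ^ 4 : ℝ) : ℂ) =
      ∑ x : ((ZMod c)ˣ × (ZMod c)ˣ) × ((ZMod c)ˣ × (ZMod c)ˣ),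
        (ZMod.stdAddChar (a * ((x.1.1 : ZMod c) + (x.1.2 : ZMod c) - (x.2.1 : ZMod c) -
          (x.2.2 : ZMod c))) : ℂ) *
        ZMod.stdAddChar (b * (((x.1.1⁻¹ : (ZMod c)ˣ) : ZMod c) + ((x.1.2⁻¹ : (ZMod c)ˣ) : ZMod c)
          - ((x.2.1⁻¹ : (ZMod c)ˣ) : ZMod c) - ((x.2.2⁻¹ : (ZMod c)ˣ) : ZMod c))) := by
    intro a b
    rw [hnorm, kloostermanSum, map_sum, Finset.sum_mul_sum, Finset.sum_mul_sum,
      ← Finset.sum_product', ← Finset.sum_product', Finset.sum_mul_sum, ← Finset.sum_product']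
    refine Finset.sum_congr rfl fun x _ => ?_
    simp only [← AddChar.map_neg_eq_conj, ← AddChar.map_add_eq_mul]
    congr 1; ring
  have : ((∑ a : ZMod c, ∑ b : ZMod c, ‖kloostermanSum c a b‖ ^ 4 : ℝ) : ℂ) =
      ((c ^ 2 * (kloostermanQuadruples c).card : ℝ) : ℂ) := by
    push_cast
    simp only [← Complex.ofReal_pow, key]
    rw [Finset.sum_congr rfl fun a _ => Finset.sum_comm, Finset.sum_comm]
    simp only [← Finset.mul_sum, ← Finset.sum_mul, horth]
    rw [kloostermanQuadruples, Finset.card_filter, Nat.cast_sum, Finset.mul_sum]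
    refine Finset.sum_congr rfl fun x _ => ?_
    split_ifs <;> first | (push_cast; ring1) | (exfalso; tauto)
  exact_mod_cast this

theorem kloostermanSum_mul_unit (c : ℕ) [NeZero c] (a b : ZMod c) (u : (ZMod c)ˣ) :
    kloostermanSum c (a * u) (b * ((u⁻¹ : (ZMod c)ˣ) : ZMod c)) = kloostermanSum c a b := by
  rw [kloostermanSum, kloostermanSum]
  refine Fintype.sum_equiv (Equiv.mulLeft u) _ _ fun k => ?_
  simp only [Equiv.coe_mulLeft, mul_inv, Units.val_mul]
  congr 1; ring

theorem le_totient_mul_card_divisors (c : ℕ) : c ≤ c.totient * c.divisors.card := by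
  rcases Nat.eq_zero_or_pos c with rfl | hc
  · simp
  calc c = ∑ d ∈ c.divisors, d.totient := (Nat.sum_totient c).symm
    _ ≤ ∑ _d ∈ c.divisors, c.totient := Finset.sum_le_sum fun d hd =>
        Nat.le_of_dvd (Nat.totient_pos.2 hc) (Nat.totient_dvd_of_dvd (Nat.dvd_of_mem_divisors hd))
    _ = _ := by rw [Finset.sum_const, smul_eq_mul, mul_comm]

/-- The sum is constant along the φ(c) pairs (mu, bu⁻¹), all of which occur in the fourth moment. A
given pair arises from at most m units u, because mu is prescribed. -/
theorem totient_mul_norm_kloostermanSum_pow_four_le (c : ℕ) [NeZero c] {m : ℕ} (hm : 0 < m)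
    (b : ZMod c) :
    (c.totient : ℝ) * ‖kloostermanSum c m b‖ ^ 4 ≤
      m * ∑ a : ZMod c, ∑ b : ZMod c, ‖kloostermanSum c a b‖ ^ 4 := by
  classical
  let g : (ZMod c)ˣ → ZMod c × ZMod c := fun u => ((m : ZMod c) * u, b * ((u⁻¹ : (ZMod c)ˣ) : ZMod c))
  have h1 : (c.totient : ℝ) * ‖kloostermanSum c m b‖ ^ 4 =
      ∑ u : (ZMod c)ˣ, ‖kloostermanSum c (g u).1 (g u).2‖ ^ 4 := by
    simp only [g, kloostermanSum_mul_unit, Finset.sum_const, Finset.card_univ,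
      ZMod.card_units_eq_totient, nsmul_eq_mul]
  rw [h1, ← Fintype.sum_prod_type', Finset.mul_sum,
    ← Finset.sum_fiberwise (s := Finset.univ) (g := g)]
  refine Finset.sum_le_sum fun p _ => ?_
  rw [Finset.sum_congr rfl (g := fun _ => ‖kloostermanSum c p.1 p.2‖ ^ 4)]
  · rw [Finset.sum_const, nsmul_eq_mul]
    refine mul_le_mul_of_nonneg_right ?_ (by positivity)
    have : (Finset.univ.filter fun u => g u = p).card ≤ m := by
      refine le_trans ?_ (ZMod.card_nsmul_eq_le (c := c) hm p.1)
      refine Finset.card_le_card_of_injOn (fun u => (u : ZMod c)) ?_ ?_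
      · intro u hu
        simp only [Finset.coe_filter, Finset.mem_univ, true_and, Set.mem_ofPred_eq, g] at hu ⊢
        rw [nsmul_eq_mul, ← hu]
      · intro u _ v _ h
        exact Units.ext h
    exact_mod_cast this
  · intro u hu
    rw [(Finset.mem_filter.1 hu).2]

/-- The moment gives φ(c)|S|⁴ ≤ 2m c⁴ d(c)²; dividing by φ(c) ≥ c / d(c) leaves |S|⁴ ≤ 2m c³ d(c)³.
Any exponent below 1 would beat the trivial bound; uniformity in b is essential later. -/
theorem norm_kloostermanSum_le (c : ℕ) [NeZero c] {m : ℕ} (hm : 0 < m) (b : ZMod c) :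
    ‖kloostermanSum c m b‖ ≤ 2 * m * (c : ℝ) ^ (3 / 4 : ℝ) * c.divisors.card := by
  have hc : 0 < c := Nat.pos_of_ne_zero (NeZero.ne c)
  have hc' : (0 : ℝ) < c := by exact_mod_cast hc
  have hd : (1 : ℝ) ≤ c.divisors.card := by
    exact_mod_cast Finset.card_pos.2 ⟨1, Nat.one_mem_divisors.2 hc.ne'⟩
  have hm' : (1 : ℝ) ≤ m := by exact_mod_cast hm
  have h1 := totient_mul_norm_kloostermanSum_pow_four_le c hm b
  rw [sum_norm_kloostermanSum_pow_four] at h1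
  have h2 : ((kloostermanQuadruples c).card : ℝ) ≤ 2 * (c * c.divisors.card) ^ 2 := by
    exact_mod_cast card_kloostermanQuadruples_le c
  have h3 : (c : ℝ) ≤ c.totient * c.divisors.card := by
    exact_mod_cast le_totient_mul_card_divisors c
  set S := ‖kloostermanSum c m b‖
  set d : ℝ := (c.divisors.card : ℝ)
  have h4 : (c : ℝ) * S ^ 4 ≤ c * (2 * m * c ^ 3 * d ^ 3) := by
    calc (c : ℝ) * S ^ 4 ≤ (c.totient * d) * S ^ 4 := by gcongr
      _ = (c.totient * S ^ 4) * d := by ring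
      _ ≤ (m * (c ^ 2 * (2 * (c * d) ^ 2))) * d := by
          refine mul_le_mul_of_nonneg_right (h1.trans ?_) (by positivity)
          gcongr
      _ = _ := by ring
  have h5 := le_of_mul_le_mul_left h4 hc'
  refine le_of_pow_le_pow_left₀ (n := 4) (by norm_num) (by positivity) (h5.trans ?_)
  have h6 : ((c : ℝ) ^ (3 / 4 : ℝ)) ^ 4 = (c : ℝ) ^ 3 := by
    rw [← Real.rpow_natCast, ← Real.rpow_mul hc'.le]; norm_num
  calc 2 * (m : ℝ) * c ^ 3 * d ^ 3 ≤ (2 * m) ^ 4 * c ^ 3 * d ^ 4 := by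
        gcongr
        · exact le_self_pow₀ (by linarith) (by norm_num)
        · norm_num
    _ = _ := by rw [mul_pow _ d, mul_pow _ ((c : ℝ) ^ (3 / 4 : ℝ)), h6]

end KloostermanBound

/-! ### Sums of (cz+d)⁻² over intervals, twisted by roots of unity. -/

section IncompleteSums

/-- This is the Dirichlet series of ζ² at 9/8. -/
theorem summable_rpow_mul_card_divisors :
    Summable fun c : ℕ+ => ((c : ℕ) : ℝ) ^ (-(9 / 8) : ℝ) * ((c : ℕ).divisors.card : ℝ) := by
  have hz : LSeriesSummable (fun n => ((ArithmeticFunction.zeta : ArithmeticFunction ℂ)) n)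
      ((9 / 8 : ℝ) : ℂ) := by
    have h := (ArithmeticFunction.LSeriesSummable_zeta_iff (s := ((9 / 8 : ℝ) : ℂ))).2
      (by rw [Complex.ofReal_re]; norm_num)
    simpa using h
  have h := ArithmeticFunction.LSeriesSummable_mul hz hz
  have h' := (h.norm).comp_injective PNat.coe_injective
  refine h'.congr fun c => ?_
  have hσ : ((ArithmeticFunction.zeta : ArithmeticFunction ℂ) *
      (ArithmeticFunction.zeta : ArithmeticFunction ℂ)) (c : ℕ) = ((c : ℕ).divisors.card : ℂ) := by
    rw [ArithmeticFunction.coe_zeta_mul_apply]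
    rw [Finset.sum_congr rfl (g := fun _ => (1 : ℂ))]
    · simp
    · intro d hd
      rw [ArithmeticFunction.natCoe_apply, ArithmeticFunction.zeta_apply_ne
        (Nat.pos_of_mem_divisors hd).ne', Nat.cast_one]
  have hc : ((c : ℕ) : ℝ) > 0 := by exact_mod_cast c.pos
  simp only [Function.comp_apply]
  rw [LSeries.term_of_ne_zero c.ne_zero, hσ, norm_div, Complex.norm_natCast,
    Complex.norm_natCast_cpow_of_pos c.pos, Complex.ofReal_re, Real.rpow_neg hc.le]
  rw [div_eq_mul_inv, mul_comm]

/-- The difference is the value of 1/(s² + Y²) at some s in (t, t+1), and s² + Y² ≤ (2 + 2/δ²)(t² +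
Y²) there. In this form the sum over integers telescopes to at most π/Y. -/
theorem inv_sq_add_sq_le_arctan_sub {δ Y : ℝ} (hδ : 0 < δ) (hY : δ ≤ Y) (t : ℝ) :
    (t ^ 2 + Y ^ 2)⁻¹ ≤
      (2 + 2 / δ ^ 2) * (Real.arctan ((t + 1) / Y) / Y - Real.arctan (t / Y) / Y) := by
  have hY0 : 0 < Y := hδ.trans_le hY
  have hd : ∀ s : ℝ, HasDerivAt (fun s => Real.arctan (s / Y) / Y) ((s ^ 2 + Y ^ 2)⁻¹) s := by
    intro s
    have h1 := ((Real.hasDerivAt_arctan (s / Y)).comp s ((hasDerivAt_id s).div_const Y)).div_const Y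
    refine h1.congr_deriv ?_
    field_simp
    ring
  obtain ⟨ξ, hξ, h⟩ := exists_hasDerivAt_eq_slope _ _ (show t < t + 1 by linarith)
    (fun s _ => (hd s).continuousAt.continuousWithinAt) (fun s _ => hd s)
  rw [add_sub_cancel_left, div_one] at h
  rw [← h, ← div_eq_mul_inv, inv_eq_one_div, div_le_div_iff₀ (by positivity) (by positivity)]
  have h1 : ξ ^ 2 ≤ 2 * t ^ 2 + 2 := by
    have : (ξ - t) ^ 2 ≤ 1 := by
      have := hξ.1; have := hξ.2
      nlinarith
    nlinarith [sq_nonneg (ξ - 2 * t)]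
  have h2 : 2 ≤ 2 / δ ^ 2 * Y ^ 2 := by
    rw [div_mul_eq_mul_div, le_div_iff₀ (by positivity)]
    have : δ ^ 2 ≤ Y ^ 2 := by gcongr
    linarith
  have h3 : 0 ≤ 2 / δ ^ 2 * t ^ 2 := by positivity
  nlinarith [sq_nonneg Y]

theorem sum_Ico_inv_sq_add_sq_le {δ Y : ℝ} (hδ : 0 < δ) (hY : δ ≤ Y) (x : ℝ) (a b : ℤ) :
    ∑ d ∈ Finset.Ico a b, ((x + d) ^ 2 + Y ^ 2)⁻¹ ≤ (2 + 2 / δ ^ 2) * (Real.pi / Y) := by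
  have hY0 : 0 < Y := hδ.trans_le hY
  have key : ∀ b, a ≤ b → ∑ d ∈ Finset.Ico a b, ((x + d) ^ 2 + Y ^ 2)⁻¹ ≤
      (2 + 2 / δ ^ 2) * (Real.arctan ((x + b) / Y) / Y - Real.arctan ((x + a) / Y) / Y) := by
    intro b hb
    induction b, hb using Int.leInduction with
    | base => simp
    | succ b hb ih =>
      rw [← Finset.insert_Ico_right_eq_Ico_add_one hb, Finset.sum_insert (by simp)]
      have := inv_sq_add_sq_le_arctan_sub hδ hY (x + b)
      push_cast
      rw [← add_assoc]
      linarith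
  rcases le_total a b with hab | hab
  · refine (key b hab).trans ?_
    gcongr
    rw [← sub_div]
    gcongr
    linarith [Real.arctan_lt_pi_div_two ((x + b) / Y), Real.neg_pi_div_two_lt_arctan ((x + a) / Y)]
  · rw [Finset.Ico_eq_empty (by simpa using hab), Finset.sum_empty]
    positivity

theorem norm_linear_sq (c : ℕ) (z : ℂ) (d : ℤ) :
    ‖(c : ℂ) * z + d‖ ^ 2 = (c * z.re + d) ^ 2 + (c * z.im) ^ 2 := by
  rw [← Complex.normSq_eq_norm_sq, Complex.normSq_apply]
  simp [sq]

theorem mul_im_le_norm_linear (c : ℕ) (z : ℂ) (d : ℤ) : c * z.im ≤ ‖(c : ℂ) * z + d‖ := by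
  have := Complex.im_le_norm ((c : ℂ) * z + d)
  simpa using this

theorem sum_Ico_norm_linear_le {δ : ℝ} (hδ : 0 < δ) {c : ℕ} (hc : 0 < c) {z : ℂ} (hz : δ ≤ z.im)
    (a b : ℤ) :
    ∑ d ∈ Finset.Ico a b, (‖(c : ℂ) * z + d‖ ^ 2)⁻¹ ≤
      (2 + 2 / δ ^ 2) * (Real.pi / (c * z.im)) := by
  simp only [norm_linear_sq]
  refine sum_Ico_inv_sq_add_sq_le hδ ?_ _ a b
  have : (1 : ℝ) ≤ c := by exact_mod_cast hc
  nlinarith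

/-- Summation by parts: a twist by ζ ≠ 1 trades the size of u for its total variation. -/
theorem sum_Ico_zpow_mul_eq {ζ : ℂ} (hζ : ζ ≠ 0) (u : ℤ → ℂ) {a b : ℤ} (hab : a ≤ b) :
    (1 - ζ) * ∑ d ∈ Finset.Ico a b, ζ ^ d * u d =
      ζ ^ a * u a - ζ ^ b * u b + ∑ d ∈ Finset.Ico a b, ζ ^ (d + 1) * (u (d + 1) - u d) := by
  induction b, hab using Int.leInduction with
  | base => simp
  | succ b hb ih =>
    rw [← Finset.insert_Ico_right_eq_Ico_add_one hb, Finset.sum_insert (by simp),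
      Finset.sum_insert (by simp), mul_add, ih, zpow_add_one₀ hζ]
    ring

theorem norm_sum_Ico_zpow_mul_le {ζ : ℂ} (hζ : ‖ζ‖ = 1) (u : ℤ → ℂ) {a b : ℤ} (hab : a ≤ b) :
    ‖1 - ζ‖ * ‖∑ d ∈ Finset.Ico a b, ζ ^ d * u d‖ ≤
      ‖u a‖ + ‖u b‖ + ∑ d ∈ Finset.Ico a b, ‖u (d + 1) - u d‖ := by
  have hζ0 : ζ ≠ 0 := by rintro rfl; simp at hζ
  rw [← norm_mul, sum_Ico_zpow_mul_eq hζ0 u hab]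
  refine (norm_add_le _ _).trans (add_le_add ((norm_sub_le _ _).trans (by simp [hζ])) ?_)
  refine (norm_sum_le _ _).trans (Finset.sum_le_sum fun d _ => ?_)
  simp [hζ]

theorem norm_inv_sq_sub_le {u v : ℂ} {Y : ℝ} (hY : 0 < Y) (hu : Y ≤ ‖u‖) (hv : Y ≤ ‖v‖)
    (huv : ‖u - v‖ ≤ 1) :
    ‖(v ^ 2)⁻¹ - (u ^ 2)⁻¹‖ ≤ 1 / Y * ((‖u‖ ^ 2)⁻¹ + (‖v‖ ^ 2)⁻¹) := by
  have hu0 : u ≠ 0 := norm_pos_iff.1 (hY.trans_le hu)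
  have hv0 : v ≠ 0 := norm_pos_iff.1 (hY.trans_le hv)
  have h1 : (v ^ 2)⁻¹ - (u ^ 2)⁻¹ = (u - v) * (v⁻¹ + u⁻¹) * (u⁻¹ * v⁻¹) := by
    field_simp; ring
  have hu1 : ‖u‖⁻¹ ≤ 1 / Y := by rw [inv_eq_one_div]; gcongr
  have hv1 : ‖v‖⁻¹ ≤ 1 / Y := by rw [inv_eq_one_div]; gcongr
  rw [h1, norm_mul, norm_mul, norm_mul, norm_inv, norm_inv]
  calc ‖u - v‖ * ‖v⁻¹ + u⁻¹‖ * (‖u‖⁻¹ * ‖v‖⁻¹)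
      ≤ 1 * (1 / Y + 1 / Y) * (‖u‖⁻¹ * ‖v‖⁻¹) := by
        gcongr
        refine (norm_add_le _ _).trans ?_
        rw [norm_inv, norm_inv]
        gcongr
    _ = 1 / Y * (2 * ‖u‖⁻¹ * ‖v‖⁻¹) := by ring
    _ ≤ 1 / Y * (‖u‖⁻¹ ^ 2 + ‖v‖⁻¹ ^ 2) := by gcongr; exact two_mul_le_add_sq _ _
    _ = _ := by rw [inv_pow, inv_pow]

/-- With Y = c Im z, the endpoints contribute 2/Y². The variation is at most (1/Y) ∑ (|cz+d|⁻² +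
|cz+d+1|⁻²), hence again of order Y⁻². -/
theorem norm_sum_Ico_zpow_mul_linear_le {δ : ℝ} (hδ : 0 < δ) {c : ℕ} (hc : 0 < c) {z : ℂ}
    (hz : δ ≤ z.im) {ζ : ℂ} (hζ : ‖ζ‖ = 1) (a b : ℤ) :
    ‖1 - ζ‖ * ‖∑ d ∈ Finset.Ico a b, ζ ^ d * (((c : ℂ) * z + d) ^ 2)⁻¹‖ ≤
      (2 + 2 * (2 + 2 / δ ^ 2) * Real.pi) / (c * z.im) ^ 2 := by
  have hz0 : 0 < z.im := hδ.trans_le hz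
  have hc0 : (0 : ℝ) < c := by exact_mod_cast hc
  have hY : 0 < c * z.im := by positivity
  rcases le_total a b with hab | hab
  · refine (norm_sum_Ico_zpow_mul_le hζ _ hab).trans ?_
    have hs : ∀ d : ℤ, ‖(((c : ℂ) * z + d) ^ 2)⁻¹‖ ≤ 1 / (c * z.im) ^ 2 := by
      intro d
      rw [norm_inv, norm_pow, inv_eq_one_div]
      have := mul_im_le_norm_linear c z d
      gcongr
    have hT : ∑ d ∈ Finset.Ico a b, ‖(((c : ℂ) * z + (d + 1 : ℤ)) ^ 2)⁻¹ -
        (((c : ℂ) * z + d) ^ 2)⁻¹‖ ≤ 2 * (2 + 2 / δ ^ 2) * Real.pi / (c * z.im) ^ 2 := by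
      calc _ ≤ ∑ d ∈ Finset.Ico a b, 1 / (c * z.im) * ((‖(c : ℂ) * z + d‖ ^ 2)⁻¹ +
            (‖(c : ℂ) * z + (d + 1 : ℤ)‖ ^ 2)⁻¹) := by
            refine Finset.sum_le_sum fun d _ => ?_
            refine norm_inv_sq_sub_le hY (mul_im_le_norm_linear c z d)
              (mul_im_le_norm_linear c z (d + 1)) ?_
            push_cast
            rw [show (c : ℂ) * z + d - (c * z + (d + 1)) = -1 by ring]
            simp
        _ = 1 / (c * z.im) * (∑ d ∈ Finset.Ico a b, (‖(c : ℂ) * z + d‖ ^ 2)⁻¹ +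
            ∑ d ∈ Finset.Ico (a + 1) (b + 1), (‖(c : ℂ) * z + d‖ ^ 2)⁻¹) := by
            rw [← Finset.mul_sum, Finset.sum_add_distrib, ← Finset.map_add_right_Ico a b 1,
              Finset.sum_map]
            rfl
        _ ≤ 1 / (c * z.im) * ((2 + 2 / δ ^ 2) * (Real.pi / (c * z.im)) +
            (2 + 2 / δ ^ 2) * (Real.pi / (c * z.im))) := by
            gcongr <;> exact sum_Ico_norm_linear_le hδ hc hz _ _
        _ = _ := by field_simp; ring
    refine (add_le_add (add_le_add (hs a) (hs b)) hT).trans (le_of_eq ?_)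
    ring
  · rw [Finset.Ico_eq_empty (by simpa using hab), Finset.sum_empty, norm_zero, mul_zero]
    positivity

/-- The right side is 2|sin(πk/q)| with k = `μ.val`; apply sin x ≥ 2x/π on [0, π/2], after
reflecting when k > q/2. -/
theorem le_norm_one_sub_stdAddChar (q : ℕ) [NeZero q] (μ : ZMod q) :
    4 * (min (μ.val : ℝ) (q - μ.val)) / q ≤ ‖1 - (ZMod.stdAddChar μ : ℂ)‖ := by
  have hq : (0 : ℝ) < q := by exact_mod_cast Nat.pos_of_ne_zero (NeZero.ne q)
  have hk : (μ.val : ℝ) ≤ q := by exact_mod_cast (ZMod.val_lt μ).le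
  set k : ℝ := (μ.val : ℝ) with hkdef
  have hk0 : 0 ≤ k := by positivity
  have h1 : (ZMod.stdAddChar μ : ℂ) = Complex.exp (Complex.I * ((2 * Real.pi * k / q : ℝ) : ℂ)) := by
    have h := ZMod.stdAddChar_coe (N := q) (μ.val : ℤ)
    rw [Int.cast_natCast, ZMod.natCast_zmod_val] at h
    rw [h, hkdef]
    congr 1; push_cast; ring
  rw [norm_sub_rev, h1, Complex.norm_exp_I_mul_ofReal_sub_one,
    show 2 * Real.pi * k / q / 2 = Real.pi * k / q by ring, norm_mul, Real.norm_ofNat, Real.norm_eq_abs]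
  have hpi := Real.pi_pos
  rcases le_total k (q - k) with h | h
  · rw [min_eq_left h]
    have h2 : Real.pi * k / q ≤ Real.pi / 2 := by
      rw [div_le_div_iff₀ hq two_pos]; nlinarith
    have := Real.mul_le_sin (x := Real.pi * k / q) (by positivity) h2
    have h3 : 2 / Real.pi * (Real.pi * k / q) = 2 * k / q := by field_simp
    rw [h3] at this
    have h4 := le_abs_self (Real.sin (Real.pi * k / q))
    rw [mul_div_assoc] at this ⊢
    linarith
  · rw [min_eq_right h]
    have h2 : Real.pi * (q - k) / q ≤ Real.pi / 2 := by
      rw [div_le_div_iff₀ hq two_pos]; nlinarith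
    have := Real.mul_le_sin (x := Real.pi * (q - k) / q)
      (div_nonneg (mul_nonneg hpi.le (by linarith)) hq.le) h2
    have h3 : 2 / Real.pi * (Real.pi * (q - k) / q) = 2 * (q - k) / q := by field_simp
    have h5 : Real.pi * (q - k) / q = Real.pi - Real.pi * k / q := by field_simp
    rw [h3, h5, Real.sin_pi_sub] at this
    have h4 := le_abs_self (Real.sin (Real.pi * k / q))
    rw [mul_div_assoc] at this ⊢
    linarith

/-- The chord bound reduces this to two harmonic sums, exchanged by μ ↦ -μ. -/
theorem sum_inv_norm_one_sub_stdAddChar_le (q : ℕ) [NeZero q] :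
    ∑ μ : ZMod q, (if (ZMod.stdAddChar μ : ℂ) = 1 then 0 else ‖1 - (ZMod.stdAddChar μ : ℂ)‖⁻¹) ≤
      q * (1 + Real.log q) := by
  have hq : (0 : ℝ) < q := by exact_mod_cast Nat.pos_of_ne_zero (NeZero.ne q)
  have hone : 1 ≤ q := Nat.one_le_iff_ne_zero.2 (NeZero.ne q)
  have hterm : ∀ μ : ZMod q,
      (if (ZMod.stdAddChar μ : ℂ) = 1 then 0 else ‖1 - (ZMod.stdAddChar μ : ℂ)‖⁻¹) ≤
      (q / 4 : ℝ) * ((μ.val : ℝ)⁻¹ + (if μ = 0 then 0 else ((q : ℝ) - μ.val)⁻¹)) := by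
    intro μ
    by_cases hμ : μ = 0
    · simp [hμ]
    have hk0 : (0 : ℝ) < μ.val := by
      exact_mod_cast Nat.pos_of_ne_zero (mt (ZMod.val_eq_zero μ).1 hμ)
    have hk : (0 : ℝ) < q - μ.val := by
      have : (μ.val : ℝ) < q := by exact_mod_cast ZMod.val_lt μ
      linarith
    rw [if_neg hμ]
    split_ifs with h1
    · positivity
    have h2 := le_norm_one_sub_stdAddChar q μ
    have hmin : 0 < min (μ.val : ℝ) (q - μ.val) := lt_min hk0 hk
    calc ‖1 - (ZMod.stdAddChar μ : ℂ)‖⁻¹ ≤ (4 * (min (μ.val : ℝ) (q - μ.val)) / q)⁻¹ :=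
          inv_anti₀ (by positivity) h2
      _ = q / 4 * (min (μ.val : ℝ) (q - μ.val))⁻¹ := by field_simp
      _ ≤ _ := by
          gcongr
          rcases le_total (μ.val : ℝ) (q - μ.val) with h | h
          · rw [min_eq_left h]; linarith [inv_pos.2 hk]
          · rw [min_eq_right h]; linarith [inv_pos.2 hk0]
  refine (Finset.sum_le_sum fun μ _ => hterm μ).trans ?_
  rw [← Finset.mul_sum, Finset.sum_add_distrib]
  have hH : ∑ μ : ZMod q, (μ.val : ℝ)⁻¹ ≤ 1 + Real.log q := by
    have h1 : ∑ μ : ZMod q, (μ.val : ℝ)⁻¹ ≤ ∑ k ∈ Finset.range (q + 1), (k : ℝ)⁻¹ := by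
      rw [← Finset.sum_image (f := fun k : ℕ => (k : ℝ)⁻¹) (g := fun μ : ZMod q => μ.val)
        (fun a _ b _ h => ZMod.val_injective q h)]
      refine Finset.sum_le_sum_of_subset_of_nonneg ?_ fun _ _ _ => by positivity
      intro k hk
      obtain ⟨μ, -, rfl⟩ := Finset.mem_image.1 hk
      exact Finset.mem_range.2 ((ZMod.val_lt μ).trans (Nat.lt_succ_self q))
    refine h1.trans ?_
    have h2 := harmonic_le_one_add_log q
    rw [harmonic] at h2
    rw [Finset.sum_range_succ', Nat.cast_zero, inv_zero, add_zero]
    push_cast at h2 ⊢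
    exact h2
  have hneg : ∑ μ : ZMod q, (if μ = 0 then 0 else ((q : ℝ) - μ.val)⁻¹) =
      ∑ μ : ZMod q, (μ.val : ℝ)⁻¹ := by
    refine Fintype.sum_equiv (Equiv.neg _) _ _ fun μ => ?_
    simp only [Equiv.neg_apply, ZMod.neg_val]
    split_ifs with h
    · simp
    · rw [Nat.cast_sub (ZMod.val_lt μ).le]
  rw [hneg]
  have hl : 0 ≤ Real.log q := Real.log_nonneg (by exact_mod_cast hone)
  nlinarith

end IncompleteSums

/-! ### Partial Poincaré sums with a fixed lower left entry c. -/

noncomputable section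

/-- The function `d ↦ e(m d⁻¹ / c)` on units modulo `c`, extended by zero. -/
def kloostermanPhase (m c : ℕ) [NeZero c] (d : ZMod c) : ℂ :=
  open Classical in if IsUnit d then ZMod.stdAddChar ((m : ZMod c) * d⁻¹) else 0

/-- Finite Fourier inversion: the Fourier coefficients of d ↦ e(m d⁻¹/c), supported on units, are
Kloosterman sums. -/
theorem kloostermanPhase_eq (m c : ℕ) [NeZero c] (d : ZMod c) :
    kloostermanPhase m c d =
      (c : ℂ)⁻¹ * ∑ n : ZMod c, kloostermanSum c m (-n) * ZMod.stdAddChar (n * d) := by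
  classical
  have hc : (c : ℂ) ≠ 0 := by exact_mod_cast NeZero.ne c
  rw [eq_inv_mul_iff_mul_eq₀ hc]
  have h1 : ∀ n : ZMod c, kloostermanSum c m (-n) * ZMod.stdAddChar (n * d) =
      ∑ k : (ZMod c)ˣ, (ZMod.stdAddChar ((m : ZMod c) * (k : ZMod c)) : ℂ) *
        ZMod.stdAddChar (n * (d - ((k⁻¹ : (ZMod c)ˣ) : ZMod c))) := by
    intro n
    rw [kloostermanSum, Finset.sum_mul]
    refine Finset.sum_congr rfl fun k _ => ?_
    rw [← AddChar.map_add_eq_mul, ← AddChar.map_add_eq_mul]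
    congr 1; ring
  simp_rw [h1]
  rw [Finset.sum_comm]
  simp_rw [← Finset.mul_sum]
  have h2 : ∀ k : (ZMod c)ˣ, ∑ n : ZMod c,
      (ZMod.stdAddChar (n * (d - ((k⁻¹ : (ZMod c)ˣ) : ZMod c))) : ℂ) =
      if d = ((k⁻¹ : (ZMod c)ˣ) : ZMod c) then (c : ℂ) else 0 := by
    intro k
    rw [AddChar.sum_mulShift _ (ZMod.isPrimitive_stdAddChar c), ZMod.card]
    simp only [sub_eq_zero]
    split_ifs <;> simp
  simp_rw [h2]
  rw [kloostermanPhase]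
  split_ifs with hd
  · obtain ⟨u, rfl⟩ := hd
    rw [Finset.sum_eq_single u⁻¹]
    · simp [mul_comm]
    · intro k _ hk
      rw [if_neg, mul_zero]
      intro h
      exact hk (by rw [Units.val_inj.1 h, inv_inv])
    · simp
  · rw [mul_zero, eq_comm]
    refine Finset.sum_eq_zero fun k _ => ?_
    rw [if_neg, mul_zero]
    rintro rfl
    exact hd (Units.isUnit _)

theorem dvd_indicator_eq (N : ℕ) [NeZero N] (x : ℤ) :
    (if (N : ℤ) ∣ x then (1 : ℂ) else 0) =
      (N : ℂ)⁻¹ * ∑ t : ZMod N, (ZMod.stdAddChar (t * (x : ZMod N)) : ℂ) := by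
  classical
  have hN : (N : ℂ) ≠ 0 := by exact_mod_cast NeZero.ne N
  rw [AddChar.sum_mulShift _ (ZMod.isPrimitive_stdAddChar N), ZMod.card]
  simp only [ZMod.intCast_zmod_eq_zero_iff_dvd]
  split_ifs <;> simp [hN]

theorem stdAddChar_mul_stdAddChar (c N : ℕ) [NeZero c] [NeZero N] (n : ZMod c) (s : ZMod N) :
    (ZMod.stdAddChar n : ℂ) * ZMod.stdAddChar s =
      ZMod.stdAddChar ((n.val * N + s.val * c : ℕ) : ZMod (c * N)) := by
  have hc : (c : ℂ) ≠ 0 := by exact_mod_cast NeZero.ne c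
  have hN : (N : ℂ) ≠ 0 := by exact_mod_cast NeZero.ne N
  have h1 := ZMod.stdAddChar_coe (N := c) (n.val : ℤ)
  have h2 := ZMod.stdAddChar_coe (N := N) (s.val : ℤ)
  have h3 := ZMod.stdAddChar_coe (N := c * N) ((n.val * N + s.val * c : ℕ) : ℤ)
  rw [Int.cast_natCast, ZMod.natCast_zmod_val] at h1 h2
  rw [Int.cast_natCast] at h3
  rw [h1, h2, h3, ← Complex.exp_add]
  congr 1
  push_cast
  field_simp

/-- For fixed s, the products are distinct cN-th roots of unity as n varies. -/
theorem sum_stdAddChar_mul_le (c N : ℕ) [NeZero c] [NeZero N] (s : ZMod N) {f : ℂ → ℝ}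
    (hf : ∀ z, 0 ≤ f z) :
    ∑ n : ZMod c, f (ZMod.stdAddChar n * ZMod.stdAddChar s) ≤
      ∑ μ : ZMod (c * N), f (ZMod.stdAddChar μ) := by
  classical
  simp only [stdAddChar_mul_stdAddChar]
  have hinj : Function.Injective fun n : ZMod c =>
      ((n.val * N + s.val * c : ℕ) : ZMod (c * N)) := by
    intro n n' h
    have h1 : (ZMod.stdAddChar n : ℂ) * ZMod.stdAddChar s =
        ZMod.stdAddChar n' * ZMod.stdAddChar s := by
      rw [stdAddChar_mul_stdAddChar, stdAddChar_mul_stdAddChar]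
      exact congrArg _ h
    have h2 : (ZMod.stdAddChar s : ℂ) ≠ 0 := by
      intro h0
      have := AddChar.norm_apply (ZMod.stdAddChar (N := N)) s
      rw [h0] at this; simp at this
    exact ZMod.injective_stdAddChar (mul_right_cancel₀ h2 h1)
  rw [← Finset.sum_image (f := fun μ : ZMod (c * N) => f (ZMod.stdAddChar μ))
    (fun a _ b _ h => hinj h)]
  exact Finset.sum_le_sum_of_subset_of_nonneg (Finset.subset_univ _) fun _ _ _ => hf _

/-- The condition `N ∣ c v₁ + d v₂` on `(c, d)`. -/
def rowWeight (N : ℕ) (v : ℤ × ℤ) (c d : ℤ) : ℂ :=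
  if (N : ℤ) ∣ c * v.1 + d * v.2 then 1 else 0

/-- Once the congruence modulo N and the phase modulo c are both written in additive characters, d
enters only through u(d) and powers of one root of unity. -/
theorem sum_rowWeight_mul_kloostermanPhase (N : ℕ) [NeZero N] (v : ℤ × ℤ) (m c : ℕ) [NeZero c]
    (u : ℤ → ℂ) (s : Finset ℤ) :
    ∑ d ∈ s, rowWeight N v c d * kloostermanPhase m c d * u d =
      (N : ℂ)⁻¹ * ∑ t : ZMod N, ZMod.stdAddChar (t * ((c * v.1 : ℤ) : ZMod N)) *
        ((c : ℂ)⁻¹ * ∑ n : ZMod c, kloostermanSum c m (-n) *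
          ∑ d ∈ s, ((ZMod.stdAddChar n : ℂ) * ZMod.stdAddChar (t * (v.2 : ZMod N))) ^ d * u d) := by
  have key : ∀ d : ℤ, rowWeight N v c d * kloostermanPhase m c d * u d =
      ∑ t : ZMod N, ∑ n : ZMod c, (N : ℂ)⁻¹ * (ZMod.stdAddChar (t * ((c * v.1 : ℤ) : ZMod N)) *
        ((c : ℂ)⁻¹ * (kloostermanSum c m (-n) *
          (((ZMod.stdAddChar n : ℂ) * ZMod.stdAddChar (t * (v.2 : ZMod N))) ^ d * u d)))) := by
    intro d
    rw [rowWeight, dvd_indicator_eq, kloostermanPhase_eq, mul_mul_mul_comm, Finset.sum_mul_sum,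
      Finset.mul_sum, Finset.sum_mul]
    refine Finset.sum_congr rfl fun t _ => ?_
    rw [Finset.mul_sum, Finset.sum_mul]
    refine Finset.sum_congr rfl fun n _ => ?_
    have h1 : (ZMod.stdAddChar (t * ((c * v.1 + d * v.2 : ℤ) : ZMod N)) : ℂ) =
        ZMod.stdAddChar (t * ((c * v.1 : ℤ) : ZMod N)) *
          ZMod.stdAddChar (t * (v.2 : ZMod N)) ^ d := by
      rw [← AddChar.map_zsmul_eq_zpow, ← AddChar.map_add_eq_mul]
      congr 1; push_cast; rw [zsmul_eq_mul]; ring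
    have h2 : (ZMod.stdAddChar (n * (d : ZMod c)) : ℂ) = ZMod.stdAddChar n ^ d := by
      rw [← AddChar.map_zsmul_eq_zpow]; congr 1; rw [zsmul_eq_mul, mul_comm]
    rw [h1, h2, mul_zpow]
    ring
  simp only [key, Finset.mul_sum]
  rw [Finset.sum_comm]
  exact Finset.sum_congr rfl fun t _ => Finset.sum_comm

theorem norm_rowWeight_le (N : ℕ) (v : ℤ × ℤ) (c d : ℤ) : ‖rowWeight N v c d‖ ≤ 1 := by
  rw [rowWeight]; split_ifs <;> simp

theorem norm_kloostermanPhase_le (m c : ℕ) [NeZero c] (d : ZMod c) :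
    ‖kloostermanPhase m c d‖ ≤ 1 := by
  rw [kloostermanPhase]; split_ifs <;> simp [AddChar.norm_apply]

/-- The majorant of the partial Poincaré sums with lower left entry `c`. -/
def poincareMajorant (c : ℕ) : ℝ := (c : ℝ) ^ (-(9 / 8) : ℝ) * (c.divisors.card : ℝ)

theorem poincareMajorant_nonneg (c : ℕ) : 0 ≤ poincareMajorant c := by
  unfold poincareMajorant; positivity

theorem inv_sq_le_poincareMajorant {c : ℕ} (hc : 0 < c) : ((c : ℝ) ^ 2)⁻¹ ≤ poincareMajorant c := by
  have hc1 : (1 : ℝ) ≤ c := by exact_mod_cast hc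
  have hd : (1 : ℝ) ≤ c.divisors.card := by
    exact_mod_cast Finset.card_pos.2 ⟨1, Nat.one_mem_divisors.2 hc.ne'⟩
  have h1 : ((c : ℝ) ^ 2)⁻¹ ≤ (c : ℝ) ^ (-(9 / 8) : ℝ) := by
    rw [← Real.rpow_natCast, ← Real.rpow_neg (by positivity)]
    exact Real.rpow_le_rpow_of_exponent_le hc1 (by norm_num)
  exact h1.trans (le_mul_of_one_le_right (by positivity) hd)

/-- The trivial twist, which occurs at most once, is bounded absolutely by `A`; every other root ζ
is bounded by `V` / |1 - ζ|. The sum is then enlarged to all cN-th roots of unity. -/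
theorem norm_sum_twist_le {N : ℕ} [NeZero N] {δ : ℝ} (hδ : 0 < δ) (c : ℕ) [NeZero c] {z : ℂ}
    (hz : δ ≤ z.im) (s : ZMod N) (a b : ℤ) :
    ∑ n : ZMod c, ‖∑ d ∈ Finset.Ico a b,
        ((ZMod.stdAddChar n : ℂ) * ZMod.stdAddChar s) ^ d * (((c : ℂ) * z + d) ^ 2)⁻¹‖ ≤
      (2 + 2 / δ ^ 2) * (Real.pi / (c * z.im)) +
        (2 + 2 * (2 + 2 / δ ^ 2) * Real.pi) / (c * z.im) ^ 2 *
          ((c * N : ℕ) * (1 + Real.log (c * N : ℕ))) := by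
  have hc : 0 < c := Nat.pos_of_ne_zero (NeZero.ne c)
  have hz0 : 0 < z.im := hδ.trans_le hz
  set A := (2 + 2 / δ ^ 2) * (Real.pi / (c * z.im)) with hA
  set V := (2 + 2 * (2 + 2 / δ ^ 2) * Real.pi) / (c * z.im) ^ 2 with hV
  have hA0 : 0 ≤ A := by have := Real.pi_pos; positivity
  have hV0 : 0 ≤ V := by have := Real.pi_pos; positivity
  let f : ℂ → ℝ := fun ζ => if ζ = 1 then A else V * ‖1 - ζ‖⁻¹
  have hf : ∀ ζ, 0 ≤ f ζ := fun ζ => by simp only [f]; split_ifs <;> positivity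
  have hterm : ∀ n : ZMod c, ‖∑ d ∈ Finset.Ico a b,
      ((ZMod.stdAddChar n : ℂ) * ZMod.stdAddChar s) ^ d * (((c : ℂ) * z + d) ^ 2)⁻¹‖ ≤
      f (ZMod.stdAddChar n * ZMod.stdAddChar s) := by
    intro n
    have hζ : ‖(ZMod.stdAddChar n : ℂ) * ZMod.stdAddChar s‖ = 1 := by
      rw [norm_mul, AddChar.norm_apply, AddChar.norm_apply, one_mul]
    set ζ := (ZMod.stdAddChar n : ℂ) * ZMod.stdAddChar s
    simp only [f]
    split_ifs with h
    · rw [h]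
      refine (norm_sum_le _ _).trans ((Finset.sum_le_sum fun d _ => ?_).trans
        (sum_Ico_norm_linear_le hδ hc hz a b))
      simp
    · have h1 : 0 < ‖1 - ζ‖ := norm_pos_iff.2 (sub_ne_zero.2 (Ne.symm h))
      rw [← div_eq_mul_inv, le_div_iff₀ h1, mul_comm]
      exact norm_sum_Ico_zpow_mul_linear_le hδ hc hz hζ a b
  refine (Finset.sum_le_sum fun n _ => hterm n).trans ((sum_stdAddChar_mul_le c N s hf).trans ?_)
  have h2 : ∀ μ : ZMod (c * N), f (ZMod.stdAddChar μ) = (if μ = 0 then A else 0) +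
      V * (if (ZMod.stdAddChar μ : ℂ) = 1 then 0 else ‖1 - (ZMod.stdAddChar μ : ℂ)‖⁻¹) := by
    intro μ
    have hiff : (ZMod.stdAddChar μ : ℂ) = 1 ↔ μ = 0 := by
      rw [← AddChar.map_zero_eq_one (ZMod.stdAddChar (N := c * N))]
      exact ZMod.injective_stdAddChar.eq_iff
    simp only [f, hiff]
    split_ifs <;> simp
  simp only [h2]
  rw [Finset.sum_add_distrib, ← Finset.mul_sum, Finset.sum_ite_eq' Finset.univ (0 : ZMod (c * N))]
  simp only [Finset.mem_univ, if_true]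
  have := sum_inv_norm_one_sub_stdAddChar_le (c * N)
  gcongr

theorem one_add_log_le {x : ℝ} (hx : 1 ≤ x) : 1 + Real.log x ≤ 9 * x ^ (1 / 8 : ℝ) := by
  have h1 := Real.log_le_rpow_div (x := x) (ε := 1 / 8) (by linarith) (by norm_num)
  have h2 : 1 ≤ x ^ (1 / 8 : ℝ) := Real.one_le_rpow hx (by norm_num)
  linarith [show x ^ (1 / 8 : ℝ) / (1 / 8) = 8 * x ^ (1 / 8 : ℝ) by ring]

/-- Exponent of c: -1 from Fourier inversion, 3/4 from the Kloosterman sums, -1 + 1/8 from the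
twisted sums including the logarithm. The total is -9/8, below -1 as needed. -/
theorem norm_sum_rowWeight_mul_kloostermanPhase_le (N : ℕ) [NeZero N] {m : ℕ} (hm : 0 < m) {δ : ℝ}
    (hδ : 0 < δ) : ∃ C, 0 ≤ C ∧ ∀ (v : ℤ × ℤ) (c : ℕ) [NeZero c] (z : ℂ), δ ≤ z.im → ∀ a b : ℤ,
      ‖∑ d ∈ Finset.Ico a b, rowWeight N v c d * kloostermanPhase m c d *
        (((c : ℂ) * z + d) ^ 2)⁻¹‖ ≤ C * poincareMajorant c / z.im := by
  have hpi := Real.pi_pos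
  have hN : 0 < N := Nat.pos_of_ne_zero (NeZero.ne N)
  have hN1 : (1 : ℝ) ≤ N := by exact_mod_cast hN
  set K := 2 + 2 / δ ^ 2 with hK
  have hK0 : 0 ≤ K := by positivity
  refine ⟨2 * m * (K * Real.pi + (2 + 2 * K * Real.pi) / δ * (N * (9 * (N : ℝ) ^ (1 / 8 : ℝ)))),
    by positivity, ?_⟩
  intro v c _ z hz a b
  have hc : 0 < c := Nat.pos_of_ne_zero (NeZero.ne c)
  have hc1 : (1 : ℝ) ≤ c := by exact_mod_cast hc
  have hz0 : 0 < z.im := hδ.trans_le hz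
  set y := z.im with hy
  set d : ℝ := (c.divisors.card : ℝ) with hd
  rw [sum_rowWeight_mul_kloostermanPhase]
  have hinner : ∀ t : ZMod N, ‖(ZMod.stdAddChar (t * ((c * v.1 : ℤ) : ZMod N)) : ℂ) *
        ((c : ℂ)⁻¹ * ∑ n : ZMod c, kloostermanSum c m (-n) *
          ∑ d ∈ Finset.Ico a b, ((ZMod.stdAddChar n : ℂ) *
            ZMod.stdAddChar (t * (v.2 : ZMod N))) ^ d * (((c : ℂ) * z + d) ^ 2)⁻¹)‖ ≤
      (c : ℝ)⁻¹ * (2 * m * (c : ℝ) ^ (3 / 4 : ℝ) * d * (K * (Real.pi / (c * y)) +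
        (2 + 2 * K * Real.pi) / (c * y) ^ 2 * ((c * N : ℕ) * (1 + Real.log (c * N : ℕ))))) := by
    intro t
    rw [norm_mul, AddChar.norm_apply, one_mul, norm_mul, norm_inv, Complex.norm_natCast]
    gcongr
    refine (norm_sum_le _ _).trans ?_
    refine le_trans ?_ (mul_le_mul_of_nonneg_left
      (norm_sum_twist_le hδ c hz (t * (v.2 : ZMod N)) a b) (by positivity))
    rw [Finset.mul_sum]
    refine Finset.sum_le_sum fun n _ => ?_
    rw [norm_mul]
    gcongr
    exact norm_kloostermanSum_le c hm _
  rw [norm_mul, norm_inv, Complex.norm_natCast]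
  have hsum := (norm_sum_le (Finset.univ : Finset (ZMod N)) _).trans
    (Finset.sum_le_sum fun t _ => hinner t)
  rw [Finset.sum_const, Finset.card_univ, ZMod.card, nsmul_eq_mul] at hsum
  have hlog : 1 + Real.log (c * N : ℕ) ≤ 9 * ((c : ℝ) ^ (1 / 8 : ℝ) * (N : ℝ) ^ (1 / 8 : ℝ)) := by
    rw [← Real.mul_rpow (by positivity) (by positivity), Nat.cast_mul]
    exact one_add_log_le (by nlinarith)
  calc _ ≤ (N : ℝ)⁻¹ * (N * ((c : ℝ)⁻¹ * (2 * m * (c : ℝ) ^ (3 / 4 : ℝ) * d *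
          (K * (Real.pi / (c * y)) + (2 + 2 * K * Real.pi) / (c * y) ^ 2 *
            ((c * N : ℕ) * (1 + Real.log (c * N : ℕ))))))) := by gcongr
    _ = (c : ℝ)⁻¹ * (2 * m * (c : ℝ) ^ (3 / 4 : ℝ) * d * (K * (Real.pi / (c * y)) +
        (2 + 2 * K * Real.pi) / (c * y) ^ 2 *
          ((c * N : ℕ) * (1 + Real.log (c * N : ℕ))))) := by field_simp
    _ ≤ (c : ℝ)⁻¹ * (2 * m * (c : ℝ) ^ (3 / 4 : ℝ) * d * (K * (Real.pi / (c * y)) *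
          (c : ℝ) ^ (1 / 8 : ℝ) +
        (2 + 2 * K * Real.pi) / (c * y * (c * δ)) * ((c * N : ℕ) *
          (9 * ((c : ℝ) ^ (1 / 8 : ℝ) * (N : ℝ) ^ (1 / 8 : ℝ)))))) := by
        have h8 : (1 : ℝ) ≤ (c : ℝ) ^ (1 / 8 : ℝ) := Real.one_le_rpow hc1 (by norm_num)
        have h9 : K * (Real.pi / (c * y)) ≤ K * (Real.pi / (c * y)) * (c : ℝ) ^ (1 / 8 : ℝ) :=
          le_mul_of_one_le_right (by positivity) h8
        -- One factor y is given up for δ, so that both terms decay like 1/y.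
        have h10 : (c : ℝ) * y * (c * δ) ≤ (c * y) ^ 2 := by rw [sq]; gcongr
        gcongr
    _ = 2 * m * (K * Real.pi + (2 + 2 * K * Real.pi) / δ * (N * (9 * (N : ℝ) ^ (1 / 8 : ℝ)))) *
        (((c : ℝ) ^ (3 / 4 : ℝ) * (c : ℝ) ^ (1 / 8 : ℝ) / c ^ 2) * d) / y := by
        push_cast; field_simp
    _ = _ := by
        rw [poincareMajorant, ← Real.rpow_add (by positivity), ← Real.rpow_natCast,
          ← Real.rpow_sub (by positivity)]
        norm_num [hd]

/-- The summand `X(c, d) e(m d⁻¹ / c) (c z + d)⁻² e(-m / (c (c z + d)))`. -/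
def poincareTerm (N : ℕ) (v : ℤ × ℤ) (m c : ℕ) [NeZero c] (z : ℂ) (d : ℤ) : ℂ :=
  rowWeight N v c d * kloostermanPhase m c d * (((c : ℂ) * z + d) ^ 2)⁻¹ *
    Complex.exp (-(2 * Real.pi * Complex.I * m / (c * (c * z + d))))

/-- The real part is a nonnegative multiple of Im(1/w), which is negative. -/
theorem neg_two_pi_I_div_re_nonpos (m c : ℕ) [NeZero c] {w : ℂ} (hw : 0 < w.im) :
    (-(2 * Real.pi * Complex.I * m / (c * w))).re ≤ 0 := by
  have hc : (0 : ℝ) < c := by exact_mod_cast Nat.pos_of_ne_zero (NeZero.ne c)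
  have hpi := Real.pi_pos
  have h : -(2 * Real.pi * Complex.I * m / (c * w)) =
      ((2 * Real.pi * m / c : ℝ) : ℂ) * (-Complex.I * w⁻¹) := by
    push_cast; field_simp
  rw [h, Complex.re_ofReal_mul]
  refine mul_nonpos_of_nonneg_of_nonpos (by positivity) ?_
  simp only [Complex.mul_re, Complex.neg_re, Complex.I_re, zero_mul,
    Complex.I_im, Complex.inv_im, zero_sub, neg_mul, one_mul, neg_neg]
  exact div_nonpos_of_nonpos_of_nonneg (by linarith) (Complex.normSq_nonneg _)

theorem linear_im_pos {c : ℕ} (hc : 0 < c) {z : ℂ} (hz : 0 < z.im) (d : ℤ) :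
    0 < ((c : ℂ) * z + d).im := by
  have : (0 : ℝ) < c := by exact_mod_cast hc
  simp; positivity

theorem norm_poincareTerm_le (N : ℕ) (v : ℤ × ℤ) (m c : ℕ) [NeZero c] {z : ℂ} (hz : 0 < z.im)
    (d : ℤ) : ‖poincareTerm N v m c z d‖ ≤ (‖(c : ℂ) * z + d‖ ^ 2)⁻¹ := by
  have hc : 0 < c := Nat.pos_of_ne_zero (NeZero.ne c)
  rw [poincareTerm, norm_mul, norm_mul, norm_mul, Complex.norm_exp, norm_inv, norm_pow]
  have h1 : Real.exp (-(2 * Real.pi * Complex.I * m / (c * (c * z + d)))).re ≤ 1 :=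
    Real.exp_le_one_iff.2 (neg_two_pi_I_div_re_nonpos m c (linear_im_pos hc hz d))
  calc _ ≤ 1 * 1 * (‖(c : ℂ) * z + d‖ ^ 2)⁻¹ * 1 := by
        gcongr
        · exact norm_rowWeight_le N v c d
        · exact norm_kloostermanPhase_le m c d
    _ = _ := by ring

theorem norm_exp_sub_one_le_two_mul {u : ℂ} (hu : u.re ≤ 0) : ‖Complex.exp u - 1‖ ≤ 2 * ‖u‖ := by
  rcases le_total ‖u‖ 1 with h | h
  · exact Complex.norm_exp_sub_one_le h
  · have h1 : ‖Complex.exp u‖ ≤ 1 := by rw [Complex.norm_exp]; exact Real.exp_le_one_iff.2 hu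
    have := norm_sub_le (Complex.exp u) 1
    rw [norm_one] at this
    linarith

/-- The exponential factor differs from 1 by at most 4πm/(c² y). Hence replacing it by 1 costs an
absolutely convergent error of order c⁻³ y⁻², and the oscillating main term is already bounded. -/
theorem exists_norm_sum_poincareTerm_le (N : ℕ) [NeZero N] {m : ℕ} (hm : 0 < m) {δ : ℝ}
    (hδ : 0 < δ) : ∃ C, 0 ≤ C ∧ ∀ (v : ℤ × ℤ) (c : ℕ) [NeZero c] (z : ℂ), δ ≤ z.im → ∀ a b : ℤ,
      ‖∑ d ∈ Finset.Ico a b, poincareTerm N v m c z d‖ ≤ C * poincareMajorant c / z.im := by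
  obtain ⟨C, hC0, hC⟩ := norm_sum_rowWeight_mul_kloostermanPhase_le N hm hδ
  have hpi := Real.pi_pos
  set K := 2 + 2 / δ ^ 2 with hK
  refine ⟨C + K * Real.pi * (4 * Real.pi * m) / δ, by positivity, ?_⟩
  intro v c _ z hz a b
  have hc : 0 < c := Nat.pos_of_ne_zero (NeZero.ne c)
  have hc1 : (1 : ℝ) ≤ c := by exact_mod_cast hc
  have hz0 : 0 < z.im := hδ.trans_le hz
  have hsplit : ∑ d ∈ Finset.Ico a b, poincareTerm N v m c z d =
      ∑ d ∈ Finset.Ico a b, rowWeight N v c d * kloostermanPhase m c d *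
        (((c : ℂ) * z + d) ^ 2)⁻¹ +
      ∑ d ∈ Finset.Ico a b, rowWeight N v c d * kloostermanPhase m c d *
        (((c : ℂ) * z + d) ^ 2)⁻¹ *
        (Complex.exp (-(2 * Real.pi * Complex.I * m / (c * (c * z + d)))) - 1) := by
    rw [← Finset.sum_add_distrib]
    refine Finset.sum_congr rfl fun d _ => ?_
    rw [poincareTerm]; ring
  rw [hsplit]
  refine (norm_add_le _ _).trans ?_
  have h2 : ‖∑ d ∈ Finset.Ico a b, rowWeight N v c d * kloostermanPhase m c d *
        (((c : ℂ) * z + d) ^ 2)⁻¹ *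
        (Complex.exp (-(2 * Real.pi * Complex.I * m / (c * (c * z + d)))) - 1)‖ ≤
      K * Real.pi * (4 * Real.pi * m) / δ * poincareMajorant c / z.im := by
    calc _ ≤ ∑ d ∈ Finset.Ico a b, (‖(c : ℂ) * z + d‖ ^ 2)⁻¹ *
          (4 * Real.pi * m / (c * (c * z.im))) := by
          refine (norm_sum_le _ _).trans (Finset.sum_le_sum fun d _ => ?_)
          rw [norm_mul, norm_mul, norm_mul, norm_inv, norm_pow]
          have him := linear_im_pos hc hz0 d
          have he := norm_exp_sub_one_le_two_mul (neg_two_pi_I_div_re_nonpos m c him)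
          have hn : ‖-(2 * Real.pi * Complex.I * m / (c * (c * z + d)))‖ ≤
              2 * Real.pi * m / (c * (c * z.im)) := by
            rw [norm_neg, norm_div, norm_mul, norm_mul, norm_mul, norm_mul, Complex.norm_I,
              Complex.norm_natCast, Complex.norm_natCast, Complex.norm_real, Real.norm_of_nonneg hpi.le]
            simp only [Complex.norm_ofNat, mul_one]
            have := mul_im_le_norm_linear c z d
            gcongr
          calc _ ≤ 1 * 1 * (‖(c : ℂ) * z + d‖ ^ 2)⁻¹ * (4 * Real.pi * m / (c * (c * z.im))) := by
                gcongr
                · exact norm_rowWeight_le N v c d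
                · exact norm_kloostermanPhase_le m c d
                · refine he.trans ((mul_le_mul_of_nonneg_left hn two_pos.le).trans (le_of_eq ?_))
                  ring
            _ = _ := by ring
      _ ≤ K * (Real.pi / (c * z.im)) * (4 * Real.pi * m / (c * (c * z.im))) := by
          rw [← Finset.sum_mul]
          gcongr
          exact sum_Ico_norm_linear_le hδ hc hz a b
      _ = K * Real.pi * (4 * Real.pi * m) / (z.im * c) * ((c : ℝ) ^ 2)⁻¹ / z.im := by
          field_simp
      _ ≤ K * Real.pi * (4 * Real.pi * m) / δ * poincareMajorant c / z.im := by
          gcongr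
          · nlinarith
          · exact inv_sq_le_poincareMajorant hc
  calc _ ≤ C * poincareMajorant c / z.im +
        K * Real.pi * (4 * Real.pi * m) / δ * poincareMajorant c / z.im :=
        add_le_add (hC v c z hz a b) h2
    _ = _ := by ring

end

/-! ### Rows (c, d), truncated Poincaré sums and the action of SL₂(ℤ). -/

noncomputable section

/-- The function `z ↦ e(m z)`. -/
def expForm (m : ℕ) (z : ℍ) : ℂ := Complex.exp (2 * Real.pi * Complex.I * m * z)

theorem norm_expForm (m : ℕ) (z : ℍ) : ‖expForm m z‖ = Real.exp (-(2 * Real.pi * m * z.im)) := by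
  rw [expForm, Complex.norm_exp]
  congr 1
  simp [Complex.mul_re, Complex.mul_im]

theorem exp_two_pi_I_mul_int (k : ℤ) : Complex.exp (2 * Real.pi * Complex.I * k) = 1 :=
  Complex.exp_eq_one_iff.2 ⟨k, by ring⟩

theorem expForm_T_zpow_smul (m : ℕ) (n : ℤ) (z : ℍ) :
    expForm m (ModularGroup.T ^ n • z) = expForm m z := by
  rw [expForm, expForm, ModularGroup.coe_T_zpow_smul_eq, mul_add, Complex.exp_add]
  have := exp_two_pi_I_mul_int (m * n)
  push_cast at this
  rw [show 2 * (Real.pi : ℂ) * Complex.I * m * n = 2 * Real.pi * Complex.I * (m * n) by ring, this,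
    mul_one]

theorem expForm_slash_of_row {m : ℕ} {δ : SL(2, ℤ)} (h0 : δ 1 0 = 0) (h1 : δ 1 1 = 1) :
    expForm m ∣[(2 : ℤ)] δ = expForm m := by
  ext z
  obtain ⟨n, hn⟩ := ModularGroup.exists_eq_T_zpow_of_c_eq_zero h0
  rw [ModularForm.SL_slash_apply, hn, expForm_T_zpow_smul, ModularGroup.denom_apply, h0, h1]
  simp

/-- Two matrices with the same bottom row differ on the left by a translation, under which e(mz) is
invariant. -/
theorem expForm_slash_congr (m : ℕ) {γ γ' : SL(2, ℤ)}
    (h : (γ : Matrix (Fin 2) (Fin 2) ℤ) 1 = (γ' : Matrix (Fin 2) (Fin 2) ℤ) 1) :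
    expForm m ∣[(2 : ℤ)] γ = expForm m ∣[(2 : ℤ)] γ' := by
  have hd := Matrix.det_fin_two (γ : Matrix (Fin 2) (Fin 2) ℤ)
  rw [γ.det_coe] at hd
  have e0 : γ' 1 0 = γ 1 0 := (congrFun h 0).symm
  have e1 : γ' 1 1 = γ 1 1 := (congrFun h 1).symm
  have hδ : γ' = (γ' * γ⁻¹) * γ := by group
  rw [hδ, SlashAction.slash_mul, expForm_slash_of_row (δ := γ' * γ⁻¹)]
  · rw [Matrix.SpecialLinearGroup.coe_mul, Matrix.SpecialLinearGroup.coe_inv,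
      Matrix.adjugate_fin_two, Matrix.mul_apply, Fin.sum_univ_two]
    simp [e0, e1]; ring
  · rw [Matrix.SpecialLinearGroup.coe_mul, Matrix.SpecialLinearGroup.coe_inv,
      Matrix.adjugate_fin_two, Matrix.mul_apply, Fin.sum_univ_two]
    simp [e0, e1]; linarith

/-- The term `(c z + d)⁻² e(m γ z)`, where `γ ∈ SL₂(ℤ)` has bottom row `(c, d)`. -/
def rowTerm (m : ℕ) (p : Fin 2 → ℤ) (z : ℍ) : ℂ :=
  open Classical in
  if h : ∃ γ : SL(2, ℤ), (γ : Matrix (Fin 2) (Fin 2) ℤ) 1 = p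
  then (expForm m ∣[(2 : ℤ)] h.choose) z else 0

theorem rowTerm_row (m : ℕ) (γ : SL(2, ℤ)) (z : ℍ) :
    rowTerm m ((γ : Matrix (Fin 2) (Fin 2) ℤ) 1) z = (expForm m ∣[(2 : ℤ)] γ) z := by
  have h : ∃ γ' : SL(2, ℤ), (γ' : Matrix (Fin 2) (Fin 2) ℤ) 1 =
    (γ : Matrix (Fin 2) (Fin 2) ℤ) 1 := ⟨γ, rfl⟩
  rw [rowTerm, dif_pos h, expForm_slash_congr m h.choose_spec]

theorem rowTerm_of_not_isCoprime (m : ℕ) {p : Fin 2 → ℤ} (hp : ¬ IsCoprime (p 0) (p 1)) (z : ℍ) :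
    rowTerm m p z = 0 := by
  rw [rowTerm, dif_neg]
  rintro ⟨γ, rfl⟩
  exact hp (ModularGroup.bottom_row_coprime γ)

theorem exists_row_eq {p : Fin 2 → ℤ} (hp : IsCoprime (p 0) (p 1)) :
    ∃ γ : SL(2, ℤ), (γ : Matrix (Fin 2) (Fin 2) ℤ) 1 = p := by
  obtain ⟨γ, -, h⟩ := ModularGroup.bottom_row_surj (R := ℤ) hp
  exact ⟨γ, h⟩

theorem rowTerm_neg (m : ℕ) (p : Fin 2 → ℤ) (z : ℍ) : rowTerm m (-p) z = rowTerm m p z := by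
  by_cases hp : IsCoprime (p 0) (p 1)
  · obtain ⟨γ, rfl⟩ := exists_row_eq hp
    have h : -((γ : Matrix (Fin 2) (Fin 2) ℤ) 1) = ((-γ : SL(2, ℤ)) : Matrix (Fin 2) (Fin 2) ℤ) 1 := by
      ext i; simp
    rw [h, rowTerm_row, rowTerm_row, ModularForm.SL_slash_apply, ModularForm.SL_slash_apply,
      ModularGroup.SL_neg_smul, ModularGroup.denom_apply, ModularGroup.denom_apply]
    congr 1
    rw [zpow_neg, zpow_neg]
    congr 1
    simp only [Matrix.SpecialLinearGroup.coe_neg, Matrix.neg_apply, Int.cast_neg]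
    rw [zpow_ofNat, zpow_ofNat]; ring
  · rw [rowTerm_of_not_isCoprime m hp, rowTerm_of_not_isCoprime]
    simpa [IsCoprime.neg_left_iff, IsCoprime.neg_right_iff] using hp

theorem rowTerm_zero_one (m : ℕ) (z : ℍ) : rowTerm m ![0, 1] z = expForm m z := by
  have h : ((1 : SL(2, ℤ)) : Matrix (Fin 2) (Fin 2) ℤ) 1 = ![0, 1] := by
    ext i; fin_cases i <;> simp
  rw [← h, rowTerm_row, SlashAction.slash_one]

theorem isUnit_intCast_zmod_iff (c : ℕ) (d : ℤ) :
    IsUnit (d : ZMod c) ↔ IsCoprime (c : ℤ) d := by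
  rw [ZMod.coe_int_isUnit_iff_isCoprime]

theorem mobius_eq_sub {a b c d z : ℂ} (hc : c ≠ 0) (hw : c * z + d ≠ 0) (h : a * d - b * c = 1) :
    (a * z + b) / (c * z + d) = a / c - 1 / (c * (c * z + d)) := by
  rw [div_sub_div _ _ hc (mul_ne_zero hc hw), div_eq_div_iff hw (mul_ne_zero hc (mul_ne_zero hc hw))]
  linear_combination (-(c * (c * z + d))) * h

/-- For γ = (a, b; c, d), γz = a/c - 1/(c(cz+d)) and ad ≡ 1 mod c, so e(ma/c) is the Kloosterman
phase. If c and d are not coprime, both sides are zero. -/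
theorem rowTerm_natCast (m c : ℕ) [NeZero c] (d : ℤ) (z : ℍ) :
    rowTerm m ![(c : ℤ), d] z = kloostermanPhase m c d * (((c : ℂ) * z + d) ^ 2)⁻¹ *
      Complex.exp (-(2 * Real.pi * Complex.I * m / (c * (c * z + d)))) := by
  have hc : (c : ℂ) ≠ 0 := by exact_mod_cast NeZero.ne c
  by_cases hp : IsCoprime (c : ℤ) d
  · obtain ⟨γ, hγ⟩ := exists_row_eq (p := ![(c : ℤ), d]) hp
    have h0 : γ 1 0 = c := congrFun hγ 0
    have h1 : γ 1 1 = d := congrFun hγ 1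
    have hdet := Matrix.det_fin_two (γ : Matrix (Fin 2) (Fin 2) ℤ)
    rw [γ.det_coe, h0, h1] at hdet
    rw [← hγ, rowTerm_row, ModularForm.SL_slash_apply, ModularGroup.denom_apply, h0, h1]
    have hu : IsUnit (d : ZMod c) := (isUnit_intCast_zmod_iff c d).2 hp
    have hw : (c : ℂ) * z + d ≠ 0 := by
      have := (linear_im_pos (Nat.pos_of_ne_zero (NeZero.ne c)) z.im_pos d).ne'
      intro h; rw [h] at this; simp at this
    have hinv : (d : ZMod c)⁻¹ = (γ 0 0 : ZMod c) := by
      have h2 : ((γ 0 0 : ℤ) : ZMod c) * (d : ZMod c) = 1 := by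
        have := congrArg (Int.cast : ℤ → ZMod c) hdet
        push_cast at this
        rw [ZMod.natCast_self, mul_zero, sub_zero] at this
        exact this.symm
      exact ZMod.inv_eq_of_mul_eq_one _ _ _ (by rw [mul_comm]; exact h2)
    have h3 : (ZMod.stdAddChar ((m : ZMod c) * (γ 0 0 : ZMod c)) : ℂ) =
        Complex.exp (2 * Real.pi * Complex.I * ((m * γ 0 0 : ℤ) : ℂ) / c) := by
      rw [← ZMod.stdAddChar_coe]; push_cast; rfl
    have hE : expForm m (γ • z) = ZMod.stdAddChar ((m : ZMod c) * (γ 0 0 : ZMod c)) *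
        Complex.exp (-(2 * Real.pi * Complex.I * m / (c * (c * z + d)))) := by
      rw [expForm, h3, ← Complex.exp_add]
      congr 1
      have hdet' : (1 : ℂ) = (γ 0 0 : ℂ) * d - (γ 0 1 : ℂ) * c := by exact_mod_cast hdet
      rw [coe_specialLinearGroup_apply]
      simp only [algebraMap_int_eq, eq_intCast, Complex.ofReal_intCast, h0, h1, Int.cast_natCast,
        Complex.ofReal_natCast]
      rw [mobius_eq_sub hc hw hdet'.symm]
      push_cast
      ring
    rw [kloostermanPhase, if_pos hu, hinv, hE, zpow_neg, zpow_ofNat]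
    push_cast
    ring
  · rw [rowTerm_of_not_isCoprime m (by simpa using hp), kloostermanPhase, if_neg, zero_mul, zero_mul]
    rwa [isUnit_intCast_zmod_iff]

theorem rowTerm_vecMul (m : ℕ) (p : Fin 2 → ℤ) (σ : SL(2, ℤ)) (z : ℍ) :
    rowTerm m (Matrix.vecMul p (σ : Matrix (Fin 2) (Fin 2) ℤ)) z =
      rowTerm m p (σ • z) * denom σ z ^ (-2 : ℤ) := by
  have hrow : ∀ (γ τ : SL(2, ℤ)), Matrix.vecMul ((γ : Matrix (Fin 2) (Fin 2) ℤ) 1)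
      (τ : Matrix (Fin 2) (Fin 2) ℤ) = ((γ * τ : SL(2, ℤ)) : Matrix (Fin 2) (Fin 2) ℤ) 1 := by
    intro γ τ
    rw [Matrix.SpecialLinearGroup.coe_mul]; rfl
  by_cases hp : ∃ γ : SL(2, ℤ), (γ : Matrix (Fin 2) (Fin 2) ℤ) 1 = p
  · obtain ⟨γ, rfl⟩ := hp
    rw [hrow, rowTerm_row, rowTerm_row, SlashAction.slash_mul, ModularForm.SL_slash_apply (k := 2) _ σ]
  · rw [rowTerm, rowTerm, dif_neg, dif_neg hp, zero_mul]
    rintro ⟨γ, hγ⟩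
    refine hp ⟨γ * σ⁻¹, ?_⟩
    rw [← hrow, hγ, Matrix.vecMul_vecMul, ← Matrix.SpecialLinearGroup.coe_mul, mul_inv_cancel,
      Matrix.SpecialLinearGroup.coe_one, Matrix.vecMul_one]

theorem linear_smul (p : Fin 2 → ℤ) (σ : SL(2, ℤ)) (z : ℍ) :
    ((p 0 : ℂ) * (σ • z : ℍ) + p 1) * denom σ z =
      ((Matrix.vecMul p (σ : Matrix (Fin 2) (Fin 2) ℤ) 0 : ℤ) : ℂ) * z +
        ((Matrix.vecMul p (σ : Matrix (Fin 2) (Fin 2) ℤ) 1 : ℤ) : ℂ) := by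
  have hd : (σ 1 0 : ℂ) * z + σ 1 1 ≠ 0 := denom_ne_zero σ z
  rw [coe_specialLinearGroup_apply, ModularGroup.denom_apply]
  simp only [algebraMap_int_eq, eq_intCast, Complex.ofReal_intCast, Matrix.vecMul, dotProduct,
    Fin.sum_univ_two]
  rw [add_mul, mul_assoc, div_mul_cancel₀ _ hd]
  push_cast
  ring

/-- The vector `σ⁻¹ v`. -/
def slashVec (σ : SL(2, ℤ)) (v : ℤ × ℤ) : ℤ × ℤ :=
  (σ 1 1 * v.1 - σ 0 1 * v.2, -σ 1 0 * v.1 + σ 0 0 * v.2)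

/-- The pairing of a row with a column satisfies (pσ)(σ⁻¹v) = pv. -/
theorem rowWeight_vecMul (N : ℕ) (v : ℤ × ℤ) (σ : SL(2, ℤ)) (p : Fin 2 → ℤ) :
    rowWeight N (slashVec σ v) (Matrix.vecMul p (σ : Matrix (Fin 2) (Fin 2) ℤ) 0)
      (Matrix.vecMul p (σ : Matrix (Fin 2) (Fin 2) ℤ) 1) = rowWeight N v (p 0) (p 1) := by
  have hdet := Matrix.det_fin_two (σ : Matrix (Fin 2) (Fin 2) ℤ)
  rw [σ.det_coe] at hdet
  rw [rowWeight, rowWeight, slashVec]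
  simp only [Matrix.vecMul, dotProduct, Fin.sum_univ_two]
  congr 2
  linear_combination (-(p 0 * v.1) - p 1 * v.2) * hdet

/-- The sum over the rows `(c, d)` with `|c z + d| < R`. -/
def truncatedPoincare (N : ℕ) (v : ℤ × ℤ) (m : ℕ) (R : ℝ) (z : ℍ) : ℂ :=
  ∑' p : Fin 2 → ℤ, if ‖(p 0 : ℂ) * z + p 1‖ < R then rowWeight N v (p 0) (p 1) * rowTerm m p z
    else 0

/-- Right multiplication by σ permutes the rows, and the linear form of p at σz, times the
automorphy factor, is that of pσ at z. So only the radius changes; this is the reason for truncating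
by |cz+d|. -/
theorem truncatedPoincare_smul (N : ℕ) (v : ℤ × ℤ) (m : ℕ) (R : ℝ) (σ : SL(2, ℤ)) (z : ℍ) :
    truncatedPoincare N v m R (σ • z) * denom σ z ^ (-2 : ℤ) =
      truncatedPoincare N (slashVec σ v) m (R * ‖denom σ z‖) z := by
  have hd : 0 < ‖denom σ z‖ := norm_pos_iff.2 (denom_ne_zero σ z)
  let e : (Fin 2 → ℤ) ≃ (Fin 2 → ℤ) :=
    { toFun := fun p => Matrix.vecMul p (σ : Matrix (Fin 2) (Fin 2) ℤ)
      invFun := fun p => Matrix.vecMul p ((σ⁻¹ : SL(2, ℤ)) : Matrix (Fin 2) (Fin 2) ℤ)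
      left_inv := fun p => by
        change Matrix.vecMul (Matrix.vecMul p _) _ = p
        rw [Matrix.vecMul_vecMul, ← Matrix.SpecialLinearGroup.coe_mul, mul_inv_cancel,
          Matrix.SpecialLinearGroup.coe_one, Matrix.vecMul_one]
      right_inv := fun p => by
        change Matrix.vecMul (Matrix.vecMul p _) _ = p
        rw [Matrix.vecMul_vecMul, ← Matrix.SpecialLinearGroup.coe_mul, inv_mul_cancel,
          Matrix.SpecialLinearGroup.coe_one, Matrix.vecMul_one] }
  rw [truncatedPoincare, truncatedPoincare, ← tsum_mul_right]
  refine Eq.trans (tsum_congr fun p => ?_) (e.tsum_eq _)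
  simp only [e, Equiv.coe_fn_mk, rowWeight_vecMul, rowTerm_vecMul, ← linear_smul, norm_mul,
    mul_lt_mul_iff_left₀ hd]
  split_ifs
  · ring
  · simp

theorem finite_setOf_norm_linear_lt (z : ℍ) (R : ℝ) :
    {p : Fin 2 → ℤ | ‖(p 0 : ℂ) * z + p 1‖ < R}.Finite := by
  have h := (ModularGroup.tendsto_normSq_coprime_pair z).eventually_ge_atTop (R ^ 2)
  rw [Filter.eventually_cofinite] at h
  refine h.subset fun p hp => ?_
  simp only [Set.mem_ofPred_eq, not_le] at hp ⊢
  rw [Complex.normSq_eq_norm_sq]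
  have := norm_nonneg ((p 0 : ℂ) * z + p 1)
  gcongr

/-- This lets the interval bounds apply to the truncations. -/
theorem exists_Ico_norm_linear_lt (c : ℕ) (z : ℂ) (R : ℝ) :
    ∃ a b : ℤ, ∀ d : ℤ, ‖(c : ℂ) * z + d‖ < R ↔ d ∈ Finset.Ico a b := by
  by_cases hR : 0 < R ∧ (c * z.im) ^ 2 < R ^ 2
  · obtain ⟨hR, h⟩ := hR
    have hpos : 0 < R ^ 2 - (c * z.im) ^ 2 := by linarith
    -- The condition is |c Re z + d| < √(R² - (c Im z)²); both inequalities are strict, hence floor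
    -- plus one on the left and ceiling on the excluded right end.
    refine ⟨⌊-(c * z.re) - √(R ^ 2 - (c * z.im) ^ 2)⌋ + 1, ⌈-(c * z.re) + √(R ^ 2 - (c * z.im) ^ 2)⌉,
      fun d => ?_⟩
    rw [Finset.mem_Ico, Int.add_one_le_iff, Int.floor_lt, Int.lt_ceil, ← sq_lt_sq₀ (norm_nonneg _) hR.le,
      norm_linear_sq, ← lt_sub_iff_add_lt]
    nth_rw 1 [← Real.sq_sqrt hpos.le]
    rw [sq_lt_sq, abs_of_nonneg (Real.sqrt_nonneg _), abs_lt]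
    constructor <;> rintro ⟨h1, h2⟩ <;> constructor <;> linarith
  · refine ⟨0, 0, fun d => ?_⟩
    simp only [Finset.Ico_self, Finset.notMem_empty, iff_false, not_lt]
    rcases le_or_gt R 0 with h0 | h0
    · exact h0.trans (norm_nonneg _)
    · have h1 : R ^ 2 ≤ (c * z.im) ^ 2 := not_lt.1 fun h2 => hR ⟨h0, h2⟩
      rw [← sq_le_sq₀ h0.le (norm_nonneg _), norm_linear_sq]
      linarith [sq_nonneg (c * z.re + d)]

end

/-! ### The Poincaré series of weight 2 as a cusp form. -/

noncomputable section

/-- The Poincaré series attached to the condition `N ∣ c v₁ + d v₂` on the rows `(c, d)`. -/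
def poincareSeries (N : ℕ) (v : ℤ × ℤ) (m : ℕ) (z : ℂ) : ℂ :=
  rowWeight N v 0 1 * Complex.exp (2 * Real.pi * Complex.I * m * z) +
    ∑' c : ℕ+, ∑' d : ℤ, poincareTerm N v m c z d

theorem rowWeight_neg (N : ℕ) (v : ℤ × ℤ) (c d : ℤ) :
    rowWeight N v (-c) (-d) = rowWeight N v c d := by
  rw [rowWeight, rowWeight, show -c * v.1 + -d * v.2 = -(c * v.1 + d * v.2) by ring]
  simp only [dvd_neg]

theorem rowWeight_mul_rowTerm_natCast (N : ℕ) (v : ℤ × ℤ) (m c : ℕ) [NeZero c] (d : ℤ) (z : ℍ) :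
    rowWeight N v c d * rowTerm m ![(c : ℤ), d] z = poincareTerm N v m c z d := by
  rw [rowTerm_natCast, poincareTerm]; ring

theorem tsum_rowTerm_zero (N : ℕ) (v : ℤ × ℤ) (m : ℕ) (R : ℝ) (z : ℍ) :
    ∑' d : ℤ, (if ‖((0 : ℤ) : ℂ) * z + d‖ < R then rowWeight N v 0 d * rowTerm m ![0, d] z else 0) =
      2 * (if 1 < R then rowWeight N v 0 1 * expForm m z else 0) := by
  rw [tsum_eq_sum (s := {1, -1})]
  · have h : rowTerm m ![0, -1] z = expForm m z := by
      rw [← rowTerm_zero_one, ← rowTerm_neg]; congr 1; ext i; fin_cases i <;> simp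
    have h' : rowWeight N v 0 (-1) = rowWeight N v 0 1 := by
      rw [← rowWeight_neg N v 0 1, neg_zero]
    rw [Finset.sum_pair (by norm_num), h, h', rowTerm_zero_one]
    simp only [Int.cast_zero, zero_mul, zero_add, Int.cast_one, norm_one, Int.cast_neg, norm_neg,
      two_mul]
  · intro d hd
    rw [rowTerm_of_not_isCoprime, mul_zero, ite_self]
    simp only [Matrix.cons_val_zero, Matrix.cons_val_one, isCoprime_zero_left]
    intro h
    rcases Int.isUnit_iff.1 h with rfl | rfl <;> simp at hd

/-- Rows p and -p contribute equally, which accounts for the factor 2 and leaves c > 0 together with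
the row (0, 1). -/
theorem truncatedPoincare_eq (N : ℕ) (v : ℤ × ℤ) (m : ℕ) (R : ℝ) (z : ℍ) :
    truncatedPoincare N v m R z = 2 * ((if 1 < R then rowWeight N v 0 1 * expForm m z else 0) +
      ∑' c : ℕ+, ∑' d : ℤ, if ‖((c : ℕ) : ℂ) * z + d‖ < R then poincareTerm N v m c z d else 0) := by
  set G : (Fin 2 → ℤ) → ℂ := fun p => if ‖(p 0 : ℂ) * z + p 1‖ < R then
    rowWeight N v (p 0) (p 1) * rowTerm m p z else 0 with hG
  have hsG : Summable G := by
    refine summable_of_hasFiniteSupport ((finite_setOf_norm_linear_lt z R).subset fun p hp => ?_)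
    by_contra h
    exact hp (if_neg h)
  have hs : Summable fun q : ℤ × ℤ => G ((finTwoArrowEquiv ℤ).symm q) :=
    (finTwoArrowEquiv ℤ).symm.summable_iff.2 hsG
  have hGneg : ∀ p, G (-p) = G p := by
    intro p
    simp only [hG, rowTerm_neg, Pi.neg_apply, rowWeight_neg, Int.cast_neg]
    rw [neg_mul, ← neg_add, norm_neg]
  have h1 : truncatedPoincare N v m R z = ∑' c : ℤ, ∑' d : ℤ, G ![c, d] := by
    rw [truncatedPoincare, ← (finTwoArrowEquiv ℤ).symm.tsum_eq, hs.tsum_prod]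
    rfl
  have h2 : Function.Even fun c : ℤ => ∑' d : ℤ, G ![c, d] := by
    intro c
    change ∑' d : ℤ, G ![-c, d] = ∑' d : ℤ, G ![c, d]
    rw [← (Equiv.neg ℤ).tsum_eq]
    refine tsum_congr fun d => ?_
    rw [← hGneg]
    congr 1
    ext i; fin_cases i <;> simp
  have h3 : Summable fun c : ℤ => ∑' d : ℤ, G ![c, d] := hs.prod
  rw [h1, tsum_int_eq_zero_add_two_mul_tsum_pnat h2 h3, mul_add]
  refine congrArg₂ _ (tsum_rowTerm_zero N v m R z) ?_
  · rw [nsmul_eq_mul, Nat.cast_ofNat]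
    congr 1
    refine tsum_congr fun c => ?_
    refine tsum_congr fun d => ?_
    simp only [hG, Matrix.cons_val_zero, Matrix.cons_val_one, Int.cast_natCast,
      rowWeight_mul_rowTerm_natCast]

theorem summable_norm_linear_sq_inv (c : ℕ) (z : ℂ) :
    Summable fun d : ℤ => (‖(c : ℂ) * z + d‖ ^ 2)⁻¹ := by
  have h := EisensteinSeries.linear_right_summable z c (k := 2) le_rfl
  have := h.norm
  simpa [norm_inv, norm_zpow] using this

theorem tsum_ite_poincareTerm_eq (N : ℕ) (v : ℤ × ℤ) (m c : ℕ) [NeZero c] (z : ℂ) (R : ℝ) :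
    ∃ a b : ℤ, ∑' d : ℤ, (if ‖(c : ℂ) * z + d‖ < R then poincareTerm N v m c z d else 0) =
      ∑ d ∈ Finset.Ico a b, poincareTerm N v m c z d := by
  obtain ⟨a, b, h⟩ := exists_Ico_norm_linear_lt c z R
  refine ⟨a, b, ?_⟩
  simp only [h]
  rw [tsum_eq_sum (s := Finset.Ico a b) fun d hd => if_neg hd]
  exact Finset.sum_congr rfl fun d hd => if_pos hd

theorem tendsto_tsum_ite_poincareTerm (N : ℕ) (v : ℤ × ℤ) (m c : ℕ) [NeZero c] {z : ℂ}
    (hz : 0 < z.im) : Filter.Tendsto (fun R : ℝ =>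
      ∑' d : ℤ, (if ‖(c : ℂ) * z + d‖ < R then poincareTerm N v m c z d else 0)) Filter.atTop
      (nhds (∑' d : ℤ, poincareTerm N v m c z d)) := by
  refine tendsto_tsum_of_dominated_convergence (summable_norm_linear_sq_inv c z) (fun d => ?_)
    (Filter.Eventually.of_forall fun R d => ?_)
  · refine tendsto_const_nhds.congr' ?_
    filter_upwards [Filter.eventually_gt_atTop ‖(c : ℂ) * z + d‖] with R hR
    rw [if_pos hR]
  · split_ifs
    · exact norm_poincareTerm_le N v m c hz d
    · simp

/-- The partial Poincaré sums are bounded by `C / y`, uniformly in the truncation. -/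
theorem exists_norm_tsum_le (N : ℕ) [NeZero N] {m : ℕ} (hm : 0 < m) {δ : ℝ} (hδ : 0 < δ) :
    ∃ C, 0 ≤ C ∧ ∀ (v : ℤ × ℤ) (z : ℂ), δ ≤ z.im →
      (∀ (c : ℕ+) (R : ℝ), ‖∑' d : ℤ,
        (if ‖((c : ℕ) : ℂ) * z + d‖ < R then poincareTerm N v m c z d else 0)‖ ≤
          C * poincareMajorant c / z.im) ∧
      ∀ (c : ℕ+), ‖∑' d : ℤ, poincareTerm N v m c z d‖ ≤ C * poincareMajorant c / z.im := by
  obtain ⟨C, hC0, hC⟩ := exists_norm_sum_poincareTerm_le N hm hδ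
  refine ⟨C, hC0, fun v z hz => ?_⟩
  have h1 : ∀ (c : ℕ+) (R : ℝ), ‖∑' d : ℤ,
      (if ‖((c : ℕ) : ℂ) * z + d‖ < R then poincareTerm N v m c z d else 0)‖ ≤
          C * poincareMajorant c / z.im := by
    intro c R
    obtain ⟨a, b, h⟩ := tsum_ite_poincareTerm_eq N v m c z R
    rw [h]
    exact hC v c z hz a b
  refine ⟨h1, fun c => ?_⟩
  exact le_of_tendsto (tendsto_tsum_ite_poincareTerm N v m c (hδ.trans_le hz)).norm
    (Filter.Eventually.of_forall (h1 c))

theorem summable_poincareMajorant (C y : ℝ) :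
    Summable fun c : ℕ+ => C * poincareMajorant c / y :=
  (summable_rpow_mul_card_divisors.mul_left C).div_const y

/-- Dominated convergence over c: for each c the inner sum converges absolutely, and the majorant is
uniform in R. -/
theorem tendsto_truncatedPoincare (N : ℕ) [NeZero N] (v : ℤ × ℤ) {m : ℕ} (hm : 0 < m) (z : ℍ) :
    Filter.Tendsto (fun R => truncatedPoincare N v m R z) Filter.atTop
      (nhds (2 * poincareSeries N v m z)) := by
  obtain ⟨C, hC0, hC⟩ := exists_norm_tsum_le N hm z.im_pos
  simp only [truncatedPoincare_eq]
  refine (Filter.Tendsto.add ?_ ?_).const_mul 2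
  · refine tendsto_const_nhds.congr' ?_
    filter_upwards [Filter.eventually_gt_atTop 1] with R hR
    rw [if_pos hR, expForm]
  · exact tendsto_tsum_of_dominated_convergence (summable_poincareMajorant C z.im)
      (fun c => tendsto_tsum_ite_poincareTerm N v m c z.im_pos)
      (Filter.Eventually.of_forall fun R c => (hC v z le_rfl).1 c R)

theorem exists_norm_truncatedPoincare_le (N : ℕ) [NeZero N] {m : ℕ} (hm : 0 < m) {δ : ℝ}
    (hδ : 0 < δ) : ∃ C, 0 ≤ C ∧ ∀ (v : ℤ × ℤ) (R : ℝ) (z : ℍ), δ ≤ z.im →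
      ‖truncatedPoincare N v m R z‖ ≤ 2 * Real.exp (-(2 * Real.pi * m * z.im)) + C / z.im := by
  obtain ⟨C, hC0, hC⟩ := exists_norm_tsum_le N hm hδ
  refine ⟨2 * (C * ∑' c : ℕ+, poincareMajorant c), by
    have : 0 ≤ ∑' c : ℕ+, poincareMajorant c := tsum_nonneg fun c => poincareMajorant_nonneg c
    positivity, fun v R z hz => ?_⟩
  have h1 : ‖(if 1 < R then rowWeight N v 0 1 * expForm m z else 0)‖ ≤
      Real.exp (-(2 * Real.pi * m * z.im)) := by
    split_ifs
    · rw [norm_mul, norm_expForm]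
      exact mul_le_of_le_one_left (Real.exp_pos _).le (norm_rowWeight_le N v 0 1)
    · simpa using (Real.exp_pos _).le
  have h2 : ‖∑' c : ℕ+, ∑' d : ℤ,
      (if ‖((c : ℕ) : ℂ) * z + d‖ < R then poincareTerm N v m c z d else 0)‖ ≤
      C * (∑' c : ℕ+, poincareMajorant c) / z.im := by
    rw [← tsum_mul_left, ← tsum_div_const]
    exact tsum_of_norm_bounded (summable_poincareMajorant C z.im).hasSum fun c => (hC v z hz).1 c R
  rw [truncatedPoincare_eq, norm_mul, RCLike.norm_ofNat]
  refine (mul_le_mul_of_nonneg_left (norm_add_le_of_le h1 h2) (by norm_num)).trans (le_of_eq ?_)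
  ring

theorem exists_norm_poincareSeries_le (N : ℕ) [NeZero N] {m : ℕ} (hm : 0 < m) {δ : ℝ}
    (hδ : 0 < δ) : ∃ C, 0 ≤ C ∧ ∀ (v : ℤ × ℤ) (z : ℍ), δ ≤ z.im →
      ‖poincareSeries N v m z‖ ≤ Real.exp (-(2 * Real.pi * m * z.im)) + C / z.im := by
  obtain ⟨C, hC0, hC⟩ := exists_norm_truncatedPoincare_le N hm hδ
  refine ⟨C / 2, by positivity, fun v z hz => ?_⟩
  have h := le_of_tendsto (tendsto_truncatedPoincare N v hm z).norm
    (Filter.Eventually.of_forall fun R => hC v R z hz)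
  rw [norm_mul, RCLike.norm_ofNat] at h
  rw [div_right_comm]
  linarith

/-- Pass to the limit in `truncatedPoincare_smul`: R and R‖denom‖ tend to infinity together. -/
theorem poincareSeries_slash (N : ℕ) [NeZero N] (v : ℤ × ℤ) {m : ℕ} (hm : 0 < m) (σ : SL(2, ℤ)) :
    (fun z : ℍ => poincareSeries N v m z) ∣[(2 : ℤ)] σ =
      fun z : ℍ => poincareSeries N (slashVec σ v) m z := by
  ext z
  rw [ModularForm.SL_slash_apply]
  have hd : 0 < ‖denom σ z‖ := norm_pos_iff.2 (denom_ne_zero σ z)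
  have h1 := (tendsto_truncatedPoincare N v hm (σ • z)).mul_const (denom σ z ^ (-2 : ℤ))
  have h2 := (tendsto_truncatedPoincare N (slashVec σ v) hm z).comp
    (Filter.tendsto_id.atTop_mul_const hd)
  refine mul_left_cancel₀ (two_ne_zero (α := ℂ)) ?_
  rw [← mul_assoc]
  refine tendsto_nhds_unique h1 (h2.congr fun R => ?_)
  rw [Function.comp_apply, truncatedPoincare_smul]; rfl

theorem differentiableAt_poincareTerm (N : ℕ) (v : ℤ × ℤ) (m c : ℕ) [NeZero c] (d : ℤ) {z : ℂ}
    (hz : 0 < z.im) : DifferentiableAt ℂ (fun z => poincareTerm N v m c z d) z := by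
  have hc : (c : ℂ) ≠ 0 := by exact_mod_cast NeZero.ne c
  have hw : (c : ℂ) * z + d ≠ 0 := by
    have := (linear_im_pos (Nat.pos_of_ne_zero (NeZero.ne c)) hz d).ne'
    intro h; rw [h] at this; simp at this
  have hl : DifferentiableAt ℂ (fun z : ℂ => (c : ℂ) * z + d) z := by fun_prop
  unfold poincareTerm
  exact ((hl.pow 2).inv (pow_ne_zero 2 hw)).const_mul _ |>.mul
    (((differentiableAt_const _).div (hl.const_mul _) (mul_ne_zero hc hw)).neg.cexp)

theorem norm_linear_le_of_mem_ball (c : ℕ) (d : ℤ) {z w : ℂ} (hw : w ∈ Metric.ball z (z.im / 2)) :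
    ‖(c : ℂ) * z + d‖ ≤ 2 * ‖(c : ℂ) * w + d‖ := by
  have h1 : ‖(c : ℂ) * z + d‖ ≤ ‖(c : ℂ) * w + d‖ + c * ‖w - z‖ := by
    have : (c : ℂ) * z + d = ((c : ℂ) * w + d) - c * (w - z) := by ring
    rw [this]
    refine (norm_sub_le _ _).trans ?_
    rw [norm_mul, Complex.norm_natCast]
  have h2 := mul_im_le_norm_linear c z d
  have h3 : (c : ℝ) * ‖w - z‖ ≤ c * (z.im / 2) := by
    have := (mem_ball_iff_norm.1 hw).le
    gcongr
  linarith

theorem half_im_lt_of_mem_ball {z w : ℂ} (hw : w ∈ Metric.ball z (z.im / 2)) :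
    z.im / 2 < w.im := by
  have h1 := Complex.abs_im_le_norm (w - z)
  rw [Complex.sub_im] at h1
  have h2 := mem_ball_iff_norm.1 hw
  have := (abs_le.1 h1).1
  linarith

/-- Weierstrass' theorem is used twice on the ball of radius Im z / 2: over d with majorant
4|cz+d|⁻², over c with the bound obtained from cancellation. -/
theorem differentiableAt_poincareSeries (N : ℕ) [NeZero N] (v : ℤ × ℤ) {m : ℕ} (hm : 0 < m) {z : ℂ}
    (hz : 0 < z.im) : DifferentiableAt ℂ (poincareSeries N v m) z := by
  have hz2 : 0 < z.im / 2 := by positivity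
  obtain ⟨C, hC0, hC⟩ := exists_norm_tsum_le N hm hz2
  have hmem : Metric.ball z (z.im / 2) ∈ nhds z := Metric.ball_mem_nhds z hz2
  have him : ∀ w ∈ Metric.ball z (z.im / 2), 0 < w.im := fun w hw =>
    hz2.trans (half_im_lt_of_mem_ball hw)
  have h : DifferentiableOn ℂ (fun w => ∑' c : ℕ+, ∑' d : ℤ, poincareTerm N v m c w d)
      (Metric.ball z (z.im / 2)) := by
    refine Complex.differentiableOn_tsum_of_summable_norm
      (summable_poincareMajorant C (z.im / 2)) (fun c => ?_) Metric.isOpen_ball fun c w hw => ?_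
    · refine Complex.differentiableOn_tsum_of_summable_norm
        ((summable_norm_linear_sq_inv c z).mul_left 4) (fun d w hw => ?_) Metric.isOpen_ball
        fun d w hw => ?_
      · exact (differentiableAt_poincareTerm N v m c d (him w hw)).differentiableWithinAt
      · refine (norm_poincareTerm_le N v m c (him w hw) d).trans ?_
        have h1 := norm_linear_le_of_mem_ball c d hw
        have h2 : 0 < ‖((c : ℕ) : ℂ) * w + d‖ :=
          (mul_pos (by exact_mod_cast c.pos) (him w hw)).trans_le (mul_im_le_norm_linear c w d)
        have h3 : 0 < ‖((c : ℕ) : ℂ) * z + d‖ :=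
          (mul_pos (by exact_mod_cast c.pos) hz).trans_le (mul_im_le_norm_linear c z d)
        rw [← div_eq_mul_inv, inv_le_comm₀ (by positivity) (by positivity), inv_div,
          div_le_iff₀ (by norm_num)]
        nlinarith
    · refine ((hC v w (half_im_lt_of_mem_ball hw).le).2 c).trans ?_
      have := (half_im_lt_of_mem_ball hw).le
      have := poincareMajorant_nonneg c
      gcongr
  unfold poincareSeries
  exact DifferentiableAt.add (by fun_prop) (h.differentiableAt hmem)

theorem tendsto_poincareSeries_atImInfty (N : ℕ) [NeZero N] (v : ℤ × ℤ) {m : ℕ} (hm : 0 < m) :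
    IsZeroAtImInfty fun z : ℍ => poincareSeries N v m z := by
  obtain ⟨C, hC0, hC⟩ := exists_norm_poincareSeries_le N hm zero_lt_one
  have h1 : Filter.Tendsto (fun z : ℍ => Real.exp (-(2 * Real.pi * m * z.im)) + C / z.im) atImInfty
      (nhds 0) := by
    have him : Filter.Tendsto UpperHalfPlane.im atImInfty Filter.atTop := Filter.tendsto_comap
    have hpos : (0 : ℝ) < 2 * Real.pi * m := by have := Real.pi_pos; positivity
    have h := (Real.tendsto_exp_neg_atTop_nhds_zero.comp (him.const_mul_atTop hpos)).add
      (him.const_div_atTop C)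
    simpa using h
  refine squeeze_zero_norm' ?_ h1
  have him : Filter.Tendsto UpperHalfPlane.im atImInfty Filter.atTop := Filter.tendsto_comap
  filter_upwards [him.eventually_ge_atTop 1] with z hz using hC v z hz

/-- Modulo N, γ⁻¹(1, 0) is a unit multiple of (1, 0), so the congruence on rows does not change. -/
theorem slashVec_Gamma0 {N : ℕ} {γ : SL(2, ℤ)} (hγ : γ ∈ CongruenceSubgroup.Gamma0 N) (c d : ℤ) :
    rowWeight N (slashVec γ (1, 0)) c d = rowWeight N (1, 0) c d := by
  have hdet := Matrix.det_fin_two (γ : Matrix (Fin 2) (Fin 2) ℤ)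
  rw [γ.det_coe] at hdet
  have h10 : (N : ℤ) ∣ γ 1 0 := by
    rw [CongruenceSubgroup.Gamma0_mem] at hγ
    exact (ZMod.intCast_zmod_eq_zero_iff_dvd _ _).1 hγ
  obtain ⟨k, hk⟩ := h10
  rw [hk] at hdet
  have hcop : IsCoprime (N : ℤ) (γ 1 1) := ⟨-(γ 0 1 * k), γ 0 0, by linear_combination -hdet⟩
  have key : (N : ℤ) ∣ c * γ 1 1 + d * -γ 1 0 ↔ (N : ℤ) ∣ c := by
    rw [hk, dvd_add_left ⟨-(d * k), by ring⟩]
    exact ⟨fun h => hcop.dvd_of_dvd_mul_right h, fun h => h.mul_right _⟩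
  rw [rowWeight, rowWeight, slashVec]
  simp only [mul_one, mul_zero, sub_zero, add_zero, key]

theorem poincareSeries_congr {N : ℕ} {v v' : ℤ × ℤ}
    (h : ∀ c d, rowWeight N v c d = rowWeight N v' c d) (m : ℕ) (z : ℂ) :
    poincareSeries N v m z = poincareSeries N v' m z := by
  simp only [poincareSeries, poincareTerm, h]

/-- The Poincaré series `∑ (c z + d)⁻² e(m γ z)` of weight `2` as a cusp form. -/
def poincareForm (N : ℕ) [NeZero N] {m : ℕ} (hm : 0 < m) : CuspForms₂ N where
  toFun z := poincareSeries N (1, 0) m z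
  slash_action_eq' := by
    rintro _ ⟨γ, hγ, rfl⟩
    refine (poincareSeries_slash N (1, 0) hm γ).trans ?_
    ext z
    exact poincareSeries_congr (slashVec_Gamma0 hγ) m z
  holo' := by
    rw [UpperHalfPlane.mdifferentiable_iff]
    intro z hz
    refine (differentiableAt_poincareSeries N (1, 0) hm hz).differentiableWithinAt.congr
      (fun w hw => ?_) ?_
    · simp [UpperHalfPlane.ofComplex_apply_of_im_pos hw]
    · simp [UpperHalfPlane.ofComplex_apply_of_im_pos hz]
  zero_at_cusps' {c} hc := by
    rw [Subgroup.IsArithmetic.isCusp_iff_isCusp_SL2Z] at hc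
    rw [OnePoint.isZeroAt_iff_forall_SL2Z hc]
    intro γ _
    -- At any cusp the expansion is that of the series for another vector, and the decay at infinity
    -- holds for every vector.
    have h := poincareSeries_slash N (1, 0) hm γ
    have h2 := tendsto_poincareSeries_atImInfty N (slashVec γ (1, 0)) hm
    rw [← h] at h2
    exact h2

theorem poincareForm_apply (N : ℕ) [NeZero N] {m : ℕ} (hm : 0 < m) (z : ℍ) :
    poincareForm N hm z = poincareSeries N (1, 0) m z := rfl

end

/-! ### Uniform bounds, the hyperbolic measure and finite covolume. -/

noncomputable section

/-- SL₂(ℤ) preserves |P| y up to changing v and R, so it suffices to treat Im z ≥ 1/2, where the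
bound is uniform in both. -/
theorem exists_norm_truncatedPoincare_mul_im_le (N : ℕ) [NeZero N] {m : ℕ} (hm : 0 < m) :
    ∃ C, ∀ (v : ℤ × ℤ) (R : ℝ) (z : ℍ), ‖truncatedPoincare N v m R z‖ * z.im ≤ C := by
  obtain ⟨C, hC0, hC⟩ := exists_norm_truncatedPoincare_le N hm (δ := 1 / 2) (by norm_num)
  refine ⟨2 + C, fun v R z => ?_⟩
  obtain ⟨g, hg⟩ := ModularGroup.exists_one_half_le_im_smul z
  set w := g • z with hw
  have hz : z = g⁻¹ • w := by rw [hw, inv_smul_smul]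
  have hd : 0 < ‖denom (g⁻¹ : SL(2, ℤ)) w‖ := norm_pos_iff.2 (denom_ne_zero _ w)
  have him : z.im = w.im / ‖denom (g⁻¹ : SL(2, ℤ)) w‖ ^ 2 := by
    rw [hz, ModularGroup.im_smul_eq_div_normSq, Complex.normSq_eq_norm_sq]
  have h1 := congrArg norm (truncatedPoincare_smul N v m R g⁻¹ w)
  rw [← hz, norm_mul, norm_zpow] at h1
  have h2 : ‖truncatedPoincare N v m R z‖ * z.im =
      ‖truncatedPoincare N (slashVec g⁻¹ v) m (R * ‖denom (g⁻¹ : SL(2, ℤ)) w‖) w‖ * w.im := by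
    rw [← h1, him, zpow_neg, zpow_ofNat]; ring
  rw [h2]
  have h3 := hC (slashVec g⁻¹ v) (R * ‖denom (g⁻¹ : SL(2, ℤ)) w‖) w hg
  have hm1 : (1 : ℝ) ≤ m := by exact_mod_cast hm
  have h4 : Real.exp (-(2 * Real.pi * m * w.im)) * w.im ≤ 1 := by
    have h5 : w.im ≤ 2 * Real.pi * m * w.im := by
      have := w.im_pos
      have : 1 ≤ 2 * Real.pi * m := by nlinarith [Real.pi_gt_three]
      nlinarith
    have h6 := Real.add_one_le_exp (2 * Real.pi * m * w.im)
    rw [Real.exp_neg, ← div_eq_inv_mul, div_le_one (Real.exp_pos _)]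
    linarith
  calc _ ≤ (2 * Real.exp (-(2 * Real.pi * m * w.im)) + C / w.im) * w.im := by
        have := w.im_pos; gcongr
    _ = 2 * (Real.exp (-(2 * Real.pi * m * w.im)) * w.im) + C := by
        have := w.im_pos.ne'; field_simp
    _ ≤ 2 + C := by linarith

/-- The coordinates `(x, y)` of a point of the upper half-plane. -/
def coordinates (z : ℍ) : ℝ × ℝ := (z.re, z.im)

theorem measurePreserving_coordinates :
    MeasurePreserving coordinates ((volume : Measure ℂ).comap UpperHalfPlane.coe)
      (volume.restrict {p : ℝ × ℝ | 0 < p.2}) := by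
  have h1 : MeasurePreserving UpperHalfPlane.coe ((volume : Measure ℂ).comap UpperHalfPlane.coe)
      (volume.restrict (Complex.measurableEquivRealProd ⁻¹' {p : ℝ × ℝ | 0 < p.2})) := by
    refine ⟨measurable_coe, ?_⟩
    rw [measurableEmbedding_coe.map_comap, range_coe]
    rfl
  exact (Complex.volume_preserving_equiv_real_prod.restrict_preimage_emb
    Complex.measurableEquivRealProd.measurableEmbedding _).comp h1

theorem measurableEmbedding_coordinates : MeasurableEmbedding coordinates :=
  Complex.measurableEquivRealProd.measurableEmbedding.comp measurableEmbedding_coe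

theorem measurable_inv_im :
    Measurable fun z : ℍ => ((1 / NNReal.mk z.im z.im_pos.le : NNReal) ^ 2) := by
  refine Measurable.pow_const (measurable_const.div ?_) 2
  exact (UpperHalfPlane.continuous_im.measurable).subtype_mk

/-- The factor y² cancels the density y⁻² of the hyperbolic measure. -/
theorem integrable_im_sq_mul_iff (φ : ℝ × ℝ → ℂ) :
    Integrable (fun z : ℍ => (z.im : ℂ) ^ 2 * φ (coordinates z)) volume ↔
      IntegrableOn φ {p : ℝ × ℝ | 0 < p.2} := by
  rw [IntegrableOn, ← measurePreserving_coordinates.integrable_comp_emb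
    measurableEmbedding_coordinates, UpperHalfPlane.volume_def,
    integrable_withDensity_iff_integrable_smul measurable_inv_im]
  refine integrable_congr (Filter.Eventually.of_forall fun z => ?_)
  have : (z.im : ℂ) ≠ 0 := by exact_mod_cast z.im_ne_zero
  simp only [NNReal.smul_def, Function.comp_apply]
  push_cast
  rw [Complex.real_smul]
  push_cast
  simp
  field_simp

theorem integral_im_sq_mul (φ : ℝ × ℝ → ℂ) :
    ∫ z : ℍ, (z.im : ℂ) ^ 2 * φ (coordinates z) = ∫ p in {p : ℝ × ℝ | 0 < p.2}, φ p := by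
  rw [← measurePreserving_coordinates.integral_comp measurableEmbedding_coordinates,
    UpperHalfPlane.volume_def, integral_withDensity_eq_integral_smul measurable_inv_im]
  refine integral_congr_ae (Filter.Eventually.of_forall fun z => ?_)
  have : (z.im : ℂ) ≠ 0 := by exact_mod_cast z.im_ne_zero
  simp only [NNReal.smul_def]
  push_cast
  rw [Complex.real_smul]
  push_cast
  simp
  field_simp

theorem volume_fd_lt_top : volume (ModularGroup.fd : Set ℍ) < ⊤ := by
  set S : Set (ℝ × ℝ) := Set.Icc (-1) 1 ×ˢ Set.Ioi (1 / 2 : ℝ) with hS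
  have hSm : MeasurableSet S := measurableSet_Icc.prod measurableSet_Ioi
  have h1 : IntegrableOn (fun p : ℝ × ℝ => ((p.2 ^ (-2 : ℝ) : ℝ) : ℂ)) S := by
    have h2 : Integrable (fun y : ℝ => ((y ^ (-2 : ℝ) : ℝ) : ℂ))
        (volume.restrict (Set.Ioi (1 / 2 : ℝ))) :=
      (integrableOn_Ioi_rpow_of_lt (by norm_num) (by norm_num)).ofReal
    have h3 : Integrable (fun _ : ℝ => (1 : ℂ)) (volume.restrict (Set.Icc (-1 : ℝ) 1)) :=
      integrable_const 1
    have h4 := h3.mul_prod h2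
    rw [Measure.prod_restrict] at h4
    simp only [one_mul] at h4
    exact h4
  have h5 : Integrable (S.indicator fun p : ℝ × ℝ => ((p.2 ^ (-2 : ℝ) : ℝ) : ℂ)) :=
    h1.integrable_indicator hSm
  have h6 := (integrable_im_sq_mul_iff _).2 (h5.integrableOn (s := {p : ℝ × ℝ | 0 < p.2}))
  -- The indicator of the strip is y² · y⁻², so its hyperbolic area is the finite Lebesgue integral
  -- of y⁻²; the standard domain lies in this strip.
  have h7 : (fun z : ℍ => (z.im : ℂ) ^ 2 * S.indicator (fun p : ℝ × ℝ =>
      ((p.2 ^ (-2 : ℝ) : ℝ) : ℂ)) (coordinates z)) =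
      (coordinates ⁻¹' S).indicator fun _ => (1 : ℂ) := by
    ext z
    by_cases hz : coordinates z ∈ S
    · rw [Set.indicator_of_mem hz, Set.indicator_of_mem (s := coordinates ⁻¹' S) hz]
      have : z.im ≠ 0 := z.im_ne_zero
      simp only [coordinates]
      rw [Real.rpow_neg z.im_pos.le, Real.rpow_ofNat]
      push_cast
      exact mul_inv_cancel₀ (by exact_mod_cast pow_ne_zero 2 this)
    · rw [Set.indicator_of_notMem hz, Set.indicator_of_notMem (s := coordinates ⁻¹' S) hz, mul_zero]
  rw [h7, integrable_indicator_iff (measurableEmbedding_coordinates.measurable hSm),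
    integrableOn_const_iff] at h6
  refine lt_of_le_of_lt (measure_mono fun z hz => ?_) (h6.resolve_left (by simp))
  have h8 := ModularGroup.three_le_four_mul_im_sq_of_mem_fd hz
  have h9 := abs_le.1 hz.2
  refine ⟨⟨?_, ?_⟩, ?_⟩
  · change -1 ≤ z.re; linarith
  · change z.re ≤ 1; linarith
  · change 1 / 2 < z.im
    have := z.im_pos
    nlinarith

instance : SMulInvariantMeasure SL(2, ℤ) ℍ volume :=
  ⟨fun g s _ => measure_preimage_smul (Matrix.SpecialLinearGroup.mapGL ℝ g) s (μ := volume)⟩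

/-- The group of transformations of the upper half-plane induced by `Γ₀(N)`. -/
abbrev gamma0Range (N : ℕ) : Subgroup (Equiv.Perm ℍ) :=
  (MulAction.toPermHom (CongruenceSubgroup.Gamma0 N) ℍ).range

/-- The transformation of the upper half-plane induced by `γ ∈ Γ₀(N)`. -/
def gamma0Perm {N : ℕ} (γ : CongruenceSubgroup.Gamma0 N) : gamma0Range N :=
  ⟨MulAction.toPermHom _ ℍ γ, γ, rfl⟩

theorem gamma0Perm_smul {N : ℕ} (γ : CongruenceSubgroup.Gamma0 N) (z : ℍ) :
    gamma0Perm γ • z = (γ : SL(2, ℤ)) • z := rfl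

theorem gamma0Perm_surjective (N : ℕ) : Function.Surjective (gamma0Perm (N := N)) := by
  rintro ⟨_, γ, rfl⟩
  exact ⟨γ, rfl⟩

instance (N : ℕ) : SMulInvariantMeasure (gamma0Range N) ℍ volume := by
  refine ⟨fun g s _ => ?_⟩
  obtain ⟨γ, rfl⟩ := gamma0Perm_surjective N g
  exact measure_preimage_smul (γ : SL(2, ℤ)) s (μ := volume)

instance (N : ℕ) : Countable (gamma0Range N) :=
  have : Countable (Matrix (Fin 2) (Fin 2) ℤ) := inferInstanceAs (Countable (Fin 2 → Fin 2 → ℤ))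
  have : Countable SL(2, ℤ) := Subtype.countable
  (gamma0Perm_surjective N).countable

instance (N : ℕ) : MeasurableConstSMul (gamma0Range N) ℍ := by
  refine ⟨fun g => ?_⟩
  obtain ⟨γ, rfl⟩ := gamma0Perm_surjective N g
  exact measurable_const_smul (Matrix.SpecialLinearGroup.mapGL ℝ (γ : SL(2, ℤ)))

-- The translates of `S` cover `D`, and the measures of their intersections with the fundamental
-- domain `D` add up to the measure of `S`.
open scoped Pointwise in
theorem measure_le_of_forall_exists_smul_mem {G α : Type*} [Group G] [Countable G] [MulAction G α]
    [MeasurableSpace α] {μ : Measure α} [SMulInvariantMeasure G α μ] [MeasurableConstSMul G α]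
    {D S : Set α} (hD : IsFundamentalDomain G D μ) (hS : ∀ x, ∃ g : G, g • x ∈ S) : μ D ≤ μ S := by
  have h1 : D ⊆ ⋃ g : G, g • S ∩ D := fun x hx => by
    obtain ⟨g, hg⟩ := hS x
    exact Set.mem_iUnion.2 ⟨g⁻¹, ⟨⟨_, hg, inv_smul_smul g x⟩, hx⟩⟩
  rw [hD.measure_eq_tsum S]
  exact (measure_mono h1).trans (measure_iUnion_le _)

-- Finite index: finitely many translates of the standard domain of SL₂(ℤ) meet every orbit of
-- Γ₀(N).
open scoped Pointwise in
theorem volume_lt_top_of_isFundamentalDomainGamma0 {N : ℕ} [NeZero N] {D : Set ℍ}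
    (hD : IsFundamentalDomainGamma0 N D) : volume D < ⊤ := by
  have hfin : Finite (SL(2, ℤ) ⧸ CongruenceSubgroup.Gamma0 N) :=
    Subgroup.finite_quotient_of_finiteIndex
  refine (measure_le_of_forall_exists_smul_mem (G := gamma0Range N)
    (S := ⋃ q : SL(2, ℤ) ⧸ CongruenceSubgroup.Gamma0 N, (q.out)⁻¹ • (ModularGroup.fd : Set ℍ))
    hD fun z => ?_).trans_lt ?_
  · obtain ⟨g, hg⟩ := ModularGroup.exists_smul_mem_fd z
    obtain ⟨h, hh⟩ := QuotientGroup.mk_out_eq_mul (CongruenceSubgroup.Gamma0 N) g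
    refine ⟨gamma0Perm h⁻¹, Set.mem_iUnion.2 ⟨(g : SL(2, ℤ) ⧸ CongruenceSubgroup.Gamma0 N), ?_⟩⟩
    rw [Set.mem_inv_smul_set_iff, hh, gamma0Perm_smul, smul_smul, InvMemClass.coe_inv,
      mul_inv_cancel_right]
    exact hg
  · refine (measure_iUnion_le _).trans_lt ?_
    simp only [measure_smul]
    have := Fintype.ofFinite (SL(2, ℤ) ⧸ CongruenceSubgroup.Gamma0 N)
    rw [tsum_fintype]
    exact ENNReal.sum_lt_top.2 fun _ _ => volume_fd_lt_top

end

/-! ### The integral over the strip 0 ≤ x < 1, y > ε. -/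

noncomputable section

/-- The function on a half-strip whose sum over the transformations in `Γ₀(N)` is
`y² conj (f z)` times a truncated Poincaré series. -/
def unfoldKernel (f : ℍ → ℂ) (m : ℕ) (ε : ℝ) (z : ℍ) : ℂ :=
  (z.im : ℂ) ^ 2 * (Set.Ico (0 : ℝ) 1 ×ˢ Set.Ioi ε).indicator
    (fun p : ℝ × ℝ => conj (f (ofComplex (p.1 + p.2 * Complex.I))) *
      Complex.exp (2 * Real.pi * Complex.I * m * (p.1 + p.2 * Complex.I))) (coordinates z)

theorem unfoldKernel_eq (f : ℍ → ℂ) (m : ℕ) (ε : ℝ) (z : ℍ) :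
    unfoldKernel f m ε z = if (0 ≤ z.re ∧ z.re < 1) ∧ ε < z.im then
      (z.im : ℂ) ^ 2 * (conj (f z) * expForm m z) else 0 := by
  rw [unfoldKernel, Set.indicator_apply]
  have hz : (z.re : ℂ) + z.im * Complex.I = (z : ℂ) := Complex.re_add_im z
  simp only [coordinates, Set.mem_prod, Set.mem_Ico, Set.mem_Ioi, hz, ofComplex_apply, expForm,
    mul_ite, mul_zero]

theorem one_mem_strictPeriods_Gamma0 {N : ℕ} :
    (1 : ℝ) ∈ ((CongruenceSubgroup.Gamma0 N).map
      (Matrix.SpecialLinearGroup.mapGL ℝ)).strictPeriods := by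
  rw [Subgroup.strictPeriods_eq_zmultiples_one_of_T_mem]
  · exact AddSubgroup.mem_zmultiples 1
  · exact CongruenceSubgroup.Gamma0_mem.2 (by simp [ModularGroup.T])

section Integral

variable {N : ℕ} (f : CuspForms₂ N)

theorem exists_norm_mul_im_le [NeZero N] : ∃ C, 0 ≤ C ∧ ∀ z : ℍ, ‖f z‖ * z.im ≤ C := by
  obtain ⟨C, hC⟩ := CuspFormClass.exists_bound f
  refine ⟨max C 0, le_max_right _ _, fun z => ?_⟩
  have h := hC z
  norm_num at h
  rw [le_div_iff₀ z.im_pos] at h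
  exact h.trans (le_max_left _ _)

/-- The integral over x picks out the m-th coefficient; conj(f) and e(mz) each contribute a factor
e^{-2πmt}. -/
theorem integral_unfold_strip (m : ℕ) {t : ℝ} (ht : 0 < t) :
    ∫ x in Set.Ico (0 : ℝ) 1, conj (f (ofComplex (x + t * Complex.I))) *
      Complex.exp (2 * Real.pi * Complex.I * m * (x + t * Complex.I)) =
    conj (fourierCoeff₂ m f) * Complex.exp ((-(4 * Real.pi * m) : ℝ) * t) := by
  have h := ModularFormClass.qExpansion_coeff_eq_intervalIntegral f one_pos
    one_mem_strictPeriods_Gamma0 m ht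
  rw [fourierCoeff₂, h, intervalIntegral.integral_of_le zero_le_one, integral_Ico_eq_integral_Ioc]
  simp only [Complex.ofReal_one, div_one, one_mul]
  rw [← integral_conj, ← integral_mul_const]
  refine integral_congr_ae (Filter.Eventually.of_forall fun x => ?_)
  have him : 0 < ((x : ℂ) + t * Complex.I).im := by simpa using ht
  simp only [map_mul, ofComplex_apply_of_im_pos him]
  rw [mul_comm (conj (1 / _)), mul_assoc (conj (f _))]
  refine congrArg₂ _ rfl ?_
  rw [Function.Periodic.qParam, ← Complex.exp_nat_mul, one_div, ← Complex.exp_neg, ← Complex.exp_conj,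
    ← Complex.exp_add]
  congr 1
  simp only [Complex.ofReal_one, div_one, map_neg, map_mul, map_add, Complex.conj_ofReal,
    Complex.conj_I, map_natCast, map_ofNat]
  push_cast
  linear_combination (4 * (Real.pi : ℂ) * m * t) * Complex.I_sq

theorem integrableOn_unfold_strip [NeZero N] {m : ℕ} (hm : 0 < m) {ε : ℝ} (hε : 0 < ε) :
    IntegrableOn (fun p : ℝ × ℝ => conj (f (ofComplex (p.1 + p.2 * Complex.I))) *
      Complex.exp (2 * Real.pi * Complex.I * m * (p.1 + p.2 * Complex.I)))
      (Set.Ico (0 : ℝ) 1 ×ˢ Set.Ioi ε) := by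
  obtain ⟨C, hC0, hC⟩ := exists_norm_mul_im_le f
  have hpos : 0 < 2 * Real.pi * m := by have := Real.pi_pos; positivity
  have h2 : Integrable (fun y : ℝ => C / ε * Real.exp (-(2 * Real.pi * m) * y))
      (volume.restrict (Set.Ioi ε)) :=
    (integrableOn_exp_mul_Ioi (by linarith) ε).const_mul _
  have h3 : Integrable (fun _ : ℝ => (1 : ℝ)) (volume.restrict (Set.Ico (0 : ℝ) 1)) :=
    integrable_const 1
  have h4 := h3.mul_prod h2
  rw [Measure.prod_restrict] at h4
  have hS : MeasurableSet (Set.Ico (0 : ℝ) 1 ×ˢ Set.Ioi ε) := measurableSet_Ico.prod measurableSet_Ioi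
  refine Integrable.mono' h4 ?_ ?_
  · refine ContinuousOn.aestronglyMeasurable ?_ hS
    have hf : ContinuousOn (fun w : ℂ => f (ofComplex w)) {w | 0 < w.im} :=
      (UpperHalfPlane.mdifferentiable_iff.1 (CuspFormClass.holo f)).continuousOn
    have hg : ContinuousOn (fun p : ℝ × ℝ => f (ofComplex (p.1 + p.2 * Complex.I)))
        (Set.Ico (0 : ℝ) 1 ×ˢ Set.Ioi ε) :=
      hf.comp (f := fun p : ℝ × ℝ => (p.1 + p.2 * Complex.I : ℂ)) (by fun_prop) fun p hp => by
        simpa using hε.trans hp.2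
    exact (Complex.continuous_conj.comp_continuousOn hg).mul (by fun_prop)
  · rw [ae_restrict_iff' hS]
    refine Filter.Eventually.of_forall fun p hp => ?_
    have him : 0 < ((p.1 : ℂ) + p.2 * Complex.I).im := by simpa using hε.trans hp.2
    have h5 := hC ⟨_, him⟩
    have h6 : (⟨(p.1 : ℂ) + p.2 * Complex.I, him⟩ : ℍ).im = p.2 := by
      change ((p.1 : ℂ) + p.2 * Complex.I).im = p.2
      simp
    rw [h6] at h5
    have h7 : ‖f ⟨(p.1 : ℂ) + p.2 * Complex.I, him⟩‖ ≤ C / ε := by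
      rw [le_div_iff₀ hε]
      refine le_trans ?_ h5
      have := (Set.mem_Ioi.1 hp.2).le
      gcongr
    rw [norm_mul, RCLike.norm_conj, ofComplex_apply_of_im_pos him, Complex.norm_exp, one_mul]
    refine mul_le_mul h7 (Real.exp_le_exp.2 (le_of_eq ?_)) (Real.exp_pos _).le (by positivity)
    simp

theorem integrable_unfoldKernel [NeZero N] {m : ℕ} (hm : 0 < m) {ε : ℝ} (hε : 0 < ε) :
    Integrable (unfoldKernel f m ε) := by
  refine (integrable_im_sq_mul_iff _).2 ?_
  exact ((integrableOn_unfold_strip f hm hε).integrable_indicator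
    (measurableSet_Ico.prod measurableSet_Ioi)).integrableOn

theorem integral_unfoldKernel [NeZero N] {m : ℕ} (hm : 0 < m) {ε : ℝ} (hε : 0 < ε) :
    ∫ z, unfoldKernel f m ε z =
      conj (fourierCoeff₂ m f) * (Real.exp (-(4 * Real.pi * m) * ε) / (4 * Real.pi * m)) := by
  have hS : MeasurableSet (Set.Ico (0 : ℝ) 1 ×ˢ Set.Ioi ε) := measurableSet_Ico.prod measurableSet_Ioi
  have hpos : 0 < 4 * Real.pi * m := by have := Real.pi_pos; positivity
  have hsub : Set.Ico (0 : ℝ) 1 ×ˢ Set.Ioi ε ⊆ {p : ℝ × ℝ | 0 < p.2} := fun p hp => hε.trans hp.2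
  have h := integrableOn_unfold_strip f hm hε
  rw [IntegrableOn, Measure.volume_eq_prod, ← Measure.prod_restrict] at h
  have h1 := fun {t : ℝ} (ht : 0 < t) => integral_unfold_strip f m ht
  unfold unfoldKernel
  rw [integral_im_sq_mul, setIntegral_indicator hS, Set.inter_eq_self_of_subset_right hsub,
    Measure.volume_eq_prod, ← Measure.prod_restrict, integral_prod_symm _ h,
    setIntegral_congr_fun measurableSet_Ioi fun t ht => h1 (hε.trans ht), integral_const_mul,
    integral_exp_mul_complex_Ioi (by simpa using hpos)]
  push_cast
  rw [neg_div_neg_eq]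

end Integral
end

/-! ### Transformations in Γ₀(N) versus rows up to sign. -/

noncomputable section

/-- A choice of representatives of the non-zero rows up to sign. -/
def IsPosRow (p : Fin 2 → ℤ) : Prop := 0 < p 0 ∨ p 0 = 0 ∧ 0 < p 1

theorem isPosRow_neg_iff {p : Fin 2 → ℤ} (hp : p ≠ 0) : IsPosRow (-p) ↔ ¬ IsPosRow p := by
  have h : p 0 = 0 → p 1 ≠ 0 := fun h0 h1 => hp (by ext i; fin_cases i <;> simp [h0, h1])
  simp only [IsPosRow, Pi.neg_apply]
  omega

theorem tsum_eq_two_mul_tsum_isPosRow {F : (Fin 2 → ℤ) → ℂ} (hF : F.support.Finite) (h0 : F 0 = 0)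
    (hneg : ∀ p, F (-p) = F p) [DecidablePred IsPosRow] :
    ∑' p, F p = 2 * ∑' p, if IsPosRow p then F p else 0 := by
  have hs : Summable fun p => if IsPosRow p then F p else 0 :=
    summable_of_hasFiniteSupport (hF.subset fun p hp h => hp (by simp [h]))
  have h1 : ∀ p, F p = (if IsPosRow p then F p else 0) + (if IsPosRow (-p) then F (-p) else 0) := by
    intro p
    by_cases hp : p = 0
    · subst hp; simp [h0]
    · by_cases h : IsPosRow p <;> simp [h, isPosRow_neg_iff hp, hneg]
  have h2 : Summable fun p => if IsPosRow (-p) then F (-p) else 0 :=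
    (Equiv.neg (Fin 2 → ℤ)).summable_iff.2 hs
  rw [tsum_congr h1, hs.tsum_add h2, two_mul]
  congr 1
  exact (Equiv.neg (Fin 2 → ℤ)).tsum_eq (fun p => if IsPosRow p then F p else 0)

/-- Equal transformations give equal imaginary parts, hence |cz+d| = |c'z+d'| for all z, and this
quadratic form determines (c, d) up to sign. -/
theorem row_eq_or_eq_neg_of_gamma0Perm_eq {N : ℕ} {γ γ' : CongruenceSubgroup.Gamma0 N}
    (h : gamma0Perm γ = gamma0Perm γ') :
    ((γ : SL(2, ℤ)) : Matrix (Fin 2) (Fin 2) ℤ) 1 = ((γ' : SL(2, ℤ)) : Matrix (Fin 2) (Fin 2) ℤ) 1 ∨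
    ((γ : SL(2, ℤ)) : Matrix (Fin 2) (Fin 2) ℤ) 1 = -((γ' : SL(2, ℤ)) : Matrix (Fin 2) (Fin 2) ℤ) 1 := by
  set c := (γ : SL(2, ℤ)) 1 0 with hc
  set d := (γ : SL(2, ℤ)) 1 1 with hd
  set c' := (γ' : SL(2, ℤ)) 1 0 with hc'
  set d' := (γ' : SL(2, ℤ)) 1 1 with hd'
  have key : ∀ x y : ℤ, 0 < y → (c * x + d) ^ 2 + (c * y) ^ 2 = (c' * x + d') ^ 2 + (c' * y) ^ 2 := by
    intro x y hy
    have hy' : (0 : ℝ) < y := by exact_mod_cast hy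
    set z : ℍ := ⟨⟨x, y⟩, hy'⟩ with hz
    have h1 : (γ : SL(2, ℤ)) • z = (γ' : SL(2, ℤ)) • z := by
      rw [← gamma0Perm_smul, ← gamma0Perm_smul, h]
    have h2 := congrArg UpperHalfPlane.im h1
    rw [ModularGroup.im_smul_eq_div_normSq, ModularGroup.im_smul_eq_div_normSq,
      div_eq_div_iff (Complex.normSq_pos.2 (denom_ne_zero _ z)).ne' (Complex.normSq_pos.2 (denom_ne_zero _ z)).ne'] at h2
    have h3 := mul_left_cancel₀ z.im_ne_zero h2
    rw [ModularGroup.denom_apply, ModularGroup.denom_apply, Complex.normSq_apply,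
      Complex.normSq_apply] at h3
    have hre : (z : ℂ).re = x := rfl
    have him : (z : ℂ).im = y := rfl
    simp only [Complex.add_re, Complex.mul_re, Complex.intCast_re, Complex.intCast_im, zero_mul,
      sub_zero, Complex.add_im, Complex.mul_im, add_zero, hre, him] at h3
    rw [← hc, ← hd, ← hc', ← hd'] at h3
    have h4 : ((c * x + d) ^ 2 + (c * y) ^ 2 : ℝ) = (c' * x + d') ^ 2 + (c' * y) ^ 2 := by linarith
    exact_mod_cast h4
  -- The points i, 2i and 1 + i yield c², d² and cd.
  have k1 := key 0 1 one_pos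
  have k2 := key 0 2 two_pos
  have k3 := key 1 1 one_pos
  have hcc : c ^ 2 = c' ^ 2 := by linarith
  have hdd : d ^ 2 = d' ^ 2 := by linarith
  have hcd : c * d = c' * d' := by linarith
  have hext : ∀ {p q : Fin 2 → ℤ}, p 0 = q 0 → p 1 = q 1 → p = q := fun h0 h1 => by
    ext i; fin_cases i <;> assumption
  rcases sq_eq_sq_iff_eq_or_eq_neg.1 hcc with h0 | h0
  · by_cases hz : c' = 0
    · rcases sq_eq_sq_iff_eq_or_eq_neg.1 hdd with h1 | h1
      · exact Or.inl (hext h0 h1)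
      · exact Or.inr (hext (by change c = -c'; omega) h1)
    · rw [h0] at hcd
      exact Or.inl (hext h0 (mul_left_cancel₀ hz hcd))
  · by_cases hz : c' = 0
    · rcases sq_eq_sq_iff_eq_or_eq_neg.1 hdd with h1 | h1
      · exact Or.inl (hext (by change c = c'; omega) h1)
      · exact Or.inr (hext h0 h1)
    · rw [h0, neg_mul, ← mul_neg] at hcd
      have := mul_left_cancel₀ hz hcd
      exact Or.inr (hext h0 (by change d = -d'; omega))

/-- The matrices differ by a translation by n, and two real parts in [0, 1) force n = 0. -/
theorem gamma0Perm_eq_of_row_eq {N : ℕ} {γ γ' : CongruenceSubgroup.Gamma0 N} {z : ℍ}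
    (h : ((γ : SL(2, ℤ)) : Matrix (Fin 2) (Fin 2) ℤ) 1 =
      ((γ' : SL(2, ℤ)) : Matrix (Fin 2) (Fin 2) ℤ) 1)
    (h1 : 0 ≤ ((γ : SL(2, ℤ)) • z).re ∧ ((γ : SL(2, ℤ)) • z).re < 1)
    (h2 : 0 ≤ ((γ' : SL(2, ℤ)) • z).re ∧ ((γ' : SL(2, ℤ)) • z).re < 1) :
    gamma0Perm γ = gamma0Perm γ' := by
  have h0 : ((γ : SL(2, ℤ)) * (γ' : SL(2, ℤ))⁻¹) 1 0 = 0 := by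
    have e0 : (γ : SL(2, ℤ)) 1 0 = (γ' : SL(2, ℤ)) 1 0 := congrFun h 0
    have e1 : (γ : SL(2, ℤ)) 1 1 = (γ' : SL(2, ℤ)) 1 1 := congrFun h 1
    rw [Matrix.SpecialLinearGroup.coe_mul, Matrix.SpecialLinearGroup.coe_inv,
      Matrix.adjugate_fin_two, Matrix.mul_apply, Fin.sum_univ_two]
    simp [e0, e1]; ring
  obtain ⟨n, hn⟩ := ModularGroup.exists_eq_T_zpow_of_c_eq_zero h0
  have h3 : ∀ w : ℍ, (γ : SL(2, ℤ)) • w = ModularGroup.T ^ n • (γ' : SL(2, ℤ)) • w := by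
    intro w
    rw [← hn, smul_smul, inv_mul_cancel_right]
  have h4 := h3 z
  rw [h4, ModularGroup.re_T_zpow_smul] at h1
  have h5 : n = 0 := by
    have a1 : (-1 : ℝ) < n := by linarith
    have a2 : (n : ℝ) < 1 := by linarith
    have a1' : (-1 : ℤ) < n := by exact_mod_cast a1
    have a2' : n < 1 := by exact_mod_cast a2
    omega
  apply Subtype.ext
  ext1 w
  change (γ : SL(2, ℤ)) • w = (γ' : SL(2, ℤ)) • w
  rw [h3, h5, zpow_zero, one_smul]

theorem exists_row_eq_re_mem {N : ℕ} {p : Fin 2 → ℤ} (hp : IsCoprime (p 0) (p 1))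
    (hN : (N : ℤ) ∣ p 0) (z : ℍ) : ∃ γ : CongruenceSubgroup.Gamma0 N,
      ((γ : SL(2, ℤ)) : Matrix (Fin 2) (Fin 2) ℤ) 1 = p ∧
      0 ≤ ((γ : SL(2, ℤ)) • z).re ∧ ((γ : SL(2, ℤ)) • z).re < 1 := by
  obtain ⟨γ, rfl⟩ := exists_row_eq hp
  set n : ℤ := -⌊(γ • z).re⌋
  have hrow : ((ModularGroup.T ^ n * γ : SL(2, ℤ)) : Matrix (Fin 2) (Fin 2) ℤ) 1 =
      (γ : Matrix (Fin 2) (Fin 2) ℤ) 1 := by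
    ext i
    rw [Matrix.SpecialLinearGroup.coe_mul, ModularGroup.coe_T_zpow, Matrix.mul_apply, Fin.sum_univ_two]
    simp
  refine ⟨⟨ModularGroup.T ^ n * γ, ?_⟩, hrow, ?_⟩
  · rw [CongruenceSubgroup.Gamma0_mem, congrFun hrow 0]
    exact (ZMod.intCast_zmod_eq_zero_iff_dvd _ _).2 hN
  · change 0 ≤ ((ModularGroup.T ^ n * γ) • z).re ∧ ((ModularGroup.T ^ n * γ) • z).re < 1
    rw [mul_smul, ModularGroup.re_T_zpow_smul]
    have h1 := Int.floor_le (γ • z).re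
    have h2 := Int.lt_floor_add_one (γ • z).re
    simp only [n, Int.cast_neg]
    constructor <;> linarith


/-- The summand of the truncated Poincaré series, multiplied by `y² conj (f z)`. -/
def unfoldTerm (N : ℕ) (f : ℍ → ℂ) (m : ℕ) (ε : ℝ) (z : ℍ) (p : Fin 2 → ℤ) : ℂ :=
  (z.im : ℂ) ^ 2 * conj (f z) * (if ‖(p 0 : ℂ) * z + p 1‖ < √(z.im / ε) then
    rowWeight N (1, 0) (p 0) (p 1) * rowTerm m p z else 0)

/-- Since Im γz = y/|cz+d|², the condition Im γz > ε is exactly |cz+d| < √(y/ε). The automorphy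
factors of y², conj(f) and e(mγz) combine into the weight 2 term. -/
theorem unfoldKernel_smul {N : ℕ} (f : CuspForms₂ N) (m : ℕ) {ε : ℝ} (hε : 0 < ε) (z : ℍ)
    (γ : CongruenceSubgroup.Gamma0 N)
    (h : 0 ≤ ((γ : SL(2, ℤ)) • z).re ∧ ((γ : SL(2, ℤ)) • z).re < 1) :
    unfoldKernel f m ε ((γ : SL(2, ℤ)) • z) =
      unfoldTerm N f m ε z (((γ : SL(2, ℤ)) : Matrix (Fin 2) (Fin 2) ℤ) 1) := by
  have hd : 0 < ‖denom (γ : SL(2, ℤ)) z‖ := norm_pos_iff.2 (denom_ne_zero _ z)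
  have hd0 : denom (γ : SL(2, ℤ)) z ≠ 0 := denom_ne_zero _ z
  have him : ((γ : SL(2, ℤ)) • z).im = z.im / ‖denom (γ : SL(2, ℤ)) z‖ ^ 2 := by
    rw [ModularGroup.im_smul_eq_div_normSq, Complex.normSq_eq_norm_sq]
  have hden : ((((γ : SL(2, ℤ)) : Matrix (Fin 2) (Fin 2) ℤ) 1 0 : ℤ) : ℂ) * z +
      (((γ : SL(2, ℤ)) : Matrix (Fin 2) (Fin 2) ℤ) 1 1 : ℤ) = denom (γ : SL(2, ℤ)) z :=
    (ModularGroup.denom_apply _ z).symm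
  have hw : rowWeight N (1, 0) ((((γ : SL(2, ℤ)) : Matrix (Fin 2) (Fin 2) ℤ) 1) 0)
      ((((γ : SL(2, ℤ)) : Matrix (Fin 2) (Fin 2) ℤ) 1) 1) = 1 := by
    rw [rowWeight, if_pos]
    have := CongruenceSubgroup.Gamma0_mem.1 γ.2
    have h2 := (ZMod.intCast_zmod_eq_zero_iff_dvd _ _).1 this
    simpa using h2
  have hiff : ε < ((γ : SL(2, ℤ)) • z).im ↔ ‖denom (γ : SL(2, ℤ)) z‖ < √(z.im / ε) := by
    rw [him, Real.lt_sqrt hd.le, lt_div_iff₀ (by positivity), lt_div_iff₀ hε, mul_comm]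
  have hf : f ((γ : SL(2, ℤ)) • z) = denom (γ : SL(2, ℤ)) z ^ 2 * f z := by
    have h1 : (f : ℍ → ℂ) ∣[(2 : ℤ)] (γ : SL(2, ℤ)) = f :=
      SlashInvariantForm.slash_action_eqn f _ ⟨γ, γ.2, rfl⟩
    have h2 := congrFun h1 z
    rw [ModularForm.SL_slash_apply, zpow_neg, zpow_ofNat] at h2
    rw [← h2, mul_comm (f _), mul_inv_cancel_left₀ (pow_ne_zero 2 hd0)]
  have hnorm : ((‖denom (γ : SL(2, ℤ)) z‖ : ℝ) : ℂ) ^ 2 =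
      conj (denom (γ : SL(2, ℤ)) z) * denom (γ : SL(2, ℤ)) z := by
    rw [Complex.conj_mul']
  rw [unfoldKernel_eq, unfoldTerm, hden, hw, one_mul, rowTerm_row, ModularForm.SL_slash_apply]
  simp only [h, true_and, hiff]
  split_ifs with h3
  · have hc0 : conj (denom (γ : SL(2, ℤ)) z) ≠ 0 := (map_ne_zero _).2 hd0
    rw [him, hf, zpow_neg, zpow_ofNat, map_mul, map_pow]
    push_cast
    rw [hnorm]
    field_simp
  · simp

/-- Each row up to sign that contributes comes from exactly one transformation sending z into the
strip 0 ≤ x < 1; the half removes the sign. -/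
theorem tsum_unfoldKernel_smul {N : ℕ} (f : CuspForms₂ N) (m : ℕ) {ε : ℝ} (hε : 0 < ε) (z : ℍ) :
    ∑' g : gamma0Range N, unfoldKernel f m ε (g⁻¹ • z) =
      (z.im : ℂ) ^ 2 * conj (f z) * (truncatedPoincare N (1, 0) m √(z.im / ε) z / 2) := by
  classical
  set F := unfoldTerm N f m ε z with hF
  have hsupp : F.support.Finite := (finite_setOf_norm_linear_lt z √(z.im / ε)).subset fun p hp => by
    by_contra h
    exact hp ((congrArg _ (if_neg h)).trans (mul_zero _))
  have hsum : ∑' p, F p = (z.im : ℂ) ^ 2 * conj (f z) * truncatedPoincare N (1, 0) m √(z.im / ε) z := by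
    rw [truncatedPoincare, ← tsum_mul_left]; rfl
  have hcop : ∀ p, F p ≠ 0 → IsCoprime (p 0) (p 1) ∧ (N : ℤ) ∣ p 0 := by
    intro p hp
    constructor
    · by_contra h
      exact hp (by rw [hF, unfoldTerm, rowTerm_of_not_isCoprime m h, mul_zero, ite_self, mul_zero])
    · by_contra h
      have h1 : rowWeight N (1, 0) (p 0) (p 1) = 0 := if_neg (by simpa using h)
      exact hp (by rw [hF, unfoldTerm, h1, zero_mul, ite_self, mul_zero])
  have h0 : F 0 = 0 := by
    by_contra h
    have := (hcop 0 h).1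
    simp [isCoprime_zero_left] at this
  have hneg : ∀ p, F (-p) = F p := by
    intro p
    simp only [hF, unfoldTerm, rowTerm_neg, Pi.neg_apply, rowWeight_neg, Int.cast_neg]
    rw [neg_mul, ← neg_add, norm_neg]
  rw [← mul_div_assoc, ← hsum, tsum_eq_two_mul_tsum_isPosRow hsupp h0 hneg,
    mul_div_cancel_left₀ _ two_ne_zero]
  refine ((Equiv.inv (gamma0Range N)).tsum_eq (fun g => unfoldKernel f m ε (g • z))).trans ?_
  have hex : ∀ p : Function.support fun p => if IsPosRow p then F p else 0,
      ∃ γ : CongruenceSubgroup.Gamma0 N, ((γ : SL(2, ℤ)) : Matrix (Fin 2) (Fin 2) ℤ) 1 = p ∧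
        0 ≤ ((γ : SL(2, ℤ)) • z).re ∧ ((γ : SL(2, ℤ)) • z).re < 1 := by
    rintro ⟨p, hp⟩
    have hp' : F p ≠ 0 := fun h => hp (by simp [h])
    exact exists_row_eq_re_mem (hcop p hp').1 (hcop p hp').2 z
  choose γ hrow hre using hex
  have hpos : ∀ p : Function.support fun p => if IsPosRow p then F p else 0, IsPosRow p :=
    fun p => by
      by_contra h
      exact p.2 (if_neg h)
  refine tsum_eq_tsum_of_ne_zero_bij (fun p => gamma0Perm (γ p)) ?_ ?_ ?_
  · intro p q hpq
    have h1 := row_eq_or_eq_neg_of_gamma0Perm_eq hpq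
    rw [hrow, hrow] at h1
    rcases h1 with h1 | h1
    · exact Subtype.ext h1
    · have hq0 : (q : Fin 2 → ℤ) ≠ 0 := by
        intro h
        have := hpos q
        rw [h] at this
        simp [IsPosRow] at this
      exact absurd (hpos q) ((isPosRow_neg_iff hq0).1 (h1 ▸ hpos p))
  · intro g hg
    obtain ⟨δ, hδ⟩ := gamma0Perm_surjective N g
    -- As δ and -δ induce the same transformation, the bottom row may be taken positive.
    obtain ⟨δ', hδ', hpos'⟩ : ∃ δ' : CongruenceSubgroup.Gamma0 N, gamma0Perm δ' = g ∧
        IsPosRow (((δ' : SL(2, ℤ)) : Matrix (Fin 2) (Fin 2) ℤ) 1) := by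
      by_cases h : IsPosRow (((δ : SL(2, ℤ)) : Matrix (Fin 2) (Fin 2) ℤ) 1)
      · exact ⟨δ, hδ, h⟩
      · refine ⟨⟨-δ, ?_⟩, ?_, ?_⟩
        · have := CongruenceSubgroup.Gamma0_mem.1 δ.2
          rw [CongruenceSubgroup.Gamma0_mem]
          simpa using this
        · rw [← hδ]
          apply Subtype.ext
          ext1 w
          exact ModularGroup.SL_neg_smul (δ : SL(2, ℤ)) w
        · have h1 : (((-(δ : SL(2, ℤ)) : SL(2, ℤ))) : Matrix (Fin 2) (Fin 2) ℤ) 1 =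
              -(((δ : SL(2, ℤ)) : Matrix (Fin 2) (Fin 2) ℤ) 1) := by
            ext i; simp
          rw [h1, isPosRow_neg_iff]
          · exact h
          · intro h2
            have h3 := ModularGroup.bottom_row_coprime (δ : SL(2, ℤ))
            rw [congrFun h2 0, congrFun h2 1] at h3
            exact not_isUnit_zero (isCoprime_zero_left.1 h3)
    have hre' : 0 ≤ ((δ' : SL(2, ℤ)) • z).re ∧ ((δ' : SL(2, ℤ)) • z).re < 1 := by
      by_contra h
      refine hg ?_
      rw [← hδ']
      change unfoldKernel f m ε ((δ' : SL(2, ℤ)) • z) = 0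
      rw [unfoldKernel_eq, if_neg fun h4 => h h4.1]
    have hne : (if IsPosRow (((δ' : SL(2, ℤ)) : Matrix (Fin 2) (Fin 2) ℤ) 1) then
        F (((δ' : SL(2, ℤ)) : Matrix (Fin 2) (Fin 2) ℤ) 1) else 0) ≠ 0 := by
      rw [if_pos hpos', hF, ← unfoldKernel_smul f m hε z δ' hre']
      rw [← hδ'] at hg
      exact hg
    refine ⟨⟨_, hne⟩, ?_⟩
    rw [← hδ']
    exact gamma0Perm_eq_of_row_eq (hrow ⟨_, hne⟩) (hre ⟨_, hne⟩) hre'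
  · intro p
    change unfoldKernel f m ε ((γ p : SL(2, ℤ)) • z) = if IsPosRow p then F p else 0
    rw [unfoldKernel_smul f m hε z (γ p) (hre p), hrow, if_pos (hpos p)]

end

/-! ### Unfolding the Petersson product with the Poincaré series. -/

noncomputable section

theorem IsFundamentalDomainGamma0.isFundamentalDomain {N : ℕ} {D : Set ℍ}
    (hD : IsFundamentalDomainGamma0 N D) : IsFundamentalDomain (gamma0Range N) D volume := hD

theorem measurable_rowTerm (m : ℕ) (p : Fin 2 → ℤ) : Measurable (rowTerm m p) := by
  by_cases hp : IsCoprime (p 0) (p 1)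
  · obtain ⟨γ, rfl⟩ := exists_row_eq hp
    have h1 : Measurable fun z : ℍ => expForm m (γ • z) := by
      have h2 : Continuous (expForm m) := by unfold expForm; fun_prop
      exact h2.measurable.comp (measurable_const_smul (Matrix.SpecialLinearGroup.mapGL ℝ γ))
    have h3 : Measurable fun z : ℍ =>
        ((((γ : Matrix (Fin 2) (Fin 2) ℤ) 1 0 : ℂ) * z + (γ : Matrix (Fin 2) (Fin 2) ℤ) 1 1) ^ 2)⁻¹ := by
      refine Measurable.inv (Continuous.measurable ?_)
      fun_prop
    convert h1.mul h3 using 1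
    ext z
    rw [rowTerm_row, ModularForm.SL_slash_apply, ModularGroup.denom_apply, zpow_neg, zpow_ofNat]
    rfl
  · have : rowTerm m p = fun _ => 0 := funext fun z => rowTerm_of_not_isCoprime m hp z
    rw [this]
    exact measurable_const

theorem measurable_truncatedPoincare (N : ℕ) (v : ℤ × ℤ) (m : ℕ) {R : ℍ → ℝ} (hR : Measurable R) :
    Measurable fun z => truncatedPoincare N v m (R z) z := by
  have h1 : ∀ p : Fin 2 → ℤ, Measurable fun z : ℍ =>
      if ‖(p 0 : ℂ) * z + p 1‖ < R z then rowWeight N v (p 0) (p 1) * rowTerm m p z else 0 := by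
    intro p
    refine Measurable.ite (measurableSet_lt ?_ hR) ((measurable_rowTerm m p).const_mul _)
      measurable_const
    exact Continuous.measurable (by fun_prop)
  have h2 : ∀ z : ℍ, HasSum (fun p : Fin 2 → ℤ => if ‖(p 0 : ℂ) * z + p 1‖ < R z then
      rowWeight N v (p 0) (p 1) * rowTerm m p z else 0) (truncatedPoincare N v m (R z) z) :=
    fun z => (summable_of_hasFiniteSupport
      ((finite_setOf_norm_linear_lt z (R z)).subset fun p hp => by
        by_contra h
        exact hp (if_neg h))).hasSum
  exact measurable_of_tendsto_metrizable' Filter.atTop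
    (fun s : Finset (Fin 2 → ℤ) => Finset.measurable_sum s fun p _ => h1 p)
    (tendsto_pi_nhds.2 fun z => by simpa [HasSum] using! h2 z)

/-- Unfolding over a fundamental domain. -/
theorem setIntegral_tsum_inv_smul {G α : Type*} [Group G] [Countable G] [MulAction G α]
    [MeasurableSpace α] {μ : Measure α} [SMulInvariantMeasure G α μ] [MeasurableConstSMul G α]
    {D : Set α} (hD : IsFundamentalDomain G D μ) {F : α → ℂ} (hF : Integrable F μ) :
    ∫ x in D, ∑' g : G, F (g⁻¹ • x) ∂μ = ∫ x, F x ∂μ := by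
  rw [hD.integral_eq_tsum' _ hF]
  refine integral_tsum (fun g => ?_) ?_
  · exact ((measurePreserving_smul g⁻¹ μ).integrable_comp_of_integrable
      hF).aestronglyMeasurable.restrict
  · rw [← hD.lintegral_eq_tsum' fun z => ‖F z‖ₑ]
    exact hF.2.ne

theorem setIntegral_truncated {N : ℕ} [NeZero N] {D : Set ℍ} (hD : IsFundamentalDomainGamma0 N D)
    (f : CuspForms₂ N) {m : ℕ} (hm : 0 < m) {ε : ℝ} (hε : 0 < ε) :
    ∫ z in D, (z.im : ℂ) ^ 2 * conj (f z) * (truncatedPoincare N (1, 0) m √(z.im / ε) z / 2) =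
      conj (fourierCoeff₂ m f) * (Real.exp (-(4 * Real.pi * m) * ε) / (4 * Real.pi * m)) := by
  rw [← integral_unfoldKernel f hm hε]
  simp only [← tsum_unfoldKernel_smul f m hε]
  exact setIntegral_tsum_inv_smul hD.isFundamentalDomain (integrable_unfoldKernel f hm hε)

/-- Unfolding is exact for each ε > 0; as ε → 0 the integrands converge pointwise under a constant
bound on a domain of finite volume. -/
theorem peterssonInner_poincareForm {N : ℕ} [NeZero N] {D : Set ℍ}
    (hD : IsFundamentalDomainGamma0 N D) (f : CuspForms₂ N) {m : ℕ} (hm : 0 < m) :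
    peterssonInner D f (poincareForm N hm) = conj (fourierCoeff₂ m f) / (4 * Real.pi * m) := by
  obtain ⟨C, hC0, hC⟩ := exists_norm_mul_im_le f
  obtain ⟨C', hC'⟩ := exists_norm_truncatedPoincare_mul_im_le N hm
  have hfin : IsFiniteMeasure (volume.restrict D : Measure ℍ) :=
    ⟨by simpa using volume_lt_top_of_isFundamentalDomainGamma0 hD⟩
  have hlim : Filter.Tendsto (fun ε : ℝ => ∫ z in D, (z.im : ℂ) ^ 2 * conj (f z) *
      (truncatedPoincare N (1, 0) m √(z.im / ε) z / 2)) (nhdsWithin 0 (Set.Ioi 0))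
      (nhds (peterssonInner D f (poincareForm N hm))) := by
    refine tendsto_integral_filter_of_dominated_convergence (fun _ => C * C') ?_ ?_
      (integrable_const _) ?_
    · refine Filter.Eventually.of_forall fun ε => Measurable.aestronglyMeasurable ?_
      have hf : Continuous f := (CuspFormClass.holo f).continuous
      have hR : Measurable fun z : ℍ => √(z.im / ε) :=
        (UpperHalfPlane.continuous_im.measurable.div_const ε).sqrt
      refine Measurable.mul (Continuous.measurable ?_)
        ((measurable_truncatedPoincare N (1, 0) m hR).div_const 2)
      exact ((Complex.continuous_ofReal.comp UpperHalfPlane.continuous_im).pow 2).mul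
        (Complex.continuous_conj.comp hf)
    · refine Filter.Eventually.of_forall fun ε => Filter.Eventually.of_forall fun z => ?_
      have h1 := hC z
      have h2 := hC' (1, 0) √(z.im / ε) z
      rw [norm_mul, norm_mul, norm_div, RCLike.norm_conj, norm_pow, Complex.norm_real,
        Real.norm_of_nonneg z.im_pos.le, RCLike.norm_ofNat]
      have h3 : 0 ≤ ‖truncatedPoincare N (1, 0) m √(z.im / ε) z‖ * z.im := by
        have := z.im_pos; positivity
      have h4 : 0 ≤ ‖f z‖ * z.im := by have := z.im_pos; positivity
      have h5 := mul_le_mul h1 h2 h3 hC0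
      nlinarith [mul_nonneg h4 h3]
    · refine Filter.Eventually.of_forall fun z => ?_
      have h1 : petersson 2 f (poincareForm N hm) z =
          (z.im : ℂ) ^ 2 * conj (f z) * (2 * poincareSeries N (1, 0) m z / 2) := by
        rw [petersson, poincareForm_apply, mul_div_cancel_left₀ _ two_ne_zero, zpow_ofNat]; ring
      rw [h1]
      refine ((((tendsto_truncatedPoincare N (1, 0) hm z).comp ?_).div_const 2).const_mul _)
      refine Real.tendsto_sqrt_atTop.comp ?_
      exact (tendsto_inv_nhdsGT_zero.const_mul_atTop z.im_pos)
  have hlim2 : Filter.Tendsto (fun ε : ℝ => conj (fourierCoeff₂ m f) *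
      ((Real.exp (-(4 * Real.pi * m) * ε) : ℂ) / (4 * Real.pi * m))) (nhdsWithin 0 (Set.Ioi 0))
      (nhds (conj (fourierCoeff₂ m f) *
        ((Real.exp (-(4 * Real.pi * m) * 0) : ℂ) / (4 * Real.pi * m)))) := by
    refine (ContinuousAt.tendsto ?_).mono_left nhdsWithin_le_nhds
    fun_prop
  have h := tendsto_nhds_unique hlim (hlim2.congr' ?_)
  · rw [h]; simp [div_eq_mul_inv]
  · filter_upwards [self_mem_nhdsWithin] with ε hε
    exact (setIntegral_truncated hD f hm hε).symm

end

/-! ### Bessel series and Lipschitz' formula. -/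

noncomputable section

/-- The terms of the power series `∑ (-x)^k / (k! (k + 1)!)`. -/
def besselSumTerm (x : ℂ) (k : ℕ) : ℂ :=
  (-1 : ℂ) ^ k / ((k.factorial : ℂ) * ((k + 1).factorial : ℂ)) * x ^ k

/-- The power series `∑ (-x)^k / (k! (k + 1)!)`, so that `J₁(z) = (z / 2) besselSum ((z / 2)²)`. -/
def besselSum (x : ℂ) : ℂ := ∑' k, besselSumTerm x k

theorem besselJOne_eq (z : ℂ) : besselJOne z = z / 2 * besselSum ((z / 2) ^ 2) := by
  rw [besselJOne, besselSum, ← tsum_mul_left]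
  refine tsum_congr fun k => ?_
  rw [besselSumTerm, pow_succ (z / 2), pow_mul]
  ring

/-- One of the two factorials absorbs (εt)^k into e^{εt}, with ε free; the other keeps the series in
k convergent. -/
theorem norm_besselSumTerm_le {x : ℂ} {b t ε : ℝ} (hε : 0 < ε) (hb : 0 ≤ b) (ht : 0 ≤ t)
    (hx : ‖x‖ ≤ b * t) (k : ℕ) :
    ‖besselSumTerm x k‖ ≤ (b / ε) ^ k / k.factorial * Real.exp (ε * t) := by
  have h1 : (0 : ℝ) < k.factorial := by exact_mod_cast k.factorial_pos
  have h2 : (k.factorial : ℝ) ≤ (k + 1).factorial := by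
    exact_mod_cast Nat.factorial_le (Nat.le_succ k)
  rw [besselSumTerm, norm_mul, norm_div, norm_mul, norm_pow, norm_neg, norm_one, one_pow,
    Complex.norm_natCast, Complex.norm_natCast, norm_pow]
  have h3 : ‖x‖ ^ k ≤ (b / ε) ^ k * (ε * t) ^ k := by
    rw [← mul_pow]
    refine pow_le_pow_left₀ (norm_nonneg x) (hx.trans (le_of_eq ?_)) k
    field_simp
  have h4 := Real.pow_div_factorial_le_exp (ε * t) (by positivity) k
  calc 1 / ((k.factorial : ℝ) * (k + 1).factorial) * ‖x‖ ^ k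
      ≤ 1 / ((k.factorial : ℝ) * k.factorial) * ((b / ε) ^ k * (ε * t) ^ k) := by
        gcongr
    _ = (b / ε) ^ k / k.factorial * ((ε * t) ^ k / k.factorial) := by ring
    _ ≤ _ := by gcongr

theorem norm_besselSum_le {x : ℂ} {b t ε : ℝ} (hε : 0 < ε) (hb : 0 ≤ b) (ht : 0 ≤ t)
    (hx : ‖x‖ ≤ b * t) : ‖besselSum x‖ ≤ Real.exp (b / ε) * Real.exp (ε * t) := by
  refine tsum_of_norm_bounded ?_ (norm_besselSumTerm_le hε hb ht hx)
  refine HasSum.mul_right _ ?_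
  rw [Real.exp_eq_exp_ℝ]
  exact NormedSpace.expSeries_div_hasSum_exp (b / ε)

/-- Expansion of `∑ (τ + l)⁻² exp (- 2 π i a / (τ + l))` in powers of `e^{2 π i τ}`. -/
theorem tsum_inv_sq_mul_exp (τ : ℍ) {a : ℝ} (ha : 0 ≤ a) :
    ∑' l : ℤ, (((τ : ℂ) + l) ^ 2)⁻¹ * Complex.exp (-(2 * Real.pi * Complex.I * a / (τ + l))) =
      ∑' n : ℕ, -(4 * Real.pi ^ 2 * n) * besselSum (4 * Real.pi ^ 2 * a * n) *
        Complex.exp (2 * Real.pi * Complex.I * τ) ^ n := by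
  have hpi := Real.pi_pos
  have hy := τ.im_pos
  set q := Complex.exp (2 * Real.pi * Complex.I * τ) with hq
  have hqn : ‖q‖ = Real.exp (-(2 * Real.pi * τ.im)) := by
    rw [hq, Complex.norm_exp]; simp
  set F : ℤ → ℕ → ℂ := fun l k =>
    (-(2 * Real.pi * Complex.I * a)) ^ k / k.factorial * (1 / ((τ : ℂ) + l) ^ (k + 1 + 1)) with hF
  set G : ℕ → ℕ → ℂ := fun k n =>
    -(4 * Real.pi ^ 2 * n) * besselSumTerm (4 * Real.pi ^ 2 * a * n) k * q ^ n with hG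
  have hle : ∀ l : ℤ, τ.im ≤ ‖(τ : ℂ) + l‖ := fun l => by
    have := Complex.im_le_norm ((τ : ℂ) + l)
    simpa using this
  have hne : ∀ l : ℤ, (τ : ℂ) + l ≠ 0 := fun l => norm_pos_iff.1 (hy.trans_le (hle l))
  have h1 : ∀ l : ℤ, (((τ : ℂ) + l) ^ 2)⁻¹ *
      Complex.exp (-(2 * Real.pi * Complex.I * a / (τ + l))) = ∑' k, F l k := by
    intro l
    rw [Complex.exp_eq_exp_ℂ, ← (NormedSpace.expSeries_div_hasSum_exp
      (-(2 * Real.pi * Complex.I * a / ((τ : ℂ) + l)))).tsum_eq, ← tsum_mul_left]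
    refine tsum_congr fun k => ?_
    simp only [hF]
    have := hne l
    rw [neg_div', div_pow]
    field_simp
    ring
  have hFs : Summable (Function.uncurry F) := by
    have hb := (EisensteinSeries.linear_right_summable (τ : ℂ) 1 (k := 2) le_rfl).norm.mul_of_nonneg
      (Real.summable_pow_div_factorial (2 * Real.pi * a / τ.im)) (fun _ => norm_nonneg _)
      (fun k => by positivity)
    refine Summable.of_norm_bounded hb ?_
    rintro ⟨l, k⟩
    simp only [Function.uncurry, hF]
    rw [norm_mul, norm_div, norm_pow, norm_neg, Complex.norm_natCast, norm_div, norm_one, norm_pow,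
      norm_inv, Int.cast_one, one_mul, norm_zpow, zpow_ofNat]
    have h2 : ‖(2 * Real.pi * Complex.I * a : ℂ)‖ = 2 * Real.pi * a := by
      simp [abs_of_pos hpi, abs_of_nonneg ha]
    rw [h2]
    have h3 : (0 : ℝ) < ‖(τ : ℂ) + l‖ := hy.trans_le (hle l)
    have h4 : τ.im ^ k ≤ ‖(τ : ℂ) + l‖ ^ k := pow_le_pow_left₀ hy.le (hle l) k
    calc (2 * Real.pi * a) ^ k / k.factorial * (1 / ‖(τ : ℂ) + l‖ ^ (k + 1 + 1))
        = (2 * Real.pi * a) ^ k / k.factorial * (1 / ‖(τ : ℂ) + l‖ ^ k) *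
          (‖(τ : ℂ) + l‖ ^ 2)⁻¹ := by field_simp; ring
      _ ≤ (2 * Real.pi * a) ^ k / k.factorial * (1 / τ.im ^ k) * (‖(τ : ℂ) + l‖ ^ 2)⁻¹ := by
          gcongr
      _ = _ := by rw [div_pow]; ring
  have h2 : ∀ k, ∑' l, F l k = ∑' n, G k n := by
    intro k
    simp only [hF, hG]
    -- Lipschitz' formula with exponent k + 2, applied to each term of the exponential series.
    rw [tsum_mul_left, EisensteinSeries.qExpansion_identity (Nat.le_add_left 1 k), ← tsum_mul_left,
      ← tsum_mul_left]
    refine tsum_congr fun n => ?_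
    rw [besselSumTerm, ← hq]
    have e1 : (-2 * (Real.pi : ℂ) * Complex.I) ^ (k + 1 + 1) =
        (-2 * (Real.pi : ℂ) * Complex.I) ^ k * (-(4 * (Real.pi : ℂ) ^ 2)) := by
      rw [pow_succ, pow_succ, mul_assoc]
      congr 1
      linear_combination (4 * (Real.pi : ℂ) ^ 2) * Complex.I_sq
    have e2 : (-(2 * (Real.pi : ℂ) * Complex.I * a)) ^ k * (-2 * (Real.pi : ℂ) * Complex.I) ^ k =
        (-1) ^ k * (4 * (Real.pi : ℂ) ^ 2 * a) ^ k := by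
      rw [← mul_pow, ← mul_pow]
      congr 1
      linear_combination (4 * (Real.pi : ℂ) ^ 2 * a) * Complex.I_sq
    have e3 : (4 * (Real.pi : ℂ) ^ 2 * a * n) ^ k = (4 * (Real.pi : ℂ) ^ 2 * a) ^ k * n ^ k :=
      mul_pow _ _ _
    rw [e1, e3]
    linear_combination (-(4 * (Real.pi : ℂ) ^ 2)) / (k.factorial * (k + 1).factorial) * n ^ (k + 1) *
      q ^ n * e2
  have hGs : Summable (Function.uncurry G) := by
    -- The growth e^{εn} then uses up only half of the decay |q|ⁿ = e^{-2πn Im τ}.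
    set ε := Real.pi * τ.im with hε
    have hε0 : 0 < ε := by positivity
    have hr : ‖Real.exp (-ε)‖ < 1 := by
      rw [Real.norm_of_nonneg (Real.exp_pos _).le]; exact Real.exp_lt_one_iff.2 (by linarith)
    have hb := (Real.summable_pow_div_factorial (4 * Real.pi ^ 2 * a / ε)).mul_of_nonneg
      ((summable_pow_mul_geometric_of_norm_lt_one 1 hr).mul_left (4 * Real.pi ^ 2))
      (fun k => by positivity) (fun k => by positivity)
    refine Summable.of_norm_bounded hb ?_
    rintro ⟨k, n⟩
    simp only [Function.uncurry, hG]
    have h3 := norm_besselSumTerm_le (x := 4 * Real.pi ^ 2 * a * n) (b := 4 * Real.pi ^ 2 * a)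
      (t := n) hε0 (by positivity) (by positivity) (by simp [abs_of_pos hpi, abs_of_nonneg ha]) k
    have h4 : ‖-(4 * (Real.pi : ℂ) ^ 2 * n)‖ = 4 * Real.pi ^ 2 * n := by simp
    have h5 : Real.exp (ε * n) * ‖q‖ ^ n = Real.exp (-ε) ^ n := by
      rw [hqn, ← Real.exp_nat_mul, ← Real.exp_nat_mul, ← Real.exp_add, hε]; congr 1; ring
    rw [norm_mul, norm_mul, h4, norm_pow, pow_one, ← h5]
    calc _ ≤ 4 * Real.pi ^ 2 * n * ((4 * Real.pi ^ 2 * a / ε) ^ k / k.factorial *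
          Real.exp (ε * n)) * ‖q‖ ^ n := by gcongr
      _ = _ := by ring
  rw [tsum_congr h1, ← hFs.tsum_comm, tsum_congr h2, ← hGs.tsum_comm]
  refine tsum_congr fun n => ?_
  simp only [hG]
  rw [tsum_mul_right, tsum_mul_left, besselSum]

end

/-! ### Kloosterman sums in the Fourier expansion. -/

noncomputable section

/-- Substitute r = q⁻¹k⁻¹; the phase vanishes off the units. -/
theorem sum_kloostermanPhase_mul (m n : ℕ) {c q : ℕ} [NeZero c] (h : Nat.Coprime c q) :
    ∑ r : ZMod c, kloostermanPhase m c ((q : ZMod c) * r) * ZMod.stdAddChar ((n : ZMod c) * r) =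
      kloostermanSum c m ((n : ZMod c) * (q : ZMod c)⁻¹) := by
  set u := ZMod.unitOfCoprime q h.symm with hu
  have hq : (q : ZMod c) = u := rfl
  rw [kloostermanSum, eq_comm]
  refine Fintype.sum_of_injective (fun k : (ZMod c)ˣ => ((u⁻¹ * k⁻¹ : (ZMod c)ˣ) : ZMod c)) ?_ _ _ ?_ ?_
  · intro k k' hk
    simpa using Units.val_injective hk
  · intro r hr
    rw [kloostermanPhase, if_neg, zero_mul]
    rintro ⟨w, hw⟩
    refine hr ⟨w⁻¹, ?_⟩
    have h1 : r = ((u⁻¹ * w : (ZMod c)ˣ) : ZMod c) := by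
      rw [Units.val_mul, hw, hq, Units.inv_mul_cancel_left]
    simp only [h1, inv_inv]
  · intro k
    have h1 : (q : ZMod c) * ((u⁻¹ * k⁻¹ : (ZMod c)ˣ) : ZMod c) = ((k⁻¹ : (ZMod c)ˣ) : ZMod c) := by
      rw [hq, Units.val_mul, Units.mul_inv_cancel_left]
    rw [kloostermanPhase, h1, if_pos (Units.isUnit _), ZMod.inv_coe_unit, inv_inv,
      ← AddChar.map_add_eq_mul, hq, ZMod.inv_coe_unit, Units.val_mul, mul_assoc]

theorem sum_fin_natCast_zmod (c : ℕ) [NeZero c] (g : ZMod c → ℂ) :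
    ∑ r : Fin c, g ((r : ℕ) : ZMod c) = ∑ r : ZMod c, g r := by
  refine Fintype.sum_bijective (fun r : Fin c => ((r : ℕ) : ZMod c))
    ((Fintype.bijective_iff_injective_and_card _).2 ⟨fun r s h => ?_, by simp⟩) _ _ fun _ => rfl
  have := (ZMod.natCast_eq_natCast_iff' _ _ _).1 h
  rw [Nat.mod_eq_of_lt r.2, Nat.mod_eq_of_lt s.2] at this
  exact Fin.ext this

/-- The coefficient of `e^{2 π i n τ}` in the expansion `tsum_inv_sq_mul_exp`. -/
def besselCoeff (a : ℝ) (n : ℕ) : ℂ :=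
  -(4 * Real.pi ^ 2 * n) * besselSum (4 * Real.pi ^ 2 * a * n)

theorem norm_besselCoeff_le {a A ε : ℝ} (ha : 0 ≤ a) (hA : a ≤ A) (hε : 0 < ε) (n : ℕ) :
    ‖besselCoeff a n‖ ≤ Real.exp (4 * Real.pi ^ 2 * A / ε) * (4 * Real.pi ^ 2 * (n * Real.exp (ε * n))) := by
  have hpi := Real.pi_pos
  have h1 := norm_besselSum_le (x := 4 * Real.pi ^ 2 * a * n) (b := 4 * Real.pi ^ 2 * A) (t := n) hε
    (by have := ha.trans hA; positivity) (by positivity) (by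
      simp only [norm_mul, norm_pow, RCLike.norm_ofNat, Complex.norm_real, Complex.norm_natCast,
        Real.norm_eq_abs, abs_of_pos hpi, abs_of_nonneg ha]
      gcongr)
  have h4 : ‖-(4 * (Real.pi : ℂ) ^ 2 * n)‖ = 4 * Real.pi ^ 2 * n := by simp
  rw [besselCoeff, norm_mul, h4]
  calc _ ≤ 4 * Real.pi ^ 2 * n * (Real.exp (4 * Real.pi ^ 2 * A / ε) * Real.exp (ε * n)) := by
        gcongr
    _ = _ := by ring

theorem norm_exp_two_pi_I (z : ℍ) :
    ‖Complex.exp (2 * Real.pi * Complex.I * z)‖ = Real.exp (-(2 * Real.pi * z.im)) := by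
  rw [Complex.norm_exp]; simp

theorem norm_besselCoeff_mul_pow_le {a A : ℝ} (ha : 0 ≤ a) (hA : a ≤ A) (z : ℍ) (n : ℕ) :
    ‖besselCoeff a n * Complex.exp (2 * Real.pi * Complex.I * z) ^ n‖ ≤
      Real.exp (4 * Real.pi ^ 2 * A / (Real.pi * z.im)) *
        (4 * Real.pi ^ 2 * (n * Real.exp (-(Real.pi * z.im)) ^ n)) := by
  have hpi := Real.pi_pos
  have h5 : Real.exp (Real.pi * z.im * n) * Real.exp (-(2 * Real.pi * z.im)) ^ n =
      Real.exp (-(Real.pi * z.im)) ^ n := by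
    rw [← Real.exp_nat_mul, ← Real.exp_nat_mul, ← Real.exp_add]; congr 1; ring
  rw [norm_mul, norm_pow, norm_exp_two_pi_I, ← h5]
  refine (mul_le_mul_of_nonneg_right (norm_besselCoeff_le ha hA (mul_pos hpi z.im_pos) n)
    (by positivity)).trans (le_of_eq ?_)
  ring

theorem summable_mul_exp_pow (z : ℍ) (C : ℝ) : Summable fun n : ℕ =>
    C * (4 * Real.pi ^ 2 * (n * Real.exp (-(Real.pi * z.im)) ^ n)) := by
  have hr : ‖Real.exp (-(Real.pi * z.im))‖ < 1 := by
    rw [Real.norm_of_nonneg (Real.exp_pos _).le]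
    exact Real.exp_lt_one_iff.2 (neg_lt_zero.2 (mul_pos Real.pi_pos z.im_pos))
  simpa using ((summable_pow_mul_geometric_of_norm_lt_one 1 hr).mul_left (4 * Real.pi ^ 2)).mul_left C

theorem summable_besselCoeff_mul_pow {a : ℝ} (ha : 0 ≤ a) (z : ℍ) :
    Summable fun n : ℕ => besselCoeff a n * Complex.exp (2 * Real.pi * Complex.I * z) ^ n :=
  Summable.of_norm_bounded (summable_mul_exp_pow z _) (norm_besselCoeff_mul_pow_le ha le_rfl z)

theorem tsum_int_eq_sum_fin_tsum (c : ℕ) [NeZero c] {f : ℤ → ℂ} (hf : Summable f) :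
    ∑' d, f d = ∑ r : Fin c, ∑' l : ℤ, f (l * c + (r : ℕ)) := by
  have hs : Summable fun p : ℤ × Fin c => f (p.1 * c + ((p.2 : ℕ) : ℤ)) :=
    (Int.divModEquiv c).symm.summable_iff.2 hf
  have h1 : ∑' d, f d = ∑' p : ℤ × Fin c, f (p.1 * c + ((p.2 : ℕ) : ℤ)) :=
    ((Int.divModEquiv c).symm.tsum_eq f).symm
  have h2 : Summable fun p : Fin c × ℤ => f (p.2 * c + ((p.1 : ℕ) : ℤ)) :=
    (Equiv.prodComm (Fin c) ℤ).summable_iff.2 hs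
  have h3 : ∑' p : ℤ × Fin c, f (p.1 * c + ((p.2 : ℕ) : ℤ)) =
      ∑' p : Fin c × ℤ, f (p.2 * c + ((p.1 : ℕ) : ℤ)) :=
    ((Equiv.prodComm (Fin c) ℤ).tsum_eq fun p : ℤ × Fin c => f (p.1 * c + ((p.2 : ℕ) : ℤ))).symm
  rw [h1, h3, h2.tsum_prod, tsum_fintype]

/-- For d = lc + r, cz + d = c(z + r/c + l), so Lipschitz' formula applies at z + r/c and produces
the character e(nr/c). -/
theorem tsum_residue (m : ℕ) {c q : ℕ} [NeZero c] [NeZero q] (r : ℕ) (z : ℍ) :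
    ∑' l : ℤ, (((c : ℂ) * z + ((l * c + (r : ℤ) : ℤ) : ℂ)) ^ 2)⁻¹ *
        Complex.exp (-(2 * Real.pi * Complex.I * m / (q * c * (c * z + ((l * c + r : ℤ) : ℂ))))) =
      ((c : ℂ) ^ 2)⁻¹ * ∑' n : ℕ, besselCoeff (m / (q * c ^ 2)) n *
        (ZMod.stdAddChar ((n : ZMod c) * (r : ZMod c)) *
          Complex.exp (2 * Real.pi * Complex.I * z) ^ n) := by
  have hc : (c : ℂ) ≠ 0 := by exact_mod_cast NeZero.ne c
  have hq : (q : ℂ) ≠ 0 := by exact_mod_cast NeZero.ne q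
  have him : 0 < ((z : ℂ) + (r : ℂ) / c).im := by
    have h : (r : ℂ) / c = ((r / c : ℝ) : ℂ) := by push_cast; rfl
    rw [h]; simpa using z.im_pos
  have h := tsum_inv_sq_mul_exp ⟨_, him⟩ (a := m / (q * c ^ 2)) (by positivity)
  have hexp : ∀ n : ℕ, Complex.exp (2 * Real.pi * Complex.I * ((z : ℂ) + (r : ℂ) / c)) ^ n =
      ZMod.stdAddChar ((n : ZMod c) * (r : ZMod c)) *
        Complex.exp (2 * Real.pi * Complex.I * z) ^ n := by
    intro n
    have e1 := ZMod.stdAddChar_coe (N := c) ((n * r : ℕ) : ℤ)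
    push_cast at e1
    rw [e1, ← Complex.exp_nat_mul, ← Complex.exp_nat_mul, ← Complex.exp_add]
    congr 1
    ring
  have h2 : ∀ n : ℕ, besselCoeff (m / (q * c ^ 2)) n *
      (ZMod.stdAddChar ((n : ZMod c) * (r : ZMod c)) *
        Complex.exp (2 * Real.pi * Complex.I * z) ^ n) =
      -(4 * Real.pi ^ 2 * n) * besselSum (4 * Real.pi ^ 2 * (m / (q * c ^ 2) : ℝ) * n) *
        Complex.exp (2 * Real.pi * Complex.I * ((z : ℂ) + (r : ℂ) / c)) ^ n := fun n => by
    rw [hexp, besselCoeff]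
  rw [tsum_congr h2]
  refine Eq.trans ?_ (congrArg (fun x => ((c : ℂ) ^ 2)⁻¹ * x) h)
  rw [← tsum_mul_left]
  refine tsum_congr fun l => ?_
  have e1 : (c : ℂ) * z + ((l * c + (r : ℤ) : ℤ) : ℂ) = c * ((z : ℂ) + (r : ℂ) / c + l) := by
    push_cast; field_simp; ring
  have e3 : ∀ w : ℂ, 2 * (Real.pi : ℂ) * Complex.I * m / (q * c * (c * w)) =
      2 * Real.pi * Complex.I * (m / (q * c ^ 2) : ℝ) / w := by
    intro w
    push_cast
    rw [mul_div_assoc', div_div]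
    congr 1
    ring
  rw [e1, e3, mul_pow, mul_inv, mul_assoc]

/-- The terms with lower left entry `c` contribute Kloosterman sums times Bessel functions to the
Fourier expansion. -/
theorem tsum_kloostermanPhase_mul (m : ℕ) {c q : ℕ} [NeZero c] [NeZero q] (h : Nat.Coprime c q)
    (z : ℍ) :
    ∑' d : ℤ, kloostermanPhase m c ((q : ZMod c) * d) * ((((c : ℂ) * z + d) ^ 2)⁻¹ *
        Complex.exp (-(2 * Real.pi * Complex.I * m / (q * c * (c * z + d))))) =
      ∑' n : ℕ, ((c : ℂ) ^ 2)⁻¹ * kloostermanSum c m ((n : ZMod c) * (q : ZMod c)⁻¹) *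
        (besselCoeff (m / (q * c ^ 2)) n * Complex.exp (2 * Real.pi * Complex.I * z) ^ n) := by
  have hc0 : 0 < c := Nat.pos_of_ne_zero (NeZero.ne c)
  have hfs : Summable fun d : ℤ => kloostermanPhase m c ((q : ZMod c) * d) *
      ((((c : ℂ) * z + d) ^ 2)⁻¹ *
        Complex.exp (-(2 * Real.pi * Complex.I * m / (q * c * (c * z + d))))) := by
    refine Summable.of_norm_bounded (summable_norm_linear_sq_inv c z) fun d => ?_
    rw [norm_mul, norm_mul, norm_inv, norm_pow, Complex.norm_exp]
    have h1 := norm_kloostermanPhase_le m c ((q : ZMod c) * d)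
    have h2 : (-(2 * Real.pi * Complex.I * m / (q * c * (c * z + d)))).re ≤ 0 := by
      have := neg_two_pi_I_div_re_nonpos m (q * c) (linear_im_pos hc0 z.im_pos d)
      push_cast at this
      exact this
    have h3 := Real.exp_le_one_iff.2 h2
    calc _ ≤ 1 * ((‖(c : ℂ) * z + d‖ ^ 2)⁻¹ * 1) := by gcongr
      _ = _ := by ring
  have hr : ∀ r : Fin c, ∑' l : ℤ, kloostermanPhase m c ((q : ZMod c) * ((l * c + (r : ℕ) : ℤ) : ZMod c)) *
      ((((c : ℂ) * z + ((l * c + (r : ℕ) : ℤ) : ℂ)) ^ 2)⁻¹ *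
        Complex.exp (-(2 * Real.pi * Complex.I * m / (q * c * (c * z + ((l * c + (r : ℕ) : ℤ) : ℂ)))))) =
      ∑' n : ℕ, ((c : ℂ) ^ 2)⁻¹ * (kloostermanPhase m c ((q : ZMod c) * ((r : ℕ) : ZMod c)) *
        ZMod.stdAddChar ((n : ZMod c) * ((r : ℕ) : ZMod c))) *
        (besselCoeff (m / (q * c ^ 2)) n * Complex.exp (2 * Real.pi * Complex.I * z) ^ n) := by
    intro r
    have e2 : ∀ l : ℤ, ((l * c + (r : ℕ) : ℤ) : ZMod c) = (r : ℕ) := fun l => by push_cast; simp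
    simp only [e2]
    rw [tsum_mul_left, tsum_residue, ← tsum_mul_left, ← tsum_mul_left]
    refine tsum_congr fun n => ?_
    ring
  rw [tsum_int_eq_sum_fin_tsum c hfs, Finset.sum_congr rfl fun r _ => hr r,
    ← Summable.tsum_finsetSum]
  · refine tsum_congr fun n => ?_
    rw [← Finset.sum_mul, ← Finset.mul_sum, sum_fin_natCast_zmod c fun r =>
      kloostermanPhase m c ((q : ZMod c) * r) * ZMod.stdAddChar ((n : ZMod c) * r),
      sum_kloostermanPhase_mul m n h]
  · intro r _
    refine Summable.of_norm_bounded
      ((summable_besselCoeff_mul_pow (a := m / (q * c ^ 2)) (by positivity) z).norm.mul_left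
        ‖((c : ℂ) ^ 2)⁻¹‖) fun n => ?_
    rw [norm_mul, norm_mul, norm_mul (kloostermanPhase _ _ _), AddChar.norm_apply, mul_one]
    refine mul_le_mul_of_nonneg_right ?_ (norm_nonneg _)
    exact mul_le_of_le_one_right (norm_nonneg _) (norm_kloostermanPhase_le _ _ _)

end

/-! ### The image of the Poincaré series under w_Q. -/

noncomputable section

namespace ExactDivisor

variable {N : ℕ} (Q : ExactDivisor N)

theorem bezout : (Q.val : ℤ) * Nat.gcdA Q.val (N / Q.val) + ((N / Q.val : ℕ) : ℤ) *
    Nat.gcdB Q.val (N / Q.val) = 1 := by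
  have h := Nat.gcd_eq_gcd_ab Q.val (N / Q.val)
  rw [Nat.Coprime.gcd_eq_one Q.coprime] at h
  exact_mod_cast h.symm

theorem mul_div_eq : Q.val * (N / Q.val) = N := Nat.mul_div_cancel' Q.dvd

/-- The matrix `σ ∈ SL₂(ℤ)` with `W_Q = σ (Q, 0; 0, 1)`. -/
def toSL : SL(2, ℤ) :=
  ⟨!![1, -Nat.gcdB Q.val (N / Q.val); ((N / Q.val : ℕ) : ℤ), (Q.val : ℤ) * Nat.gcdA Q.val (N / Q.val)],
    by rw [Matrix.det_fin_two_of]; linear_combination Q.bezout⟩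

/-- The vector attached to the image of the Poincaré series under `w_Q`. -/
def vec : ℤ × ℤ := slashVec Q.toSL (1, 0)

/-- The single congruence modulo N = Q · (N/Q) splits into one modulo each coprime factor, by the
Bézout relation. -/
theorem rowWeight_vec (c d : ℤ) : rowWeight N Q.vec c d =
    if ((N / Q.val : ℕ) : ℤ) ∣ c ∧ (Q.val : ℤ) ∣ d then 1 else 0 := by
  have hb := Q.bezout
  have hN : (N : ℤ) = Q.val * ((N / Q.val : ℕ) : ℤ) := by exact_mod_cast Q.mul_div_eq.symm
  rw [rowWeight]
  congr 1
  simp only [vec, slashVec, toSL, Matrix.SpecialLinearGroup.coe_mk, Matrix.of_apply, Matrix.cons_val',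
    Matrix.cons_val_zero, Matrix.cons_val_one, Matrix.cons_val_fin_one, mul_one, mul_zero, sub_zero,
    add_zero, eq_iff_iff]
  set M : ℤ := ((N / Q.val : ℕ) : ℤ)
  set q : ℤ := (Q.val : ℤ)
  set t := Nat.gcdA Q.val (N / Q.val)
  set s := Nat.gcdB Q.val (N / Q.val)
  rw [hN]
  constructor
  · rintro ⟨k, hk⟩
    exact ⟨⟨c * s + q * k + d, by linear_combination hk - c * hb⟩,
      ⟨d * t + s * (c * t - M * k), by linear_combination (-d) * hb - s * hk⟩⟩
  · rintro ⟨⟨k, rfl⟩, ⟨l, rfl⟩⟩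
    exact ⟨k * t - l, by ring⟩

variable [NeZero N]

instance : NeZero Q.val := ⟨Q.val_ne_zero⟩

/-- Multiplication by `Q` on the upper half-plane. -/
def scale (z : ℍ) : ℍ :=
  ⟨(Q.val : ℂ) * z, by
    have : 0 < Q.val := Nat.pos_of_ne_zero Q.val_ne_zero
    simpa using mul_pos (Nat.cast_pos.2 this) z.im_pos⟩

theorem coe_scale (z : ℍ) : (Q.scale z : ℂ) = Q.val * z := rfl

theorem det_toGL : Q.toGL.det.val = Q.val := by
  rw [toGL, Matrix.GeneralLinearGroup.val_det_apply]
  change Matrix.det (Q.toMatrix.map (Int.castRingHom ℝ)) = _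
  rw [← RingHom.mapMatrix_apply, ← RingHom.map_det, det_toMatrix]
  simp

theorem det_toGL_pos : 0 < Q.toGL.det.val := by
  rw [det_toGL]; exact_mod_cast Nat.pos_of_ne_zero Q.val_ne_zero

theorem toGL_apply (i j : Fin 2) : Q.toGL i j = (Q.toMatrix i j : ℝ) := rfl

theorem denom_toGL (z : ℍ) : denom Q.toGL z = denom Q.toSL (Q.scale z) := by
  rw [ModularGroup.denom_apply, denom, toGL_apply, toGL_apply, coe_scale]
  have hN : (N : ℂ) = Q.val * ((N / Q.val : ℕ) : ℂ) := by exact_mod_cast Q.mul_div_eq.symm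
  simp only [toMatrix, toSL, Matrix.of_apply, Matrix.cons_val', Matrix.cons_val_zero,
    Matrix.cons_val_one]
  simp only [Complex.ofReal_intCast, Complex.ofReal_natCast, Int.cast_natCast, hN]
  ring

theorem toGL_smul (z : ℍ) : Q.toGL • z = Q.toSL • Q.scale z := by
  ext1
  have h1 : ((Q.toSL • Q.scale z : ℍ) : ℂ) * denom Q.toSL (Q.scale z) = num Q.toGL z := by
    have h := linear_smul ![1, 0] Q.toSL (Q.scale z)
    simp only [Matrix.cons_val_zero, Matrix.cons_val_one, Int.cast_one, one_mul, Int.cast_zero,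
      add_zero] at h
    rw [h, num, toGL_apply, toGL_apply, coe_scale]
    simp [toMatrix, toSL, Matrix.vecMul, dotProduct, Fin.sum_univ_two]
  rw [coe_smul_of_det_pos Q.det_toGL_pos, denom_toGL, ← h1, mul_div_cancel_right₀]
  exact denom_ne_zero _ _

theorem slash_toGL_apply (f : ℍ → ℂ) (z : ℍ) :
    (f ∣[(2 : ℤ)] Q.toGL) z = Q.val * (f ∣[(2 : ℤ)] Q.toSL) (Q.scale z) := by
  rw [ModularForm.slash_apply, ModularForm.SL_slash_apply, ← denom_toGL, toGL_smul, det_toGL, σ,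
    if_pos Q.det_toGL_pos]
  simp
  ring

end ExactDivisor

variable {N : ℕ} [NeZero N]

theorem atkinLehner_poincareForm_apply (Q : ExactDivisor N) {m : ℕ} (hm : 0 < m) (z : ℍ) :
    atkinLehner Q (poincareForm N hm) z = Q.val * poincareSeries N Q.vec m (Q.val * z) := by
  rw [atkinLehner, Q.slash_toGL_apply]
  congr 1
  exact congrFun (poincareSeries_slash N (1, 0) hm Q.toSL) (Q.scale z)

/-- The contribution of the lower left entry `c` to the `n`-th Fourier coefficient of the image of
the Poincaré series under `w_Q`. -/
def poincareCoeff (m n q : ℕ) (c : ℕ+) : ℂ :=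
  (q : ℂ)⁻¹ * (((c : ℕ) : ℂ) ^ 2)⁻¹ * kloostermanSum c m ((n : ZMod c) * (q : ZMod c)⁻¹) *
    besselCoeff (m / (q * (c : ℕ) ^ 2)) n

open Classical in
theorem mul_tsum_poincareTerm (Q : ExactDivisor N) (m : ℕ) (c : ℕ+) (z : ℍ) :
    Q.val * ∑' d : ℤ, poincareTerm N Q.vec m c (Q.val * z) d =
      ∑' n : ℕ, (if c ∈ kloostermanModuli Q then poincareCoeff m n Q.val c else 0) *
        Complex.exp (2 * Real.pi * Complex.I * z) ^ n := by
  have hq : (Q.val : ℂ) ≠ 0 := by exact_mod_cast Q.val_ne_zero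
  have hq' : (Q.val : ℤ) ≠ 0 := by exact_mod_cast Q.val_ne_zero
  have hw : ∀ d : ℤ, poincareTerm N Q.vec m c (Q.val * z) d ≠ 0 →
      N / Q.val ∣ (c : ℕ) ∧ (Q.val : ℤ) ∣ d ∧ IsUnit (d : ZMod c) := by
    intro d hd
    refine ⟨?_, ?_, ?_⟩
    · by_contra h
      refine hd ?_
      rw [poincareTerm, Q.rowWeight_vec, if_neg (fun h' => h (Int.natCast_dvd_natCast.1 h'.1))]
      simp
    · by_contra h
      refine hd ?_
      rw [poincareTerm, Q.rowWeight_vec, if_neg (fun h' => h h'.2)]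
      simp
    · by_contra h
      refine hd ?_
      rw [poincareTerm, kloostermanPhase, if_neg h]
      simp
  by_cases hc : c ∈ kloostermanModuli Q
  · simp only [if_pos hc]
    -- Only multiples of Q contribute; writing d = Qd' gives c·Qz + d = Q(cz + d').
    have h1 : ∑' d : ℤ, poincareTerm N Q.vec m c (Q.val * z) (Q.val * d) =
        ∑' d : ℤ, poincareTerm N Q.vec m c (Q.val * z) d := by
      refine Function.Injective.tsum_eq (g := fun d : ℤ => (Q.val : ℤ) * d)
        (f := fun d => poincareTerm N Q.vec m c (Q.val * z) d) (mul_right_injective₀ hq')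
        fun d hd => ?_
      obtain ⟨k, rfl⟩ := (hw d hd).2.1
      exact ⟨k, rfl⟩
    have h2 : ∀ d : ℤ, poincareTerm N Q.vec m c (Q.val * z) (Q.val * d) =
        ((Q.val : ℂ) ^ 2)⁻¹ * (kloostermanPhase m c ((Q.val : ZMod c) * d) *
          (((((c : ℕ) : ℂ) * z + d) ^ 2)⁻¹ * Complex.exp (-(2 * Real.pi * Complex.I * m /
            (Q.val * (c : ℕ) * ((c : ℕ) * z + d)))))) := by
      intro d
      have e1 : ((c : ℕ) : ℂ) * (Q.val * z) + ((Q.val * d : ℤ) : ℂ) =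
          Q.val * ((c : ℕ) * z + d) := by push_cast; ring
      have e2 : ((Q.val * d : ℤ) : ZMod c) = (Q.val : ZMod c) * d := by push_cast; rfl
      rw [poincareTerm, Q.rowWeight_vec, if_pos ⟨Int.natCast_dvd_natCast.2 hc.1, dvd_mul_right _ _⟩,
        e1, e2, mul_pow, mul_inv, one_mul, mul_left_comm ((c : ℕ) : ℂ), ← mul_assoc (Q.val : ℂ)]
      ring
    rw [← h1, tsum_congr h2, tsum_mul_left, tsum_kloostermanPhase_mul m hc.2, ← tsum_mul_left,
      ← tsum_mul_left]
    refine tsum_congr fun n => ?_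
    rw [poincareCoeff]
    field_simp
  -- A nonzero term needs N/Q ∣ c, Q ∣ d and c prime to d, hence c prime to Q.
  · simp only [if_neg hc, zero_mul, tsum_zero]
    rw [mul_eq_zero]
    right
    have : ∀ d : ℤ, poincareTerm N Q.vec m c (Q.val * z) d = 0 := by
      intro d
      by_contra hd
      obtain ⟨h1, h2, h3⟩ := hw d hd
      refine hc ⟨h1, ?_⟩
      rw [isUnit_intCast_zmod_iff] at h3
      exact Nat.isCoprime_iff_coprime.1 (h3.of_isCoprime_of_dvd_right h2)
    simp only [this, tsum_zero]

theorem norm_poincareCoeff_le {m : ℕ} (hm : 0 < m) (n : ℕ) {q : ℕ} (hq : 0 < q) (c : ℕ+) :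
    ‖poincareCoeff m n q c‖ ≤ 2 * m * poincareMajorant c * ‖besselCoeff (m / (q * (c : ℕ) ^ 2)) n‖ := by
  have hc1 : (1 : ℝ) ≤ (c : ℕ) := by exact_mod_cast c.pos
  have hc0 : (0 : ℝ) < (c : ℕ) := by linarith
  have hq1 : (1 : ℝ) ≤ q := by exact_mod_cast hq
  have h1 := norm_kloostermanSum_le (c : ℕ) hm ((n : ZMod c) * (q : ZMod c)⁻¹)
  have h2 : ((c : ℕ) : ℝ) ^ (3 / 4 : ℝ) * (((c : ℕ) : ℝ) ^ 2)⁻¹ ≤ ((c : ℕ) : ℝ) ^ (-(9 / 8) : ℝ) := by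
    rw [← Real.rpow_natCast _ 2, ← Real.rpow_neg hc0.le, ← Real.rpow_add hc0]
    exact Real.rpow_le_rpow_of_exponent_le hc1 (by norm_num)
  rw [poincareCoeff, norm_mul, norm_mul, norm_mul, norm_inv, norm_inv, norm_pow, Complex.norm_natCast,
    Complex.norm_natCast]
  refine mul_le_mul_of_nonneg_right ?_ (norm_nonneg _)
  calc (q : ℝ)⁻¹ * (((c : ℕ) : ℝ) ^ 2)⁻¹ * ‖kloostermanSum c m ((n : ZMod c) * (q : ZMod c)⁻¹)‖
      ≤ 1 * (((c : ℕ) : ℝ) ^ 2)⁻¹ * (2 * m * ((c : ℕ) : ℝ) ^ (3 / 4 : ℝ) * (c : ℕ).divisors.card) := by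
        gcongr
        exact inv_le_one_of_one_le₀ hq1
    _ = 2 * m * (((c : ℕ) : ℝ) ^ (3 / 4 : ℝ) * (((c : ℕ) : ℝ) ^ 2)⁻¹ * (c : ℕ).divisors.card) := by ring
    _ ≤ _ := by rw [poincareMajorant]; gcongr

theorem div_mul_sq_le (m : ℕ) {q : ℕ} (hq : 0 < q) (c : ℕ+) :
    (m : ℝ) / (q * (c : ℕ) ^ 2) ≤ m := by
  have h : (1 : ℝ) ≤ q * ((c : ℕ) : ℝ) ^ 2 := by
    exact_mod_cast Nat.succ_le_of_lt (Nat.mul_pos hq (pow_pos c.pos 2))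
  exact div_le_self (by positivity) h

/-- All c are allowed: where q is not invertible modulo c the inverse is a default value, harmless
because the Kloosterman bound is uniform in its last argument. -/
theorem summable_poincareCoeff {m : ℕ} (hm : 0 < m) (n : ℕ) {q : ℕ} (hq : 0 < q) :
    Summable fun c => poincareCoeff m n q c := by
  refine Summable.of_norm_bounded ((summable_rpow_mul_card_divisors.mul_left (2 * (m : ℝ))).mul_right
    (Real.exp (4 * Real.pi ^ 2 * m / 1) * (4 * Real.pi ^ 2 * (n * Real.exp (1 * n))))) fun c => ?_
  refine (norm_poincareCoeff_le hm n hq c).trans ?_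
  have := norm_besselCoeff_le (by positivity) (div_mul_sq_le m hq c) one_pos n
  have h2 := poincareMajorant_nonneg c
  exact mul_le_mul_of_nonneg_left this (by positivity)

theorem summable_poincareCoeff_mul_pow {m : ℕ} (hm : 0 < m) {q : ℕ} (hq : 0 < q) (z : ℍ) :
    Summable fun p : ℕ+ × ℕ => poincareCoeff m p.2 q p.1 *
      Complex.exp (2 * Real.pi * Complex.I * z) ^ p.2 := by
  have hb := (summable_rpow_mul_card_divisors.mul_left (2 * (m : ℝ))).mul_of_nonneg
    (summable_mul_exp_pow z (Real.exp (4 * Real.pi ^ 2 * m / (Real.pi * z.im))))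
    (fun c => by positivity) (fun n => by positivity)
  refine Summable.of_norm_bounded hb ?_
  rintro ⟨c, n⟩
  rw [norm_mul]
  have h1 := norm_poincareCoeff_le hm n hq c
  have h3 := norm_besselCoeff_mul_pow_le (by positivity) (div_mul_sq_le m hq c) z n
  rw [norm_mul] at h3
  have h2 := poincareMajorant_nonneg c
  calc _ ≤ 2 * m * poincareMajorant c * ‖besselCoeff (m / (q * (c : ℕ) ^ 2)) n‖ *
        ‖Complex.exp (2 * Real.pi * Complex.I * z) ^ n‖ := by gcongr
    _ ≤ _ := by
      rw [mul_assoc]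
      exact mul_le_mul_of_nonneg_left h3 (by positivity)

end

/-! ### Fourier coefficients in terms of S_Q. -/

noncomputable section

variable {N : ℕ} [NeZero N]

open Classical in
/-- The Fourier coefficients of the image of the Poincaré series under `w_Q`. -/
theorem fourierCoeff₂_atkinLehner_poincareForm (Q : ExactDivisor N) {m : ℕ} (hm : 0 < m)
    {g : CuspForms₂ N} (hg : (g : ℍ → ℂ) = atkinLehner Q (poincareForm N hm)) (n : ℕ) :
    fourierCoeff₂ n g = (if Q = 1 ∧ m = n then 1 else 0) +
      ∑' c : ℕ+, if c ∈ kloostermanModuli Q then poincareCoeff m n Q.val c else 0 := by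
  have hq0 : 0 < Q.val := Nat.pos_of_ne_zero Q.val_ne_zero
  refine (ModularFormClass.qExpansion_coeff_unique one_pos one_mem_strictPeriods_Gamma0
    (c := fun n => (if Q = 1 ∧ m = n then 1 else 0) +
      ∑' c : ℕ+, if c ∈ kloostermanModuli Q then poincareCoeff m n Q.val c else 0)
    (fun z => ?_) n).symm
  have hQ : Function.Periodic.qParam 1 z = Complex.exp (2 * Real.pi * Complex.I * z) := by
    rw [Function.Periodic.qParam]; simp
  simp only [hQ, smul_eq_mul, add_mul, ← tsum_mul_right]
  rw [hg, atkinLehner_poincareForm_apply, poincareSeries, mul_add]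
  refine HasSum.add ?_ ?_
  · by_cases h1 : Q = 1
    · have hw : rowWeight N Q.vec 0 1 = 1 := by
        rw [Q.rowWeight_vec, if_pos]
        exact ⟨dvd_zero _, by rw [h1, ExactDivisor.one_val]; norm_num⟩
      have hv : (Q.val : ℂ) = 1 := by rw [h1, ExactDivisor.one_val, Nat.cast_one]
      rw [hw, hv, one_mul, one_mul, one_mul]
      convert hasSum_single m ?_ using 1
      · rw [if_pos ⟨h1, rfl⟩, one_mul, ← Complex.exp_nat_mul]
        congr 1; ring
      · intro n hn
        rw [if_neg (fun h => hn h.2.symm), zero_mul]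
    · have hw : rowWeight N Q.vec 0 1 = 0 := by
        rw [Q.rowWeight_vec, if_neg]
        rintro ⟨-, h⟩
        refine h1 (ExactDivisor.ext ?_)
        rw [ExactDivisor.one_val]
        exact Nat.dvd_one.1 (by exact_mod_cast h)
      simp only [hw, h1, false_and, if_false, zero_mul, mul_zero]
      exact hasSum_zero
  · have hs : Summable (Function.uncurry fun (c : ℕ+) (n : ℕ) =>
        (if c ∈ kloostermanModuli Q then poincareCoeff m n Q.val c else 0) *
          Complex.exp (2 * Real.pi * Complex.I * z) ^ n) := by
      refine Summable.of_norm_bounded (summable_poincareCoeff_mul_pow hm hq0 z).norm ?_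
      rintro ⟨c, n⟩
      simp only [Function.uncurry]
      split_ifs
      · exact le_rfl
      · rw [zero_mul, norm_zero]; exact norm_nonneg _
    rw [← tsum_mul_left]
    simp only [mul_tsum_poincareTerm]
    rw [← hs.tsum_comm]
    exact hs.prod_symm.prod.hasSum

/-- For x = 4π√(mn)/(c√q), (x/2)² = 4π²mn/(qc²) is the argument of `besselSum`; the factor x/2 of J₁
accounts for n/√(mn). -/
theorem poincareCoeff_eq {m n : ℕ} (hm : 0 < m) (hn : 0 < n) {q : ℕ} (hq : 0 < q) (c : ℕ+) :
    poincareCoeff m n q c =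
      -(n / (√((m : ℝ) * n) : ℂ)) * (2 * Real.pi * kloostermanBesselTerm m n q c) := by
  have hc0 : ((c : ℕ) : ℂ) ≠ 0 := by exact_mod_cast c.ne_zero
  have hs : (√((m : ℝ) * n) : ℂ) ≠ 0 := by
    have : 0 < √((m : ℝ) * n) := by positivity
    exact_mod_cast this.ne'
  have hs2 : (√((m : ℝ) * n) : ℂ) ^ 2 = m * n := by
    rw [← Complex.ofReal_pow, Real.sq_sqrt (by positivity)]; push_cast; rfl
  have hq0 : (√(q : ℝ) : ℂ) ≠ 0 := by
    have : 0 < √(q : ℝ) := by positivity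
    exact_mod_cast this.ne'
  have hq2 : (√(q : ℝ) : ℂ) ^ 2 = q := by
    rw [← Complex.ofReal_pow, Real.sq_sqrt (by positivity)]; push_cast; rfl
  have hx : (4 * Real.pi * (√((m : ℝ) * n) : ℂ) / (((c : ℕ) : ℂ) * (√(q : ℝ) : ℂ)) / 2) ^ 2 =
      4 * Real.pi ^ 2 * ((m / (q * (c : ℕ) ^ 2) : ℝ) : ℂ) * n := by
    rw [div_pow, div_pow, mul_pow, mul_pow, hs2, mul_pow, hq2]
    push_cast
    rw [← hq2]
    field_simp
    ring
  rw [poincareCoeff, kloostermanBesselTerm, besselJOne_eq, hx, besselCoeff]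
  generalize besselSum _ = J
  rw [← hq2]
  field_simp

theorem summable_kloostermanBesselTerm (Q : ExactDivisor N) {m n : ℕ} (hm : 0 < m) (hn : 0 < n) :
    Summable fun c : ℕ+ => kloostermanBesselTerm m n Q.val c := by
  have hq0 : 0 < Q.val := Nat.pos_of_ne_zero Q.val_ne_zero
  have hs : (√((m : ℝ) * n) : ℂ) ≠ 0 := by
    have : 0 < √((m : ℝ) * n) := by positivity
    exact_mod_cast this.ne'
  have hn0 : (n : ℂ) ≠ 0 := by exact_mod_cast hn.ne'
  have hpi : (Real.pi : ℂ) ≠ 0 := by exact_mod_cast Real.pi_ne_zero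
  have h := summable_poincareCoeff hm n hq0
  simp only [poincareCoeff_eq hm hn hq0] at h
  rw [summable_mul_left_iff (neg_ne_zero.2 (div_ne_zero hn0 hs))] at h
  exact (summable_mul_left_iff (mul_ne_zero two_ne_zero hpi)).1 h

open Classical in
/-- The Fourier coefficients of the image of the Poincaré series under `w_Q`, in terms of
Kloosterman sums and Bessel functions. -/
theorem fourierCoeff₂_atkinLehner_poincareForm_eq_sub (Q : ExactDivisor N) {m n : ℕ} (hm : 0 < m)
    (hn : 0 < n) {g : CuspForms₂ N} (hg : (g : ℍ → ℂ) = atkinLehner Q (poincareForm N hm)) :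
    fourierCoeff₂ n g = (if Q = 1 ∧ m = n then 1 else 0) -
      n / (√((m : ℝ) * n) : ℂ) * kloostermanBesselSeries m n Q := by
  have hq0 : 0 < Q.val := Nat.pos_of_ne_zero Q.val_ne_zero
  have h : kloostermanBesselSeries m n Q =
    2 * Real.pi * ∑' c : kloostermanModuli Q, kloostermanBesselTerm m n Q.val c := rfl
  rw [fourierCoeff₂_atkinLehner_poincareForm Q hm hg, sub_eq_add_neg, ← neg_mul, h,
    tsum_subtype (kloostermanModuli Q) fun c => kloostermanBesselTerm m n Q.val c,
    ← tsum_mul_left, ← tsum_mul_left]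
  congr 1
  refine tsum_congr fun c => ?_
  rw [Set.indicator_apply]
  split_ifs
  · exact poincareCoeff_eq hm hn hq0 c
  · simp

end

/-! ### Composition of Atkin–Lehner operators. -/

noncomputable section

/-- Proportional matrices have the same slash action of weight `2`. -/
theorem slash_two_eq_of_proportional (f : ℍ → ℂ) {A B : GL (Fin 2) ℝ} {g : ℝ} (hg : 0 < g)
    (hB : 0 < B.det.val) (h : ∀ i j, A i j = g * B i j) : f ∣[(2 : ℤ)] A = f ∣[(2 : ℤ)] B := by
  have hdet : A.det.val = g ^ 2 * B.det.val := by
    rw [Matrix.GeneralLinearGroup.val_det_apply, Matrix.GeneralLinearGroup.val_det_apply,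
      Matrix.det_fin_two, Matrix.det_fin_two, h, h, h, h]
    ring
  have hA : 0 < A.det.val := by rw [hdet]; positivity
  have hg' : (g : ℂ) ≠ 0 := by exact_mod_cast hg.ne'
  have hden : ∀ z : ℍ, denom A z = g * denom B z := fun z => by
    rw [denom, denom, h, h]; push_cast; ring
  have hnum : ∀ z : ℍ, num A z = g * num B z := fun z => by
    rw [num, num, h, h]; push_cast; ring
  funext z
  have hz : A • z = B • z := by
    ext1
    rw [coe_smul_of_det_pos hA, coe_smul_of_det_pos hB, hden, hnum, mul_div_mul_left _ _ hg']
  rw [ModularForm.slash_apply, ModularForm.slash_apply, σ, if_pos hA, σ, if_pos hB, hz, hden, hdet,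
    abs_of_pos (by positivity), abs_of_pos hB]
  have hd := denom_ne_zero B z
  simp only [ContinuousAlgEquiv.refl_apply, Int.reduceSub, zpow_one, zpow_neg]
  push_cast
  rw [mul_zpow, show ((g:ℂ) ^ (2:ℤ)) = (g:ℂ)^2 from by norm_cast]
  field_simp

namespace ExactDivisor

variable {N : ℕ} [NeZero N] (Q R : ExactDivisor N)

/-- `W_Q W_R` is a multiple of `γ W_{Q * R}` with `γ ∈ Γ₀(N)`. -/
theorem exists_toMatrix_mul : ∃ γ : CongruenceSubgroup.Gamma0 N,
    Q.toMatrix * R.toMatrix = (Nat.gcd Q.val R.val : ℤ) •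
      (((γ : SL(2, ℤ)) : Matrix (Fin 2) (Fin 2) ℤ) * (Q * R).toMatrix) := by
  have hQ := Q.bezout
  have hR := R.bezout
  have hS := (Q * R).bezout
  have hg : 0 < Nat.gcd Q.val R.val :=
    Nat.gcd_pos_of_pos_left _ (Nat.pos_of_ne_zero Q.val_ne_zero)
  obtain ⟨q, hq⟩ := Nat.gcd_dvd_left Q.val R.val
  obtain ⟨r, hr⟩ := Nat.gcd_dvd_right Q.val R.val
  have hs : (Q * R).val = q * r := by
    rw [mul_val, mulVal]
    congr 1
    · exact Nat.div_eq_of_eq_mul_right hg hq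
    · exact Nat.div_eq_of_eq_mul_right hg hr
  have hNs := (Q * R).mul_div_eq
  have hNQ := Q.mul_div_eq
  have hNR := R.mul_div_eq
  have hcop : Nat.Coprime q r := by
    have := Nat.coprime_div_gcd_div_gcd hg
    rwa [Nat.div_eq_of_eq_mul_right hg hq, Nat.div_eq_of_eq_mul_right hg hr] at this
  have hq0 : 0 < q := Nat.pos_of_ne_zero fun h => Q.val_ne_zero (by rw [hq, h, mul_zero])
  have hr0 : 0 < r := Nat.pos_of_ne_zero fun h => R.val_ne_zero (by rw [hr, h, mul_zero])
  set g := Nat.gcd Q.val R.val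
  -- Both q(N/Q) and r(N/R) equal N/g, and q, r are coprime, so r divides N/Q.
  obtain ⟨k, hk⟩ : ∃ k, N = g * (q * r) * k := by
    have h1 : q * (N / Q.val) = r * (N / R.val) := by
      refine Nat.eq_of_mul_eq_mul_left hg ?_
      rw [← mul_assoc, ← hq, ← mul_assoc, ← hr, hNQ, hNR]
    obtain ⟨k, hk⟩ := hcop.symm.dvd_of_dvd_mul_left (Dvd.intro _ h1.symm)
    refine ⟨k, ?_⟩
    conv_lhs => rw [← hNQ, hk, hq]
    ring
  have eQ : N / Q.val = r * k := by
    refine Nat.div_eq_of_eq_mul_right (Nat.pos_of_ne_zero Q.val_ne_zero) ?_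
    exact hk.trans (by rw [hq]; ring)
  have eR : N / R.val = q * k := by
    refine Nat.div_eq_of_eq_mul_right (Nat.pos_of_ne_zero R.val_ne_zero) ?_
    exact hk.trans (by rw [hr]; ring)
  have eS : N / (Q * R).val = g * k := by
    refine Nat.div_eq_of_eq_mul_right (Nat.pos_of_ne_zero (Q * R).val_ne_zero) ?_
    exact hk.trans (by rw [hs]; ring)
  have hk' : (N : ℤ) = g * (q * r) * k := by exact_mod_cast hk
  have hq' : (Q.val : ℤ) = g * q := by exact_mod_cast hq
  have hr' : (R.val : ℤ) = g * r := by exact_mod_cast hr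
  have hs' : ((Q * R).val : ℤ) = q * r := by exact_mod_cast hs
  have eQ' : ((N / Q.val : ℕ) : ℤ) = r * k := by exact_mod_cast eQ
  have eR' : ((N / R.val : ℕ) : ℤ) = q * k := by exact_mod_cast eR
  have eS' : ((N / (Q * R).val : ℕ) : ℤ) = g * k := by exact_mod_cast eS
  rw [hq', eQ'] at hQ
  rw [hr', eR'] at hR
  rw [hs', eS'] at hS
  rw [toMatrix, toMatrix, toMatrix, hq', hr', hs', hk']
  generalize Nat.gcdA Q.val (N / Q.val) = t at *
  generalize Nat.gcdB Q.val (N / Q.val) = y at *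
  generalize Nat.gcdA R.val (N / R.val) = t' at *
  generalize Nat.gcdB R.val (N / R.val) = y' at *
  generalize Nat.gcdA (Q * R).val (N / (Q * R).val) = t'' at *
  generalize Nat.gcdB (Q * R).val (N / (Q * R).val) = y'' at *
  -- These are the entries of the product: W_Q W_R = g·(qr·a, b; N·c, qr·d), the inner matrix having
  -- determinant qr.
  obtain ⟨a, ha⟩ : ∃ a : ℤ, a = g - y * k := ⟨_, rfl⟩
  obtain ⟨b, hb⟩ : ∃ b : ℤ, b = -(q * y') - y * r * t' := ⟨_, rfl⟩
  obtain ⟨c, hc⟩ : ∃ c : ℤ, c = r + q * t := ⟨_, rfl⟩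
  obtain ⟨d, hd⟩ : ∃ d : ℤ, d = -(k * y') + g * t * t' := ⟨_, rfl⟩
  have hdet : q * r * a * d - g * k * b * c = 1 := by
    rw [ha, hb, hc, hd]
    linear_combination hQ + (g * q * t + r * k * y) * hR
  -- This is the inner matrix times the inverse of W_{Q*R}, with the denominator qr cancelled.
  obtain ⟨γ, hγ⟩ : ∃ γ : SL(2, ℤ), (γ : Matrix (Fin 2) (Fin 2) ℤ) =
      !![q * r * a * t'' - b * (g * k), b + a * y''; g * (q * r) * k * (c * t'' - d),
        g * k * c * y'' + q * r * d] := by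
    refine ⟨⟨_, ?_⟩, rfl⟩
    rw [Matrix.det_fin_two_of]
    linear_combination (q * r * t'' + g * k * y'') * hdet + hS
  refine ⟨⟨γ, ?_⟩, ?_⟩
  · rw [CongruenceSubgroup.Gamma0_mem, hγ, ← hk']
    simp
  · change _ = (g : ℤ) • ((γ : Matrix (Fin 2) (Fin 2) ℤ) * _)
    rw [hγ, Matrix.mul_fin_two, Matrix.mul_fin_two, Matrix.smul_of, Matrix.smul_cons,
      Matrix.smul_cons, Matrix.smul_cons, Matrix.smul_cons, Matrix.smul_empty]
    ext i j
    fin_cases i <;> fin_cases j <;> simp only [Fin.zero_eta, Fin.mk_one, Matrix.of_apply,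
      Matrix.cons_val', Matrix.cons_val_zero, Matrix.cons_val_one, Matrix.cons_val_fin_one,
      Pi.smul_apply, smul_eq_mul, Fin.isValue]
    · linear_combination -(g * q * r * a) * hS - g * q * r * ha
    · linear_combination -(g * b) * hS - g * hb
    · linear_combination -(g * (g * (q * r) * k) * c) * hS - g * (g * (q * r) * k) * hc
    · linear_combination -(g * q * r * d) * hS - g * q * r * hd

variable {Q R}

theorem slash_toGL_mul (f : CuspForms₂ N) :
    ((f : ℍ → ℂ) ∣[(2 : ℤ)] Q.toGL) ∣[(2 : ℤ)] R.toGL = (f : ℍ → ℂ) ∣[(2 : ℤ)] (Q * R).toGL := by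
  obtain ⟨γ, hγ⟩ := exists_toMatrix_mul Q R
  have hg : 0 < Nat.gcd Q.val R.val :=
    Nat.gcd_pos_of_pos_left _ (Nat.pos_of_ne_zero Q.val_ne_zero)
  rw [← SlashAction.slash_mul]
  have h := SlashInvariantForm.slash_action_eqn f (Matrix.SpecialLinearGroup.mapGL ℝ (γ : SL(2, ℤ)))
    (Subgroup.mem_map_of_mem _ γ.2)
  conv_rhs => rw [← h, ← SlashAction.slash_mul]
  refine slash_two_eq_of_proportional _ (g := Nat.gcd Q.val R.val) (by exact_mod_cast hg) ?_ ?_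
  · rw [map_mul]
    simpa using (Q * R).det_toGL_pos
  · intro i j
    have := congrArg (fun M : Matrix (Fin 2) (Fin 2) ℤ => (M i j : ℝ)) hγ
    simp only [Matrix.mul_apply, Fin.sum_univ_two, Matrix.smul_apply, smul_eq_mul] at this
    push_cast at this
    simpa [Matrix.mul_apply, Fin.sum_univ_two, toGL_apply] using this

end ExactDivisor

end

/-! ### Expansion of the Poincaré series in the eigenbasis. -/

noncomputable section

variable {N : ℕ} [NeZero N]

/-- The Fourier coefficient `a_n` as a linear form. -/
def fourierCoeffLinearMap (N n : ℕ) : CuspForms₂ N →ₗ[ℂ] ℂ where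
  toFun := fourierCoeff₂ n
  map_add' f g := by
    have h := congrArg (PowerSeries.coeff n)
      (ModularForm.qExpansion_add one_pos (one_mem_strictPeriods_Gamma0 (N := N)) f g)
    rw [map_add] at h
    exact h
  map_smul' a f := by
    have h := congrArg (PowerSeries.coeff n)
      (ModularForm.qExpansion_smul one_pos (one_mem_strictPeriods_Gamma0 (N := N)) a f)
    rw [PowerSeries.coeff_smul] at h
    exact h

theorem integrableOn_petersson {D : Set ℍ} (hD : IsFundamentalDomainGamma0 N D)
    (f g : CuspForms₂ N) : IntegrableOn (petersson 2 f g) D := by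
  have hfin : IsFiniteMeasure (volume.restrict D : Measure ℍ) :=
    ⟨by simpa using volume_lt_top_of_isFundamentalDomainGamma0 hD⟩
  obtain ⟨C, hC⟩ := CuspFormClass.petersson_bounded_left 2 _ f g
  exact Integrable.of_bound (petersson_continuous 2 (CuspFormClass.holo f).continuous
    (CuspFormClass.holo g).continuous).aestronglyMeasurable C (Filter.Eventually.of_forall hC)

/-- The Petersson product as a linear form in its second argument. -/
def peterssonLinearMap {D : Set ℍ} (hD : IsFundamentalDomainGamma0 N D) (f : CuspForms₂ N) :
    CuspForms₂ N →ₗ[ℂ] ℂ where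
  toFun := peterssonInner D f
  map_add' g h := by
    rw [peterssonInner, peterssonInner, peterssonInner,
      ← integral_add (integrableOn_petersson hD f g) (integrableOn_petersson hD f h)]
    congr 1
    funext z
    simp only [petersson, add_apply]
    ring
  map_smul' a g := by
    rw [peterssonInner, peterssonInner, RingHom.id_apply, smul_eq_mul, ← integral_const_mul]
    congr 1
    funext z
    simp only [petersson, smul_apply, smul_eq_mul]
    ring

omit [NeZero N] in
theorem eq_zero_of_fourierCoeff₂_eq_zero {f : CuspForms₂ N}
    (h : ∀ n, 0 < n → fourierCoeff₂ n f = 0) : f = 0 := by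
  have hΓ := one_mem_strictPeriods_Gamma0 (N := N)
  have h0 : qExpansion 1 f = 0 := by
    ext n
    rcases Nat.eq_zero_or_pos n with rfl | hn
    · exact CuspFormClass.qExpansion_coeff_zero f one_pos hΓ
    · exact h n hn
  have : Fact (IsCusp OnePoint.infty
      ((CongruenceSubgroup.Gamma0 N).map (Matrix.SpecialLinearGroup.mapGL ℝ))) :=
    ⟨Subgroup.isCusp_of_mem_strictPeriods one_pos hΓ⟩
  exact DFunLike.coe_injective ((UpperHalfPlane.qExpansion_eq_zero_iff one_pos
    (SlashInvariantFormClass.periodic_comp_ofComplex f hΓ) (CuspFormClass.holo f)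
    (ModularFormClass.bdd_at_infty f)).1 h0)

theorem atkinLehner_sum (Q : ExactDivisor N) {ι : Type*} (s : Finset ι) (a : ι → ℂ)
    (f : ι → CuspForms₂ N) :
    atkinLehner Q (∑ i ∈ s, a i • f i) = ∑ i ∈ s, a i • atkinLehner Q (f i) := by
  have h : ((∑ i ∈ s, a i • f i : CuspForms₂ N) : ℍ → ℂ) = ∑ i ∈ s, a i • (f i : ℍ → ℂ) :=
    map_sum (FunLike.coeAddMonoidHom (CuspForms₂ N) ℍ ℂ) _ _
  rw [atkinLehner, h, SlashAction.sum_slash]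
  refine Finset.sum_congr rfl fun i _ => ?_
  rw [ModularForm.smul_slash, σ, if_pos Q.det_toGL_pos]
  rfl

/-- The eigenvalues of the involutions `w_Q` on a common eigenform form a character. -/
theorem exists_monoidHom_of_eigenform {H : Subgroup (ExactDivisor N)} {f : CuspForms₂ N}
    (hf : f ≠ 0) (h : ∀ Q ∈ H, ∃ c : ℂ, atkinLehner Q f = c • (f : ℍ → ℂ)) :
    ∃ χ : H →* ℂ, ∀ Q : H, atkinLehner (Q : ExactDivisor N) f = χ Q • (f : ℍ → ℂ) := by
  have h' : ∀ Q : H, ∃ c : ℂ, atkinLehner (Q : ExactDivisor N) f = c • (f : ℍ → ℂ) :=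
    fun Q => h Q Q.2
  choose c hc using h'
  have hf0 : (f : ℍ → ℂ) ≠ 0 := fun h0 => hf (DFunLike.coe_injective h0)
  have hmul : ∀ Q R : H, c (Q * R) = c Q * c R := fun Q R => by
    have h1 := ExactDivisor.slash_toGL_mul (Q := (Q : ExactDivisor N)) (R := R) f
    have h2 : atkinLehner ((Q : ExactDivisor N) * (R : ExactDivisor N)) f = c (Q * R) • (f : ℍ → ℂ) := hc (Q * R)
    have h3 := hc Q
    have h4 := hc R
    rw [atkinLehner] at h2 h3 h4
    rw [h2, h3, ModularForm.smul_slash, h4, σ, if_pos (ExactDivisor.det_toGL_pos _)] at h1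
    rw [ContinuousAlgEquiv.refl_apply, smul_smul] at h1
    exact (smul_left_injective ℂ hf0 h1).symm
  -- Multiplicativity makes the eigenvalue idempotent, and it is nonzero because the slash operator
  -- is injective.
  have hone : c 1 = 1 := by
    have h0 : c 1 ≠ 0 := fun h0 => by
      have h1 := hc 1
      rw [h0, zero_smul, atkinLehner, SlashAction.slash_eq_zero_iff] at h1
      exact hf0 h1
    have h1 := hmul 1 1
    rw [mul_one] at h1
    exact (mul_eq_left₀ h0).1 h1.symm
  exact ⟨⟨⟨c, hone⟩, hmul⟩, hc⟩

section Eigenbasis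

variable {D : Set ℍ} {H : Subgroup (ExactDivisor N)} {ι : Type*}
  {B : Module.Basis ι ℂ (CuspForms₂ N)}

theorem IsAtkinLehnerEigenbasis.peterssonInner_eq (hD : IsFundamentalDomainGamma0 N D)
    (hB : IsAtkinLehnerEigenbasis D H B) (f : CuspForms₂ N) (i : ι) :
    peterssonInner D (B i) f = B.repr f i * peterssonInner D (B i) (B i) := by
  have h := congrArg (peterssonLinearMap hD (B i)) (B.linearCombination_repr f)
  rw [Finsupp.linearCombination_apply, Finsupp.sum, map_sum] at h
  change _ = peterssonInner D (B i) f at h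
  rw [← h]
  simp only [map_smul, smul_eq_mul]
  refine (Finset.sum_eq_single i (fun j _ hj => ?_) fun hi => ?_).trans rfl
  · exact mul_eq_zero_of_right _ (hB.orthogonal i j hj.symm)
  · rw [Finsupp.notMem_support_iff.1 hi, zero_mul]

theorem IsAtkinLehnerEigenbasis.conj_fourierCoeff₂_eq (hD : IsFundamentalDomainGamma0 N D)
    (hB : IsAtkinLehnerEigenbasis D H B) {m : ℕ} (hm : 0 < m) (i : ι) :
    conj (fourierCoeff₂ m (B i)) =
      4 * Real.pi * m * (B.repr (poincareForm N hm) i * peterssonInner D (B i) (B i)) := by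
  have hpi : (Real.pi : ℂ) ≠ 0 := by exact_mod_cast Real.pi_ne_zero
  have hm0 : (m : ℂ) ≠ 0 := by exact_mod_cast hm.ne'
  rw [← hB.peterssonInner_eq hD, peterssonInner_poincareForm hD]
  field_simp

/-- If the norm vanished, the formula for conj(a_n) would make every Fourier coefficient zero, hence
the basis member itself. -/
theorem IsAtkinLehnerEigenbasis.peterssonInner_self_ne_zero (hD : IsFundamentalDomainGamma0 N D)
    (hB : IsAtkinLehnerEigenbasis D H B) (i : ι) : peterssonInner D (B i) (B i) ≠ 0 := by
  intro h0
  refine B.ne_zero i (eq_zero_of_fourierCoeff₂_eq_zero fun n hn => ?_)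
  have h := hB.conj_fourierCoeff₂_eq hD hn i
  rwa [h0, mul_zero, mul_zero, map_eq_zero] at h

theorem IsAtkinLehnerEigenbasis.card_mul_restrictedSum_eq [Fintype H]
    (hD : IsFundamentalDomainGamma0 N D) (hB : IsAtkinLehnerEigenbasis D H B) (E : H →* ℤˣ)
    {m n : ℕ} (hm : 0 < m) (hn : 0 < n) :
    (Nat.card H : ℂ) / (4 * Real.pi * m) * restrictedSum D E B m n = (if m = n then 1 else 0) -
      n / (√((m : ℝ) * n) : ℂ) * ∑ Q : H, (((E Q : ℤˣ) : ℤ) : ℂ) *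
        kloostermanBesselSeries m n (Q : ExactDivisor N) := by
  classical
  have hpi : (Real.pi : ℂ) ≠ 0 := by exact_mod_cast Real.pi_ne_zero
  have hm0 : (m : ℂ) ≠ 0 := by exact_mod_cast hm.ne'
  have hE : ∀ Q : H, (((E Q : ℤˣ) : ℤ) : ℂ) * (((E Q : ℤˣ) : ℤ) : ℂ) = 1 := fun Q => by
    rcases Int.units_eq_one_or (E Q) with h | h <;> rw [h] <;> simp
  choose χ hχ using fun i => exists_monoidHom_of_eigenform (B.ne_zero i) (hB.eigenform i)
  set P := poincareForm N hm
  set α := B.repr P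
  set S : Set ι := {i : ι | ∀ Q : H, atkinLehner (Q : ExactDivisor N) (B i) =
      (((E Q : ℤˣ) : ℤ) : ℂ) • (B i : ℍ → ℂ)}
  let ε : H →* ℂ := ((Int.castRingHom ℂ : ℤ →* ℂ).comp (Units.coeHom ℤ)).comp E
  -- Orthogonality of characters: as E² = 1, the product Eχ_i is trivial exactly when χ_i = E.
  have hS : ∀ i, ∑ Q : H, (((E Q : ℤˣ) : ℤ) : ℂ) * χ i Q =
      if i ∈ S then (Nat.card H : ℂ) else 0 := fun i => by
    have hB0 : (B i : ℍ → ℂ) ≠ 0 := fun h0 => B.ne_zero i (DFunLike.coe_injective h0)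
    have h := sum_hom_units (ε * χ i)
    have hiff : ε * χ i = 1 ↔ i ∈ S := by
      constructor
      · intro h1 Q
        have h2 : (((E Q : ℤˣ) : ℤ) : ℂ) * χ i Q = 1 := DFunLike.congr_fun h1 Q
        rw [hχ, ← one_mul (χ i Q), ← hE Q, mul_assoc, h2, mul_one]
      · intro h1
        ext Q
        have h2 := h1 Q
        rw [hχ] at h2
        change (((E Q : ℤˣ) : ℤ) : ℂ) * χ i Q = 1
        rw [smul_left_injective ℂ hB0 h2, hE]
    simp only [hiff, Nat.card_eq_fintype_card] at h ⊢
    exact h.trans (by split_ifs <;> simp)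
  have hP : ∑ i ∈ α.support, α i • B i = P := by
    have h := B.linearCombination_repr P
    rwa [Finsupp.linearCombination_apply, Finsupp.sum] at h
  have hcoeff : ∀ Q : H, ∑ i ∈ α.support, α i * χ i Q * fourierCoeff₂ n (B i) =
      (if (Q : ExactDivisor N) = 1 ∧ m = n then 1 else 0) -
        n / (√((m : ℝ) * n) : ℂ) * kloostermanBesselSeries m n (Q : ExactDivisor N) := fun Q => by
    have hg : ((∑ i ∈ α.support, (α i * χ i Q) • B i : CuspForms₂ N) : ℍ → ℂ) =
        atkinLehner (Q : ExactDivisor N) P := by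
      rw [← hP, atkinLehner_sum]
      refine (map_sum (FunLike.coeAddMonoidHom (CuspForms₂ N) ℍ ℂ) _ _).trans (Finset.sum_congr rfl fun i _ => ?_)
      rw [hχ, smul_smul]
      rfl
    rw [← fourierCoeff₂_atkinLehner_poincareForm_eq_sub _ hm hn hg]
    exact ((map_sum (fourierCoeffLinearMap N n) _ _).trans
      (Finset.sum_congr rfl fun i _ => map_smul _ _ _)).symm
  have hR : restrictedSum D E B m n = 4 * Real.pi * m *
      ∑ i ∈ α.support, if i ∈ S then α i * fourierCoeff₂ n (B i) else 0 := by
    have hterm : ∀ i, conj (fourierCoeff₂ m (B i)) * fourierCoeff₂ n (B i) /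
        peterssonInner D (B i) (B i) = 4 * Real.pi * m * (α i * fourierCoeff₂ n (B i)) := fun i => by
      have := hB.peterssonInner_self_ne_zero hD i
      rw [hB.conj_fourierCoeff₂_eq hD hm]
      change _ * (α i * _) * _ / _ = _
      field_simp
    rw [restrictedSum]
    simp only [hterm]
    -- The terms vanish off the finite support of the coordinates of `P`, so this `finsum` is a true
    -- sum without knowing that the basis is finite.
    rw [finsum_mem_def, finsum_eq_sum_of_support_subset (s := α.support), Finset.mul_sum]
    · refine Finset.sum_congr rfl fun i _ => ?_
      rw [Set.indicator_apply, mul_ite, mul_zero]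
    · intro i hi
      rw [Finset.mem_coe, Finsupp.mem_support_iff]
      intro h0
      refine hi ?_
      rw [Set.indicator_apply, h0, zero_mul, mul_zero, ite_self]
  have hδ : ∑ Q : H, (((E Q : ℤˣ) : ℤ) : ℂ) *
      (if (Q : ExactDivisor N) = 1 ∧ m = n then (1 : ℂ) else 0) = if m = n then 1 else 0 := by
    rw [Finset.sum_eq_single 1]
    · simp
    · intro Q _ hQ
      rw [if_neg fun h => hQ (Subtype.ext h.1), mul_zero]
    · simp
  have h4 : (4 * Real.pi * m : ℂ) ≠ 0 := by simp [hpi, hm0]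
  rw [← hδ, Finset.mul_sum, ← Finset.sum_sub_distrib, hR, ← mul_assoc, div_mul_cancel₀ _ h4,
    Finset.mul_sum]
  calc _ = ∑ i ∈ α.support, ∑ Q : H, (((E Q : ℤˣ) : ℤ) : ℂ) * χ i Q *
        (α i * fourierCoeff₂ n (B i)) := Finset.sum_congr rfl fun i _ => by
        rw [← Finset.sum_mul, hS]; split_ifs <;> simp
    _ = ∑ Q : H, (((E Q : ℤˣ) : ℤ) : ℂ) *
        ∑ i ∈ α.support, α i * χ i Q * fourierCoeff₂ n (B i) := by
        rw [Finset.sum_comm]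
        refine Finset.sum_congr rfl fun Q _ => ?_
        rw [Finset.mul_sum]
        exact Finset.sum_congr rfl fun i _ => by ring
    _ = _ := Finset.sum_congr rfl fun Q _ => by rw [hcoeff]; ring

end Eigenbasis

end

theorem mainTheorem3 (N : ℕ) [NeZero N] (m n : ℕ) (hm : 0 < m) (hn : 0 < n)
    (H : Subgroup (ExactDivisor N)) (E : H →* ℤˣ)
    (D : Set UpperHalfPlane) (hD : IsFundamentalDomainGamma0 N D)
    {ι : Type*} (B : Module.Basis ι ℂ (CuspForms₂ N)) (hB : IsAtkinLehnerEigenbasis D H B) :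
    (∀ Q : ExactDivisor N,
      Summable fun c : kloostermanModuli Q => kloostermanBesselTerm m n Q.val c) ∧
    (Nat.card H : ℂ) / (4 * Real.pi * (√((m : ℝ) * n) : ℂ)) * restrictedSum D E B m n =
      (if m = n then 1 else 0) -
        ∑ᶠ Q : H, (((E Q : ℤˣ) : ℤ) : ℂ) * kloostermanBesselSeries m n (Q : ExactDivisor N) := by
  refine ⟨fun Q => (summable_kloostermanBesselTerm Q hm hn).subtype _, ?_⟩
  have := Fintype.ofFinite H
  rw [finsum_eq_sum_of_fintype]
  have h := hB.card_mul_restrictedSum_eq hD E hm hn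
  have hpi : (Real.pi : ℂ) ≠ 0 := by exact_mod_cast Real.pi_ne_zero
  have hm0 : (m : ℂ) ≠ 0 := by exact_mod_cast hm.ne'
  have hn0 : (n : ℂ) ≠ 0 := by exact_mod_cast hn.ne'
  have hs : (√((m : ℝ) * n) : ℂ) ≠ 0 := by
    have : 0 < √((m : ℝ) * n) := by positivity
    exact_mod_cast this.ne'
  have hs2 : (√((m : ℝ) * n) : ℂ) ^ 2 = m * n := by
    rw [← Complex.ofReal_pow, Real.sq_sqrt (by positivity)]; push_cast; rfl
  have hδ : (√((m : ℝ) * n) : ℂ) / n * (if m = n then 1 else 0) = if m = n then 1 else 0 := by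
    split_ifs with hmn
    · rw [hmn, Real.sqrt_mul_self (Nat.cast_nonneg n), mul_one, Complex.ofReal_natCast,
        div_self hn0]
    · rw [mul_zero]
  -- Scaling by √(mn)/n makes the normalization symmetric in m and n; the factor is 1 when m = n, so
  -- δ is unchanged.
  have h2 : (Nat.card H : ℂ) / (4 * Real.pi * (√((m : ℝ) * n) : ℂ)) =
      (√((m : ℝ) * n) : ℂ) / n * ((Nat.card H : ℂ) / (4 * Real.pi * m)) := by
    field_simp
    rw [hs2, mul_comm]
  rw [h2, mul_assoc, h, mul_sub, hδ, ← mul_assoc, div_mul_div_cancel₀ hn0, div_self hs, one_mul]
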